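/- Theorem. For $n \ge 0$ and a classical constant $c \in \{0,1\}^n$ (bit strings are identified with integers in $\{0,\dots,2^n-1\}$ by binary expansion), the $n$-bit classical–quantum adder is the linear operator on $n$ qubits given by $|x\rangle \mapsto |(x+c) \bmod 2^n\rangle$ for all $x\in\{0,1\}^n$. It can be implemented over the gate set $\{CCX, CX, X\}$ with $\Theta(n\log n)$ gates and $\Theta(\log^2 n)$ circuit depth, using one dirty ancilla qubit. That is, there are circuits $\mathcal C_{n,c}$ on $n+1$ qubits, for all $n$ and all $c\in\{0,1\}^n$, built from gates $CCX$, $CX$, $X$ on arbitrary distinct qubits, such that: 1. for all $n$, all $c$, every state $\psi$ of the $n$-qubit register and every state $\varphi$ of the remaining qubit (the dirty ancilla), $\mathcal C_{n,c}$ maps $\psi\otimes\varphi$ to $(A_c\psi)\otimes\varphi$, where $A_c$ is the adder with constant $c$; 2. there are absolute constants $0<a\le A$ such that $a\,n\log n \le \#\mathrm{gates}(\mathcal C_{n,c}) \le A\,n\log n$ for all $n\ge 2$ and all $c$; 3. there are absolute constants $0<b\le B$ such that $b\,\log^2 n \le \mathrm{depth}(\mathcal C_{n,c}) \le B\,\log^2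 n$ for all $n\ge 2$ and all $c$. Here the depth of a circuit is the number of time steps when every gate is executed as early as possible and gates on disjoint sets of qubits may be executed in the same time step. -/

import Mathlib

namespace QCircuit

/-- A computational basis label of an `m`-qubit register; bit `0` is the least significant bit. -/
abbrev Bits (m : ℕ) : Type := Fin m → Bool

/-- The state space `(ℂ²)^{⊗ m}` of `m` qubits, with amplitudes indexed by bit strings. -/
abbrev QState (m : ℕ) : Type := EuclideanSpace ℂ (Bits m)

/-- The computational basis state `|x⟩`. -/
noncomputable def ket {m : ℕ} (x : Bits m) : QState m := EuclideanSpace.single x 1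

/-- The linear operator on `m` qubits determined by `|x⟩ ↦ |f x⟩` for every bit string `x`. -/
noncomputable def basisOp {m : ℕ} (f : Bits m → Bits m) : QState m →ₗ[ℂ] QState m :=
  (EuclideanSpace.basisFun (Bits m) ℂ).toBasis.constr ℂ fun x => ket (f x)

theorem basisOp_ket {m : ℕ} (f : Bits m → Bits m) (x : Bits m) :
    basisOp f (ket x) = ket (f x) := by
  simp [basisOp, ket]

/-- The product state `ψ ⊗ φ` of an `n`-qubit register in state `ψ` and one further qubit, placed
on the last wire, in state `φ`. -/
noncomputable def tensorLast {n : ℕ} (ψ : QState n) (φ : EuclideanSpace ℂ Bool) : QState (n + 1) :=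
  WithLp.toLp 2 fun y => ψ (Fin.init y) * φ (y (Fin.last n))

/-- A gate from `{CCX, CX, X}` placed on `m` wires: a `C^kX` gate with `k ≤ 2`, given by its set
of `k` control wires and its target wire, all distinct. -/
structure Gate (m : ℕ) where
  controls : Finset (Fin m)
  target : Fin m
  target_notMem : target ∉ controls
  card_le : controls.card ≤ 2

/-- The wires on which a gate acts. -/
def Gate.wires {m : ℕ} (g : Gate m) : Finset (Fin m) := insert g.target g.controls

/-- The action of a gate on bit strings: the target bit is replaced by its exclusive or with the
conjunction of the control bits. -/
def Gate.act {m : ℕ} (g : Gate m) (x : Bits m) : Bits m :=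
  Function.update x g.target (xor (x g.target) (decide (∀ i ∈ g.controls, x i = true)))

/-- A circuit over `{CCX, CX, X}` on `m` wires: its gates in order of application. -/
abbrev Circuit (m : ℕ) : Type := List (Gate m)

/-- The operator on `m` qubits performed by a circuit. -/
noncomputable def Circuit.op {m : ℕ} : Circuit m → QState m →ₗ[ℂ] QState m
  | [] => LinearMap.id
  | g :: C => Circuit.op C ∘ₗ basisOp g.act

/-- The number of gates. -/
def Circuit.gateCount {m : ℕ} (C : Circuit m) : ℕ := C.length

/-- If `d w` is the last time step in which wire `w` has been used so far, then `g` is executed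
in the first time step in which all of its wires are free. -/
def Gate.advance {m : ℕ} (d : Fin m → ℕ) (g : Gate m) : Fin m → ℕ :=
  fun w => if w ∈ g.wires then g.wires.sup d + 1 else d w

/-- The depth: the number of time steps when each gate is executed as early as possible and gates
on disjoint sets of wires may share a time step. Equivalently, the length of a longest chain of
gates in which consecutive gates share a wire. -/
def Circuit.depth {m : ℕ} (C : Circuit m) : ℕ :=
  Finset.univ.sup (C.foldl Gate.advance fun _ => 0)

/-- The map `x ↦ (x + c) mod 2ⁿ` on bit strings of length `n`, read as numbers in binary. -/
def addBits {n : ℕ} (c x : Bits n) : Bits n :=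
  fun i => ((Nat.ofBits x + Nat.ofBits c) % 2 ^ n).testBit i

/-- The `n`-bit classical-quantum adder with constant `c`: `|x⟩ ↦ |(x + c) mod 2ⁿ⟩`. -/
noncomputable def adder {n : ℕ} (c : Bits n) : QState n →ₗ[ℂ] QState n := basisOp (addBits c)

/-- A circuit on `n + 1` wires implements the `n`-qubit operator `U` using one dirty ancilla (the
last wire): it applies `U` to the register and leaves the ancilla, whose state is arbitrary, in the
state it had. -/
def Circuit.ImplementsWithDirtyAncilla {n : ℕ} (C : Circuit (n + 1))
    (U : QState n →ₗ[ℂ] QState n) : Prop :=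
  ∀ (ψ : QState n) (φ : EuclideanSpace ℂ Bool),
    C.op (tensorLast ψ φ) = tensorLast (U ψ) φ

end QCircuit

/-! The adder is built by halving. The carry out of the lower half of the register is first added
into the upper half (`step`); then `c` is added to the two halves independently (`addHalves`). A
step has logarithmic depth and linear size and the two halves are treated in parallel, so the depth
is a sum of about log n logarithms and each of about log n levels costs O(n) gates. A step needs one
borrowed wire outside its register. The ancilla serves only the topmost step; below it each half
lends a wire to the other, which is why the two steps of a level run one after the other.

A borrowed wire `g` transmits a bit `k` by toggling: an involution controlled by `g` is applied
before and after `k` is added to `g`, and the two applications cancel unless `k` is set. The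
involution is the negated increment (`NegInc`), which flips the bits above the lowest unset one.
Adding `g` to all bits before and after `g` is restored turns this into an increment (`run_step`).

For the carry, the register is first xored with `c`, so that set bits are the positions that
propagate. The carry is the constant bit at the highest position that does not propagate
(`carry_eq_xorN`). An increment of the register read from the top flips position `j` by the
conjunction of the positions before it, so suitable parities taken before and after that increment
differ by the carry (`run_addCarry`).

The increment itself has logarithmic depth with borrowed wires only. A high bit changes only if all
low bits are set, and in that event the low bits can be turned into clean workspace. The register
consists of about √m blocks of length about √m above a low part of length O(√m). Flags telling which
blocks are reached by the carry are computed in the low part, and each block is treated with prefix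
conjunctions computed in the three blocks below it. The negated increment preserves all prefix
conjunctions (`NegInc.pre_eq`), so all of this workspace can be uncomputed after the register has
changed (`run_negIncBlocks`). The low part is handled by recursion; its length has about half the
logarithm, so the depths form a geometric series (`inc_bd`). The conjunction of the low part comes
from the same idea of conditionally clean wires, with blocks of doubling length (`run_forward`,
`run_mcx`).

The lower bounds are for this particular circuit. Every step ends with a fan-out, which needs as
many gates as it has targets and contains a chain of logarithmic length. That chain ends on the wire
borrowed by a step of the next level, so the chains concatenate (`le_times_addHalves`). -/

namespace QCircuit

/-! ### Circuits on numbered wires, with bounds on support, depth and size -/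

/-- A `C^kX` gate on wires numbered by `ℕ`. -/
structure NGate where
  controls : List ℕ
  target : ℕ

/-- The action of a gate on assignments of bits to wires. -/
def NGate.act (g : NGate) (σ : ℕ → Bool) : ℕ → Bool :=
  Function.update σ g.target (xor (σ g.target) (g.controls.all σ))

/-- Circuits on wires numbered by `ℕ`. -/
abbrev NCircuit : Type := List NGate

/-- The action of a circuit on assignments of bits to wires. -/
def run (C : NCircuit) (σ : ℕ → Bool) : ℕ → Bool := C.foldl (fun s g => g.act s) σ

@[simp] theorem run_nil (σ : ℕ → Bool) : run [] σ = σ := rfl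

theorem run_cons (g : NGate) (C : NCircuit) (σ : ℕ → Bool) : run (g :: C) σ = run C (g.act σ) := rfl

theorem run_append (C D : NCircuit) (σ : ℕ → Bool) : run (C ++ D) σ = run D (run C σ) := by
  simp [run]

theorem run_single (cs : List ℕ) (t : ℕ) (σ : ℕ → Bool) :
    run [⟨cs, t⟩] σ = Function.update σ t (xor (σ t) (cs.all σ)) := rfl

/-- `Bd S C d k`: the circuit `C` uses valid gates on wires in `S` only, can be scheduled in `d` time
steps, and has at most `k` gates. -/
inductive Bd : Set ℕ → NCircuit → ℕ → ℕ → Prop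
  | nil : Bd ∅ [] 0 0
  | gate {S : Set ℕ} {cs : List ℕ} {t : ℕ} (h : t ∉ cs) (hl : cs.length ≤ 2) (ht : t ∈ S)
      (hc : ∀ c ∈ cs, c ∈ S) : Bd S [⟨cs, t⟩] 1 1
  | seq {S : Set ℕ} {C D : NCircuit} {d e k l : ℕ} (h : Bd S C d k) (h' : Bd S D e l) :
      Bd S (C ++ D) (d + e) (k + l)
  | par {S T : Set ℕ} {C D : NCircuit} {d k l : ℕ} (h : Bd S C d k) (h' : Bd T D d l)
      (hST : Disjoint S T) : Bd (S ∪ T) (C ++ D) d (k + l)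
  | mono {S T : Set ℕ} {C : NCircuit} {d e k l : ℕ} (h : Bd S C d k) (hS : S ⊆ T) (hd : d ≤ e)
      (hk : k ≤ l) : Bd T C e l

namespace Bd

variable {S T : Set ℕ} {C D : NCircuit} {d e k l : ℕ}

theorem nil' : Bd S [] d k := Bd.nil.mono (Set.empty_subset _) (Nat.zero_le _) (Nat.zero_le _)

theorem weaken (h : Bd S C d k) (hd : d ≤ e) (hk : k ≤ l) : Bd S C e l := h.mono subset_rfl hd hk

theorem run_of_notMem (h : Bd S C d k) : ∀ {σ : ℕ → Bool} {w : ℕ}, w ∉ S → run C σ w = σ w := by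
  induction h with
  | nil => intros; rfl
  | gate h hl ht hc =>
    intro σ w hw
    rw [run_single, Function.update_of_ne]
    rintro rfl; exact hw ht
  | seq _ _ ih ih' => intro σ w hw; rw [run_append, ih' hw, ih hw]
  | par _ _ _ ih ih' =>
    intro σ w hw
    rw [run_append, ih' fun h => hw (Or.inr h), ih fun h => hw (Or.inl h)]
  | mono _ hS _ _ ih => intro σ w hw; exact ih fun h => hw (hS h)

/-- Locality: together with `Bd.run_of_notMem` it allows the parts of a circuit on disjoint wires to
be analysed separately. -/
theorem run_congr (h : Bd S C d k) : ∀ {σ τ : ℕ → Bool}, (∀ w ∈ S, σ w = τ w) →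
    ∀ w ∈ S, run C σ w = run C τ w := by
  induction h with
  | nil => intro σ τ h; exact h
  | @gate S cs t h hl ht hc =>
    intro σ τ hστ w hw
    have : cs.all σ = cs.all τ := by
      rw [Bool.eq_iff_iff]; simp only [List.all_eq_true]
      exact forall₂_congr fun c hcs => by rw [hστ c (hc c hcs)]
    rw [run_single, run_single, hστ t ht, this]
    by_cases hwt : w = t
    · subst hwt; simp
    · simp [hwt, hστ w hw]
  | seq _ _ ih ih' =>
    intro σ τ hστ w hw
    rw [run_append, run_append]
    exact ih' (fun w hw => ih hστ w hw) w hw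
  | @par S T C D d k l h h' hST ih ih' =>
    intro σ τ hστ w hw
    rw [run_append, run_append]
    have key : ∀ w ∈ S ∪ T, run C σ w = run C τ w := by
      rintro w hw
      by_cases hS : w ∈ S
      · exact ih (fun w hw => hστ w (Or.inl hw)) w hS
      · rw [h.run_of_notMem hS, h.run_of_notMem hS, hστ w hw]
    by_cases hT : w ∈ T
    · exact ih' (fun w hw => key w (Or.inr hw)) w hT
    · rw [h'.run_of_notMem hT, h'.run_of_notMem hT, key w hw]
  | @mono S T C d e k l h hS _ _ ih =>
    intro σ τ hστ w hw
    by_cases hws : w ∈ S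
    · exact ih (fun w hw => hστ w (hS hw)) w hws
    · rw [h.run_of_notMem hws, h.run_of_notMem hws, hστ w hw]

theorem reverse (h : Bd S C d k) : Bd S C.reverse d k := by
  induction h with
  | nil => exact nil
  | gate h hl ht hc => exact gate h hl ht hc
  | seq _ _ ih ih' =>
    rw [List.reverse_append]; exact (ih'.seq ih).weaken (by omega) (by omega)
  | par _ _ hST ih ih' =>
    rw [List.reverse_append]
    exact (ih'.par ih hST.symm).mono (Set.union_comm _ _).subset le_rfl (by omega)
  | mono _ hS hd hk ih => exact ih.mono hS hd hk

/-- Each gate is an involution because its target is not among its controls. -/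
theorem run_reverse_run (h : Bd S C d k) : ∀ σ : ℕ → Bool, run C.reverse (run C σ) = σ := by
  induction h with
  | nil => intro σ; rfl
  | @gate S cs t h hl ht hc =>
    intro σ
    have : ∀ b, cs.all (Function.update σ t b) = cs.all σ := by
      intro b
      rw [Bool.eq_iff_iff]; simp only [List.all_eq_true]
      refine forall₂_congr fun c hcs => ?_
      rw [Function.update_of_ne]
      rintro rfl; exact h hcs
    rw [List.reverse_singleton, run_single, run_single, this]
    ext w
    by_cases hw : w = t
    · subst hw; simp
    · simp [hw]
  | seq _ _ ih ih' =>
    intro σ; rw [List.reverse_append, run_append, run_append, ih', ih]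
  | par _ _ _ ih ih' =>
    intro σ; rw [List.reverse_append, run_append, run_append, ih', ih]
  | mono _ _ _ _ ih => exact ih

theorem run_run_reverse (h : Bd S C d k) (σ : ℕ → Bool) : run C (run C.reverse σ) = σ := by
  have := h.reverse.run_reverse_run σ
  rwa [List.reverse_reverse] at this

theorem length_le (h : Bd S C d k) : C.length ≤ k := by
  induction h with
  | nil => simp
  | gate => simp
  | seq _ _ ih ih' => rw [List.length_append]; omega
  | par _ _ _ ih ih' => rw [List.length_append]; omega
  | mono _ _ _ hk ih => omega

/-- Conjugating a circuit that only flips a wire outside the conjugating circuit. -/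
theorem run_conj (h : Bd S C d k) {t : ℕ} (ht : t ∉ S) {D : NCircuit} {σ : ℕ → Bool} {b : Bool}
    (hD : run D (run C σ) = Function.update (run C σ) t b) :
    run (C ++ D ++ C.reverse) σ = Function.update σ t b := by
  rw [run_append, run_append, hD]
  have h1 : run C (Function.update σ t b) = Function.update (run C σ) t b := by
    ext w
    by_cases hw : w ∈ S
    · rw [Function.update_of_ne (by rintro rfl; exact ht hw)]
      exact h.run_congr (fun w hw => Function.update_of_ne (by rintro rfl; exact ht hw) _ _) w hw
    · rw [h.run_of_notMem hw]
      by_cases hwt : w = t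
      · subst hwt; simp
      · simp [hwt, h.run_of_notMem hw]
  rw [← h1, h.run_reverse_run]

end Bd

/-! ### Parallel composition and layers of gates -/

/-- The circuits `C 0, …, C (n - 1)` one after the other. -/
def parN (n : ℕ) (C : ℕ → NCircuit) : NCircuit := (List.range n).flatMap C

theorem parN_succ (n : ℕ) (C : ℕ → NCircuit) : parN (n + 1) C = parN n C ++ C n := by
  simp [parN, List.range_succ]

theorem Bd.parN {n : ℕ} {C : ℕ → NCircuit} {S : ℕ → Set ℕ} {T : Set ℕ} {d k : ℕ}
    (h : ∀ i < n, Bd (S i) (C i) d k)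
    (hS : ∀ i < n, ∀ j < n, i ≠ j → ∀ w ∈ S i, w ∉ S j) (hT : ∀ i < n, S i ⊆ T) :
    Bd T (parN n C) d (n * k) := by
  have key : ∀ m ≤ n, Bd {w | ∃ i < m, w ∈ S i} (QCircuit.parN m C) d (m * k) := by
    intro m hm
    induction m with
    | zero => exact Bd.nil'
    | succ m ih =>
      rw [parN_succ]
      refine ((ih (by omega)).par (h m (by omega)) ?_).mono ?_ le_rfl (by rw [Nat.succ_mul])
      · rw [Set.disjoint_left]
        rintro w ⟨i, hi, hw⟩
        exact hS i (by omega) m (by omega) (by omega) w hw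
      · rintro w (⟨i, hi, hw⟩ | hw)
        · exact ⟨i, by omega, hw⟩
        · exact ⟨m, by omega, hw⟩
  refine (key n le_rfl).mono ?_ le_rfl le_rfl
  rintro w ⟨i, hi, hw⟩
  exact hT i hi hw

theorem run_parN {n : ℕ} {C : ℕ → NCircuit} {S : ℕ → Set ℕ} {d k : ℕ → ℕ}
    (h : ∀ i < n, Bd (S i) (C i) (d i) (k i))
    (hS : ∀ i < n, ∀ j < n, i ≠ j → ∀ w ∈ S i, w ∉ S j) (σ : ℕ → Bool) {i : ℕ} (hi : i < n) {w : ℕ}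
    (hw : w ∈ S i) : run (parN n C) σ w = run (C i) σ w := by
  have out : ∀ m ≤ n, ∀ w, (∀ j < m, w ∉ S j) → run (parN m C) σ w = σ w := by
    intro m hm w hw
    induction m with
    | zero => rfl
    | succ m ih =>
      rw [parN_succ, run_append, (h m (by omega)).run_of_notMem (hw m (by omega)),
        ih (by omega) fun j hj => hw j (by omega)]
  have key : ∀ m ≤ n, i < m → run (parN m C) σ w = run (C i) σ w := by
    intro m hm him
    induction m with
    | zero => omega
    | succ m ih =>
      rw [parN_succ, run_append]
      rcases Nat.lt_succ_iff_lt_or_eq.1 him with h1 | h1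
      · rw [(h m (by omega)).run_of_notMem (hS i hi m (by omega) (by omega) w hw),
          ih (by omega) h1]
      · subst h1
        refine (h i hi).run_congr (fun v hv => out i hi.le v fun j hj => ?_) w hw
        exact hS i hi j (by omega) (by omega) v hv
  exact key n le_rfl hi

theorem run_parN_of_notMem {n : ℕ} {C : ℕ → NCircuit} {S : ℕ → Set ℕ} {d k : ℕ → ℕ}
    (h : ∀ i < n, Bd (S i) (C i) (d i) (k i)) (σ : ℕ → Bool) {w : ℕ}
    (hw : ∀ i < n, w ∉ S i) : run (parN n C) σ w = σ w := by
  induction n with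
  | zero => rfl
  | succ m ih =>
    rw [parN_succ, run_append, (h m (by omega)).run_of_notMem (hw m (by omega)),
      ih (fun i hi => h i (by omega)) fun j hj => hw j (by omega)]

/-- The gates with controls `cs i` and target `t i` for `i < n`. -/
def layer (n : ℕ) (cs : ℕ → List ℕ) (t : ℕ → ℕ) : NCircuit := parN n fun i => [⟨cs i, t i⟩]

theorem layer_succ (n : ℕ) (cs : ℕ → List ℕ) (t : ℕ → ℕ) :
    layer (n + 1) cs t = layer n cs t ++ [⟨cs n, t n⟩] := parN_succ _ _

theorem layer_bd {n : ℕ} {cs : ℕ → List ℕ} {t : ℕ → ℕ} {S : Set ℕ}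
    (h : ∀ i < n, t i ∉ cs i) (hl : ∀ i < n, (cs i).length ≤ 2) (ht : ∀ i < n, t i ∈ S)
    (hc : ∀ i < n, ∀ c ∈ cs i, c ∈ S)
    (hd : ∀ i < n, ∀ j < n, i ≠ j → ∀ w ∈ t i :: cs i, w ∉ t j :: cs j) :
    Bd S (layer n cs t) 1 n := by
  refine (Bd.parN (S := fun i => {w | w ∈ t i :: cs i}) (k := 1) (fun i hi =>
    Bd.gate (h i hi) (hl i hi) (by simp) (by intro c hc; simp [hc])) hd ?_).weaken le_rfl (by simp)
  intro i hi w hw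
  rcases List.mem_cons.1 hw with rfl | hw
  · exact ht i hi
  · exact hc i hi w hw

theorem run_layer_of_ne {n : ℕ} {cs : ℕ → List ℕ} {t : ℕ → ℕ} {σ : ℕ → Bool} {w : ℕ}
    (h : ∀ i < n, w ≠ t i) : run (layer n cs t) σ w = σ w := by
  induction n with
  | zero => rfl
  | succ n ih =>
    rw [layer_succ, run_append, run_single, Function.update_of_ne (h n (by omega))]
    exact ih fun i hi => h i (by omega)

theorem run_layer {n : ℕ} {cs : ℕ → List ℕ} {t : ℕ → ℕ} {σ : ℕ → Bool}
    (ht : ∀ i < n, ∀ j < n, t i = t j → i = j) (hc : ∀ i < n, ∀ j < n, t i ∉ cs j) {i : ℕ}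
    (hi : i < n) : run (layer n cs t) σ (t i) = xor (σ (t i)) ((cs i).all σ) := by
  induction n with
  | zero => omega
  | succ n ih =>
    rw [layer_succ, run_append, run_single]
    rcases Nat.lt_succ_iff_lt_or_eq.1 hi with h1 | h1
    · rw [Function.update_of_ne]
      · exact ih (fun i hi j hj => ht i (by omega) j (by omega))
          (fun i hi j hj => hc i (by omega) j (by omega)) h1
      · intro h; have := ht i (by omega) n (by omega) h; omega
    · subst h1
      rw [Function.update_self, run_layer_of_ne]
      · congr 1
        rw [Bool.eq_iff_iff]; simp only [List.all_eq_true]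
        refine forall₂_congr fun c hcs => ?_
        rw [run_layer_of_ne]
        rintro j hj rfl
        exact hc j (by omega) i (by omega) hcs
      · intro j hj h
        have := ht i (by omega) j (by omega) h; omega

theorem Bd.run_update {S : Set ℕ} {C : NCircuit} {d k : ℕ} (h : Bd S C d k) {t : ℕ} (ht : t ∉ S)
    (σ : ℕ → Bool) (b : Bool) :
    run C (Function.update σ t b) = Function.update (run C σ) t b := by
  ext w
  by_cases hw : w ∈ S
  · rw [Function.update_of_ne (by rintro rfl; exact ht hw)]
    exact h.run_congr (fun w hw => Function.update_of_ne (by rintro rfl; exact ht hw) _ _) w hw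
  · rw [h.run_of_notMem hw]
    by_cases hwt : w = t
    · subst hwt; simp
    · simp [hwt, h.run_of_notMem hw]

/-! ### Linear-depth multiply controlled gates -/

/-- Flips `t` if all of `cs` are set, and changes the borrowed wires `d i`. -/
def chain : List ℕ → (ℕ → ℕ) → ℕ → NCircuit
  | [], _, t => [⟨[], t⟩]
  | [c], _, t => [⟨[c], t⟩]
  | c :: c' :: cs, d, t =>
    ⟨[c, d 0], t⟩ :: (chain (c' :: cs) (fun i => d (i + 1)) (d 0) ++ [⟨[c, d 0], t⟩])

/-- The wires of `chain cs d t`. -/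
def chainWires (cs : List ℕ) (d : ℕ → ℕ) (t : ℕ) : Set ℕ :=
  {w | w = t ∨ w ∈ cs ∨ ∃ i, i + 1 < cs.length ∧ w = d i}

/-- Controls, borrowed wires and target are distinct. -/
structure ChainReg (cs : List ℕ) (d : ℕ → ℕ) (t : ℕ) : Prop where
  target : t ∉ cs
  target_ne : ∀ i, i + 1 < cs.length → d i ≠ t
  notMem : ∀ i, i + 1 < cs.length → d i ∉ cs
  inj : ∀ i, i + 1 < cs.length → ∀ j, j + 1 < cs.length → d i = d j → i = j

theorem ChainReg.tail {c c' : ℕ} {cs : List ℕ} {d : ℕ → ℕ} {t : ℕ}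
    (h : ChainReg (c :: c' :: cs) d t) : ChainReg (c' :: cs) (fun i => d (i + 1)) (d 0) where
  target := fun hm => h.notMem 0 (by simp) (List.mem_cons_of_mem _ hm)
  target_ne := fun i hi he => by
    have := h.inj (i + 1) (by simp_all) 0 (by simp) he
    omega
  notMem := fun i hi hm => h.notMem (i + 1) (by simp_all) (List.mem_cons_of_mem _ hm)
  inj := fun i hi j hj he => by
    have := h.inj (i + 1) (by simp_all) (j + 1) (by simp_all) he
    omega

theorem chainWires_tail_subset (c c' : ℕ) (cs : List ℕ) (d : ℕ → ℕ) (t : ℕ) :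
    chainWires (c' :: cs) (fun i => d (i + 1)) (d 0) ⊆ chainWires (c :: c' :: cs) d t := by
  rintro w (rfl | hw | ⟨i, hi, rfl⟩)
  · exact Or.inr (Or.inr ⟨0, by simp, rfl⟩)
  · exact Or.inr (Or.inl (List.mem_cons_of_mem _ hw))
  · exact Or.inr (Or.inr ⟨i + 1, by simp_all, rfl⟩)

theorem ChainReg.notMem_tail {c c' : ℕ} {cs : List ℕ} {d : ℕ → ℕ} {t : ℕ}
    (h : ChainReg (c :: c' :: cs) d t) :
    t ∉ chainWires (c' :: cs) (fun i => d (i + 1)) (d 0) := by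
  rintro (ht | ht | ⟨i, hi, ht⟩)
  · exact h.target_ne 0 (by simp) ht.symm
  · exact h.target (List.mem_cons_of_mem _ ht)
  · exact h.target_ne (i + 1) (by simp_all) ht.symm

theorem chain_bd {cs : List ℕ} {d : ℕ → ℕ} {t : ℕ} (h : ChainReg cs d t) :
    Bd (chainWires cs d t) (chain cs d t) (2 * cs.length + 1) (2 * cs.length + 1) := by
  induction cs generalizing d t with
  | nil => exact Bd.gate (by simp) (by simp) (Or.inl rfl) (by simp)
  | cons c cs ih =>
    cases cs with
    | nil =>
      exact (Bd.gate (by simpa using h.target) (by simp) (Or.inl rfl)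
        (by simp [chainWires])).weaken (by simp) (by simp)
    | cons c' cs =>
      have g : Bd (chainWires (c :: c' :: cs) d t) [⟨[c, d 0], t⟩] 1 1 := by
        refine Bd.gate ?_ (by simp) (Or.inl rfl) ?_
        · simp only [List.mem_cons, List.not_mem_nil, or_false, not_or]
          exact ⟨fun e => h.target (by simp [e]), fun e => h.target_ne 0 (by simp) e.symm⟩
        · simp only [List.mem_cons, List.not_mem_nil, or_false]
          rintro w (rfl | rfl)
          · exact Or.inr (Or.inl (by simp))
          · exact Or.inr (Or.inr ⟨0, by simp, rfl⟩)
      have := (g.seq (((ih h.tail).mono (chainWires_tail_subset c c' cs d t) le_rfl le_rfl).seq g))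
      exact this.weaken (by simp; omega) (by simp; omega)

/-- The chain is a palindrome, so it is its own inverse; `bar` relies on this to restore the
borrowed wires. -/
theorem chain_reverse (cs : List ℕ) (d : ℕ → ℕ) (t : ℕ) :
    (chain cs d t).reverse = chain cs d t := by
  induction cs generalizing d t with
  | nil => rfl
  | cons c cs ih =>
    cases cs with
    | nil => rfl
    | cons c' cs => simp [chain, ih]

/-- The two outer gates add `c ∧ d 0` to `t` before and after `d 0` has been toggled by the
conjunction of the remaining controls, so the unknown value of `d 0` cancels. -/
theorem run_chain_cons {c c' : ℕ} {cs : List ℕ} {d : ℕ → ℕ} {t : ℕ}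
    (h : ChainReg (c :: c' :: cs) d t) (σ : ℕ → Bool)
    (ih : run (chain (c' :: cs) (fun i => d (i + 1)) (d 0)) σ (d 0) =
      xor (σ (d 0)) ((c' :: cs).all σ)) :
    run (chain (c :: c' :: cs) d t) σ =
      Function.update (run (chain (c' :: cs) (fun i => d (i + 1)) (d 0)) σ) t
        (xor (σ t) ((c :: c' :: cs).all σ)) := by
  have hA := chain_bd h.tail
  have htc : c ≠ t := fun e => h.target (by simp [e])
  have htd : d 0 ≠ t := h.target_ne 0 (by simp)
  have hc : run (chain (c' :: cs) (fun i => d (i + 1)) (d 0)) σ c = σ c ∨ c ∈ (c' :: cs) := by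
    by_cases hm : c ∈ (c' :: cs)
    · exact Or.inr hm
    · left
      refine hA.run_of_notMem ?_
      rintro (e | e | ⟨i, hi, e⟩)
      · exact h.notMem 0 (by simp) (by simp [e])
      · exact hm e
      · exact h.notMem (i + 1) (by simp_all) (by simp [e])
  have hc' : run (chain (c' :: cs) (fun i => d (i + 1)) (d 0)) σ c = σ c := by
    rcases hc with hc | hc
    · exact hc
    -- `ChainReg` does not require the controls to be distinct, so `c` may recur in the tail.
    -- Controls are never targets, hence it keeps its value even then.
    · have key : ∀ (cs : List ℕ) (d : ℕ → ℕ) (t : ℕ) (σ : ℕ → Bool), ChainReg cs d t →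
          ∀ c ∈ cs, run (chain cs d t) σ c = σ c := by
        intro cs
        induction cs with
        | nil => simp
        | cons a cs ih =>
          intro d t σ h c hc
          have hct : c ≠ t := fun e => h.target (e ▸ hc)
          cases cs with
          | nil => simp [chain, run_single, hct]
          | cons a' cs =>
            rw [chain, run_cons, run_append, run_single, Function.update_of_ne hct]
            by_cases hm : c ∈ a' :: cs
            · rw [ih _ _ _ h.tail c hm]
              exact Function.update_of_ne hct _ _
            · rw [(chain_bd h.tail).run_of_notMem]
              · exact Function.update_of_ne hct _ _
              · rintro (e | e | ⟨i, hi, e⟩)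
                · exact h.notMem 0 (by simp) (e ▸ hc)
                · exact hm e
                · subst e
                  exact h.notMem (i + 1) (by simp_all) hc
      exact key _ _ _ _ h.tail c hc
  rw [chain, run_cons, run_append, run_single]
  have e1 : NGate.act ⟨[c, d 0], t⟩ σ = Function.update σ t (xor (σ t) (σ c && σ (d 0))) := by
    simp [NGate.act]
  rw [e1, hA.run_update h.notMem_tail]
  ext w
  by_cases hw : w = t
  · subst hw
    simp [htc, htd, ih, hc']
    cases σ w <;> cases σ c <;> cases σ (d 0) <;> simp
  · simp [hw]

theorem run_chain_target {cs : List ℕ} {d : ℕ → ℕ} {t : ℕ} (h : ChainReg cs d t) (σ : ℕ → Bool) :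
    run (chain cs d t) σ t = xor (σ t) (cs.all σ) := by
  induction cs generalizing d t with
  | nil => simp [chain, run_single]
  | cons c cs ih =>
    cases cs with
    | nil => simp [chain, run_single]
    | cons c' cs => rw [run_chain_cons h σ (ih h.tail)]; simp

/-- Flips `t` if all of `cs` are set; the wires `d i` are borrowed. -/
def bar : List ℕ → (ℕ → ℕ) → ℕ → NCircuit
  | c :: c' :: cs, d, t =>
    chain (c :: c' :: cs) d t ++ chain (c' :: cs) (fun i => d (i + 1)) (d 0)
  | cs, d, t => chain cs d t

theorem bar_bd {cs : List ℕ} {d : ℕ → ℕ} {t : ℕ} (h : ChainReg cs d t) :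
    Bd (chainWires cs d t) (bar cs d t) (4 * cs.length + 1) (4 * cs.length + 1) := by
  match cs with
  | [] => exact (chain_bd h).weaken (by simp) (by simp)
  | [c] => exact (chain_bd h).weaken (by simp) (by simp)
  | c :: c' :: cs =>
    have := (chain_bd h).seq
      ((chain_bd h.tail).mono (chainWires_tail_subset c c' cs d t) le_rfl le_rfl)
    exact this.weaken (by simp; omega) (by simp; omega)

/-- The second, shorter chain undoes the changes of the borrowed wires and does not involve `t`. -/
theorem run_bar {cs : List ℕ} {d : ℕ → ℕ} {t : ℕ} (h : ChainReg cs d t) (σ : ℕ → Bool) :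
    run (bar cs d t) σ = Function.update σ t (xor (σ t) (cs.all σ)) := by
  match cs with
  | [] => rfl
  | [c] => rfl
  | c :: c' :: cs =>
    rw [bar, run_append, run_chain_cons h σ (run_chain_target h.tail σ),
      (chain_bd h.tail).run_update h.notMem_tail]
    have := (chain_bd h.tail).run_reverse_run σ
    rw [chain_reverse] at this
    rw [this]

/-! ### Fan-out and parity -/

/-- Adds wire `c` to each of `e 0, …, e (n - 1)`. -/
def fan (c n : ℕ) (e : ℕ → ℕ) : NCircuit :=
  if n = 0 then [] else if n = 1 then [⟨[c], e 0⟩] else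
    layer (n / 2) (fun i => [e (2 * i)]) (fun i => e (2 * i + 1)) ++
      (fan c ((n + 1) / 2) (fun i => e (2 * i)) ++
        layer (n / 2) (fun i => [e (2 * i)]) (fun i => e (2 * i + 1)))
termination_by n

theorem clog_half {n : ℕ} (h : 2 ≤ n) : Nat.clog 2 n = Nat.clog 2 ((n + 1) / 2) + 1 := by
  rw [Nat.clog_of_two_le one_lt_two h, show n + 2 - 1 = n + 1 by omega]

theorem fan_bd {c n : ℕ} {e : ℕ → ℕ} {S : Set ℕ} (hc : c ∈ S) (he : ∀ i < n, e i ∈ S)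
    (hce : ∀ i < n, c ≠ e i) (hinj : ∀ i < n, ∀ j < n, e i = e j → i = j) :
    Bd S (fan c n e) (2 * Nat.clog 2 n + 1) (2 * n) := by
  induction n using Nat.strong_induction_on generalizing e with
  | _ n ih =>
    rw [fan]
    split_ifs with h0 h1
    · exact Bd.nil'
    · subst h1
      exact (Bd.gate (by simpa using fun h => hce 0 (by omega) h.symm) (by simp) (he 0 (by omega))
        (by simpa using hc)).weaken (by simp) (by simp)
    · have hL : Bd S (layer (n / 2) (fun i => [e (2 * i)]) (fun i => e (2 * i + 1))) 1 (n / 2) := by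
        refine layer_bd ?_ (by simp) (fun i hi => he _ (by omega)) ?_ ?_
        · intro i hi; simp only [List.mem_singleton]; intro h
          have := hinj _ (by omega) _ (by omega) h; omega
        · intro i hi w hw; rw [List.mem_singleton.1 hw]; exact he _ (by omega)
        · intro i hi j hj hij w hw hw'
          simp only [List.mem_cons, List.not_mem_nil, or_false] at hw hw'
          rcases hw with rfl | rfl <;> rcases hw' with h | h <;>
            · have := hinj _ (by omega) _ (by omega) h; omega
      have hF := ih ((n + 1) / 2) (by omega) (e := fun i => e (2 * i)) (fun i hi => he _ (by omega))
        (fun i hi => hce _ (by omega)) (fun i hi j hj h => by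
          have := hinj _ (by omega) _ (by omega) h; omega)
      have := clog_half (n := n) (by omega)
      exact (hL.seq (hF.seq hL)).weaken (by omega) (by omega)

/-- The odd wire of each pair receives its even neighbour once before and once after the latter has
been changed by `c`; the difference is `c`. Only the even wires enter the recursion. -/
theorem run_fan {c n : ℕ} {e : ℕ → ℕ} (hce : ∀ i < n, c ≠ e i)
    (hinj : ∀ i < n, ∀ j < n, e i = e j → i = j) (σ : ℕ → Bool) :
    (∀ i < n, run (fan c n e) σ (e i) = xor (σ (e i)) (σ c)) ∧
      ∀ w, (∀ i < n, w ≠ e i) → run (fan c n e) σ w = σ w := by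
  induction n using Nat.strong_induction_on generalizing e σ with
  | _ n ih =>
    rw [fan]
    split_ifs with h0 h1
    · subst h0; simp
    · subst h1
      refine ⟨fun i hi => ?_, fun w hw => ?_⟩
      · obtain rfl : i = 0 := by omega
        simp [run_single]
      · simp [run_single, hw 0 (by omega)]
    · simp only [run_append]
      have Lt : ∀ (τ : ℕ → Bool) (i : ℕ), i < n / 2 →
          run (layer (n / 2) (fun i => [e (2 * i)]) (fun i => e (2 * i + 1))) τ (e (2 * i + 1)) =
            xor (τ (e (2 * i + 1))) (τ (e (2 * i))) := by
        intro τ i hi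
        have := run_layer (n := n / 2) (cs := fun i => [e (2 * i)]) (t := fun i => e (2 * i + 1))
          (σ := τ) (fun i hi j hj h => by have := hinj _ (by omega) _ (by omega) h; omega)
          (fun i hi j hj h => by
            have := hinj _ (by omega) _ (by omega) (List.mem_singleton.1 h); omega) hi
        simpa using this
      have Ln : ∀ (τ : ℕ → Bool) (w : ℕ), (∀ i < n / 2, w ≠ e (2 * i + 1)) →
          run (layer (n / 2) (fun i => [e (2 * i)]) (fun i => e (2 * i + 1))) τ w = τ w :=
        fun τ w hw => run_layer_of_ne hw
      have Le : ∀ (τ : ℕ → Bool) (i : ℕ), 2 * i < n →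
          run (layer (n / 2) (fun i => [e (2 * i)]) (fun i => e (2 * i + 1))) τ (e (2 * i)) =
            τ (e (2 * i)) := by
        intro τ i hi
        refine Ln τ _ fun j hj h => ?_
        have := hinj _ (by omega) _ (by omega) h; omega
      have F := fun τ => ih ((n + 1) / 2) (by omega) (e := fun i => e (2 * i))
        (fun i hi => hce _ (by omega)) (fun i hi j hj h => by
          have := hinj _ (by omega) _ (by omega) h; omega) τ
      refine ⟨fun i hi => ?_, fun w hw => ?_⟩
      · obtain ⟨k, rfl | rfl⟩ : ∃ k, i = 2 * k ∨ i = 2 * k + 1 := ⟨i / 2, by omega⟩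
        · rw [Le _ _ hi, (F _).1 k (by omega), Le _ _ hi, Ln _ _ fun i hi => hce _ (by omega)]
        · rw [Lt _ _ (by omega), (F _).1 k (by omega), (F _).2, Lt _ _ (by omega),
            Le _ _ (by omega), Ln _ _ fun i hi => hce _ (by omega)]
          · cases σ (e (2 * k + 1)) <;> cases σ (e (2 * k)) <;> cases σ c <;> rfl
          · intro j hj h
            have := hinj _ (by omega) _ (by omega) h; omega
      · rw [Ln _ _ fun i hi => hw _ (by omega), (F _).2 w fun i hi => hw _ (by omega),
          Ln _ _ fun i hi => hw _ (by omega)]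

/-- The exclusive or of `v 0, …, v (n - 1)`. -/
def xorN (v : ℕ → Bool) : ℕ → Bool
  | 0 => false
  | n + 1 => xor (xorN v n) (v n)

theorem xorN_congr {v v' : ℕ → Bool} {n : ℕ} (h : ∀ i < n, v i = v' i) :
    xorN v n = xorN v' n := by
  induction n with
  | zero => rfl
  | succ n ih => rw [xorN, xorN, ih fun i hi => h i (by omega), h n (by omega)]

theorem xorN_xor (v v' : ℕ → Bool) (n : ℕ) :
    xorN (fun i => xor (v i) (v' i)) n = xor (xorN v n) (xorN v' n) := by
  induction n with
  | zero => rfl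
  | succ n ih =>
    simp only [xorN, ih]
    cases xorN v n <;> cases xorN v' n <;> cases v n <;> cases v' n <;> rfl

theorem xorN_pairs (v : ℕ → Bool) (n : ℕ) :
    xorN (fun i => xor (v (2 * i)) (v (2 * i + 1))) n = xorN v (2 * n) := by
  induction n with
  | zero => rfl
  | succ n ih =>
    rw [show 2 * (n + 1) = 2 * n + 1 + 1 by ring]
    simp only [xorN, ih]
    cases xorN v (2 * n) <;> cases v (2 * n) <;> cases v (2 * n + 1) <;> rfl

/-- Adds the parity of the wires `e 0, …, e (n - 1)` to `g`. -/
def parity (g n : ℕ) (e : ℕ → ℕ) : NCircuit :=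
  if n = 0 then [] else if n = 1 then [⟨[e 0], g⟩] else
    layer (n / 2) (fun i => [e (2 * i + 1)]) (fun i => e (2 * i)) ++
      (parity g ((n + 1) / 2) (fun i => e (2 * i)) ++
        layer (n / 2) (fun i => [e (2 * i + 1)]) (fun i => e (2 * i)))
termination_by n

theorem parity_bd {g n : ℕ} {e : ℕ → ℕ} {S : Set ℕ} (hg : g ∈ S) (he : ∀ i < n, e i ∈ S)
    (hge : ∀ i < n, g ≠ e i) (hinj : ∀ i < n, ∀ j < n, e i = e j → i = j) :
    Bd S (parity g n e) (2 * Nat.clog 2 n + 1) (2 * n) := by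
  induction n using Nat.strong_induction_on generalizing e with
  | _ n ih =>
    rw [parity]
    split_ifs with h0 h1
    · exact Bd.nil'
    · subst h1
      exact (Bd.gate (by simpa using fun h => hge 0 (by omega) h) (by simp) hg
        (by simpa using he 0 (by omega))).weaken (by simp) (by simp)
    · have hL : Bd S (layer (n / 2) (fun i => [e (2 * i + 1)]) (fun i => e (2 * i))) 1 (n / 2) := by
        refine layer_bd ?_ (by simp) (fun i hi => he _ (by omega)) ?_ ?_
        · intro i hi; simp only [List.mem_singleton]; intro h
          have := hinj _ (by omega) _ (by omega) h; omega
        · intro i hi w hw; rw [List.mem_singleton.1 hw]; exact he _ (by omega)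
        · intro i hi j hj hij w hw hw'
          simp only [List.mem_cons, List.not_mem_nil, or_false] at hw hw'
          rcases hw with rfl | rfl <;> rcases hw' with h | h <;>
            · have := hinj _ (by omega) _ (by omega) h; omega
      have hF := ih ((n + 1) / 2) (by omega) (e := fun i => e (2 * i)) (fun i hi => he _ (by omega))
        (fun i hi => hge _ (by omega)) (fun i hi j hj h => by
          have := hinj _ (by omega) _ (by omega) h; omega)
      have := clog_half (n := n) (by omega)
      exact (hL.seq (hF.seq hL)).weaken (by omega) (by omega)

/-- Mirror image of the fan-out: each even wire absorbs its odd neighbour, the recursion sums the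
even wires into `g`, and the second layer restores them. -/
theorem run_parity {g n : ℕ} {e : ℕ → ℕ} (hge : ∀ i < n, g ≠ e i)
    (hinj : ∀ i < n, ∀ j < n, e i = e j → i = j) (σ : ℕ → Bool) :
    run (parity g n e) σ = Function.update σ g (xor (σ g) (xorN (fun i => σ (e i)) n)) := by
  induction n using Nat.strong_induction_on generalizing e σ with
  | _ n ih =>
    rw [parity]
    split_ifs with h0 h1
    · subst h0; simp [xorN]
    · subst h1; simp [run_single, xorN]
    · set L := layer (n / 2) (fun i => [e (2 * i + 1)]) (fun i => e (2 * i)) with hLdef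
      have Lt : ∀ (τ : ℕ → Bool) (i : ℕ), i < n / 2 → run L τ (e (2 * i)) =
            xor (τ (e (2 * i))) (τ (e (2 * i + 1))) := by
        intro τ i hi
        have := run_layer (n := n / 2) (cs := fun i => [e (2 * i + 1)]) (t := fun i => e (2 * i))
          (σ := τ) (fun i hi j hj h => by have := hinj _ (by omega) _ (by omega) h; omega)
          (fun i hi j hj h => by
            have := hinj _ (by omega) _ (by omega) (List.mem_singleton.1 h); omega) hi
        simpa using this
      have Ln : ∀ (τ : ℕ → Bool) (w : ℕ), (∀ i < n / 2, w ≠ e (2 * i)) → run L τ w = τ w :=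
        fun τ w hw => run_layer_of_ne hw
      have F := fun τ => ih ((n + 1) / 2) (by omega) (e := fun i => e (2 * i))
        (fun i hi => hge _ (by omega)) (fun i hi j hj h => by
          have := hinj _ (by omega) _ (by omega) h; omega) τ
      have hsum : xorN (fun i => run L σ (e (2 * i))) ((n + 1) / 2) =
          xorN (fun i => σ (e i)) n := by
        have h2 : xorN (fun i => run L σ (e (2 * i))) (n / 2) =
            xorN (fun i => σ (e i)) (2 * (n / 2)) := by
          rw [← xorN_pairs]
          exact xorN_congr fun i hi => Lt σ i hi
        rcases Nat.even_or_odd' n with ⟨k, rfl | rfl⟩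
        · rw [show (2 * k + 1) / 2 = 2 * k / 2 by omega, h2]; congr 1; omega
        · rw [show (2 * k + 1) / 2 = k by omega] at h2
          -- For an odd number of wires the last one has no partner and enters the recursion
          -- unchanged.
          rw [show (2 * k + 1 + 1) / 2 = k + 1 by omega, xorN, xorN, h2, Ln]
          intro i hi h
          have := hinj _ (by omega) _ (by omega) h; omega
      rw [run_append, run_append, F, hsum]
      have hg : run L σ g = σ g := Ln σ g fun i hi => hge _ (by omega)
      rw [hg]
      ext w
      by_cases hw : ∃ i < n / 2, w = e (2 * i)
      · obtain ⟨i, hi, rfl⟩ := hw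
        rw [Lt _ _ hi, Function.update_of_ne (hge _ (by omega)).symm,
          Function.update_of_ne (hge _ (by omega)).symm,
          Function.update_of_ne (hge _ (by omega)).symm, Lt _ _ hi, Ln]
        · simp
        · intro j hj h
          have := hinj _ (by omega) _ (by omega) h; omega
      · push Not at hw
        rw [Ln _ _ hw]
        by_cases hwg : w = g
        · subst hwg; simp
        · simp [hwg, Ln σ w hw]

/-! ### Prefix conjunctions -/

/-- The conjunction of `v 0, …, v (n - 1)`. -/
def pre (v : ℕ → Bool) : ℕ → Bool
  | 0 => true
  | n + 1 => pre v n && v n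

theorem pre_eq_true {v : ℕ → Bool} {n : ℕ} : pre v n = true ↔ ∀ i < n, v i = true := by
  induction n with
  | zero => simp [pre]
  | succ n ih =>
    rw [pre, Bool.and_eq_true, ih]
    constructor
    · rintro ⟨h, h'⟩ i hi
      rcases Nat.lt_succ_iff_lt_or_eq.1 hi with h1 | rfl
      · exact h i h1
      · exact h'
    · exact fun h => ⟨fun i hi => h i (by omega), h n (by omega)⟩

theorem pre_congr {v v' : ℕ → Bool} {n : ℕ} (h : ∀ i < n, v i = v' i) : pre v n = pre v' n := by
  rw [Bool.eq_iff_iff, pre_eq_true, pre_eq_true]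
  exact forall₂_congr fun i hi => by rw [h i hi]

theorem pre_add (v : ℕ → Bool) (m n : ℕ) :
    pre v (m + n) = (pre v m && pre (fun i => v (m + i)) n) := by
  induction n with
  | zero => simp [pre]
  | succ n ih => rw [← add_assoc, pre, pre, ih, Bool.and_assoc]

theorem pre_pairs (v : ℕ → Bool) (n : ℕ) :
    pre (fun i => v (2 * i) && v (2 * i + 1)) n = pre v (2 * n) := by
  induction n with
  | zero => rfl
  | succ n ih => rw [show 2 * (n + 1) = 2 * n + 1 + 1 by ring, pre, ih, pre, pre, Bool.and_assoc]

/-- The wires used by `scan n x o z` are distinct. -/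
structure ScanReg (n : ℕ) (x o z : ℕ → ℕ) : Prop where
  x_inj : ∀ i < n, ∀ j < n, x i = x j → i = j
  o_inj : ∀ i ≤ n, ∀ j ≤ n, o i = o j → i = j
  z_inj : ∀ i < n, ∀ j < n, z i = z j → i = j
  xo : ∀ i < n, ∀ j ≤ n, x i ≠ o j
  xz : ∀ i < n, ∀ j < n, x i ≠ z j
  zo : ∀ i < n, ∀ j ≤ n, z i ≠ o j

/-- The recursion scans the pair conjunctions stored on the first half of `z`, writes to the even
outputs and has the rest of `z` as workspace. -/
theorem ScanReg.half {n : ℕ} {x o z : ℕ → ℕ} (h : ScanReg n x o z) :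
    ScanReg (n / 2) z (fun i => o (2 * i)) (fun i => z (n / 2 + i)) where
  x_inj := fun i hi j hj => h.z_inj i (by omega) j (by omega)
  o_inj := fun i hi j hj e => by have := h.o_inj _ (by omega) _ (by omega) e; omega
  z_inj := fun i hi j hj e => by have := h.z_inj _ (by omega) _ (by omega) e; omega
  xo := fun i hi j hj => h.zo i (by omega) _ (by omega)
  xz := fun i hi j hj e => by have := h.z_inj _ (by omega) _ (by omega) e; omega
  zo := fun i hi j hj => h.zo _ (by omega) _ (by omega)

/-- Computes `o 0 ∧ x 0 ∧ … ∧ x (j - 1)` on the clean wire `o j` for `1 ≤ j ≤ n`, by means of the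
clean wires `z i`. -/
def scan (n : ℕ) (x o z : ℕ → ℕ) : NCircuit :=
  if n = 0 then [] else
    layer (n / 2) (fun i => [x (2 * i), x (2 * i + 1)]) z ++
      (scan (n / 2) z (fun i => o (2 * i)) (fun i => z (n / 2 + i)) ++
        (layer ((n + 1) / 2) (fun i => [x (2 * i), o (2 * i)]) (fun i => o (2 * i + 1)) ++
          layer (n / 2) (fun i => [x (2 * i), x (2 * i + 1)]) z))
termination_by n

theorem scan_bd {n : ℕ} {x o z : ℕ → ℕ} {S : Set ℕ} (h : ScanReg n x o z) (hx : ∀ i < n, x i ∈ S)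
    (ho : ∀ i ≤ n, o i ∈ S) (hz : ∀ i < n, z i ∈ S) :
    Bd S (scan n x o z) (3 * Nat.clog 2 n + 3) (4 * n) := by
  induction n using Nat.strong_induction_on generalizing x o z with
  | _ n ih =>
    rw [scan]
    split_ifs with h0
    · exact Bd.nil'
    · have hA : Bd S (layer (n / 2) (fun i => [x (2 * i), x (2 * i + 1)]) z) 1 (n / 2) := by
        refine layer_bd ?_ (by simp) (fun i hi => hz _ (by omega)) ?_ ?_
        · intro i hi hm
          simp only [List.mem_cons, List.not_mem_nil, or_false] at hm
          rcases hm with hm | hm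
          · exact h.xz _ (by omega) _ (by omega) hm.symm
          · exact h.xz _ (by omega) _ (by omega) hm.symm
        · intro i hi w hw
          simp only [List.mem_cons, List.not_mem_nil, or_false] at hw
          rcases hw with rfl | rfl <;> exact hx _ (by omega)
        · intro i hi j hj hij w hw hw'
          simp only [List.mem_cons, List.not_mem_nil, or_false] at hw hw'
          rcases hw with rfl | rfl | rfl <;> rcases hw' with e | e | e <;>
            first
            | (have := h.x_inj _ (by omega) _ (by omega) e; omega)
            | (have := h.z_inj _ (by omega) _ (by omega) e; omega)
            | exact h.xz _ (by omega) _ (by omega) e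
            | exact h.xz _ (by omega) _ (by omega) e.symm
      have hB : Bd S (layer ((n + 1) / 2) (fun i => [x (2 * i), o (2 * i)])
          (fun i => o (2 * i + 1))) 1 ((n + 1) / 2) := by
        refine layer_bd ?_ (by simp) (fun i hi => ho _ (by omega)) ?_ ?_
        · intro i hi hm
          simp only [List.mem_cons, List.not_mem_nil, or_false] at hm
          rcases hm with hm | hm
          · exact h.xo _ (by omega) _ (by omega) hm.symm
          · have := h.o_inj _ (by omega) _ (by omega) hm; omega
        · intro i hi w hw
          simp only [List.mem_cons, List.not_mem_nil, or_false] at hw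
          rcases hw with rfl | rfl
          · exact hx _ (by omega)
          · exact ho _ (by omega)
        · intro i hi j hj hij w hw hw'
          simp only [List.mem_cons, List.not_mem_nil, or_false] at hw hw'
          rcases hw with rfl | rfl | rfl <;> rcases hw' with e | e | e <;>
            first
            | (have := h.x_inj _ (by omega) _ (by omega) e; omega)
            | (have := h.o_inj _ (by omega) _ (by omega) e; omega)
            | exact h.xo _ (by omega) _ (by omega) e
            | exact h.xo _ (by omega) _ (by omega) e.symm
      -- For `n = 1` the recursive call is empty and halving does not lower `Nat.clog`; the additive
      -- constant 3 pays for the three layers.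
      rcases Nat.lt_or_ge n 2 with hn | hn
      · obtain rfl : n = 1 := by omega
        have hS : Bd S (scan (1 / 2) z (fun i => o (2 * i)) (fun i => z (1 / 2 + i))) 0 0 := by
          rw [scan]; exact Bd.nil'
        exact (hA.seq (hS.seq (hB.seq hA))).weaken (by omega) (by omega)
      · have hS := ih (n / 2) (by omega) h.half (fun i hi => hz _ (by omega))
          (fun i hi => ho _ (by omega)) (fun i hi => hz _ (by omega))
        have h1 := clog_half hn
        have h2 : Nat.clog 2 (n / 2) ≤ Nat.clog 2 ((n + 1) / 2) :=
          Nat.clog_mono_right 2 (by omega)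
        exact (hA.seq (hS.seq (hB.seq hA))).weaken (by omega) (by omega)

/-- Even prefixes are prefixes of the sequence of pair conjunctions and come from the recursion; an
odd prefix is the preceding even one with one more factor. The pair conjunctions are then
uncomputed, so only the outputs change. -/
theorem run_scan {n : ℕ} {x o z : ℕ → ℕ} (h : ScanReg n x o z) {σ : ℕ → Bool}
    (ho : ∀ i, 1 ≤ i → i ≤ n → σ (o i) = false) (hz : ∀ i < n, σ (z i) = false) :
    (∀ j ≤ n, run (scan n x o z) σ (o j) = (σ (o 0) && pre (fun i => σ (x i)) j)) ∧
      ∀ w, (∀ j, 1 ≤ j → j ≤ n → w ≠ o j) → run (scan n x o z) σ w = σ w := by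
  induction n using Nat.strong_induction_on generalizing x o z σ with
  | _ n ih =>
    rw [scan]
    split_ifs with h0
    · subst h0
      refine ⟨fun j hj => ?_, fun w _ => rfl⟩
      obtain rfl : j = 0 := by omega
      simp [pre]
    · set A := layer (n / 2) (fun i => [x (2 * i), x (2 * i + 1)]) z with hA
      set B := layer ((n + 1) / 2) (fun i => [x (2 * i), o (2 * i)]) (fun i => o (2 * i + 1)) with hB
      have At : ∀ (τ : ℕ → Bool) (i : ℕ), i < n / 2 →
          run A τ (z i) = xor (τ (z i)) (τ (x (2 * i)) && τ (x (2 * i + 1))) := by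
        intro τ i hi
        have := run_layer (n := n / 2) (cs := fun i => [x (2 * i), x (2 * i + 1)]) (t := z) (σ := τ)
          (fun i hi j hj => h.z_inj i (by omega) j (by omega)) (fun i hi j hj hm => by
            simp only [List.mem_cons, List.not_mem_nil, or_false] at hm
            rcases hm with e | e <;> exact h.xz _ (by omega) _ (by omega) e.symm) hi
        simpa using this
      have An : ∀ (τ : ℕ → Bool) (w : ℕ), (∀ i < n / 2, w ≠ z i) → run A τ w = τ w :=
        fun τ w hw => run_layer_of_ne hw
      have Bt : ∀ (τ : ℕ → Bool) (i : ℕ), i < (n + 1) / 2 →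
          run B τ (o (2 * i + 1)) = xor (τ (o (2 * i + 1))) (τ (x (2 * i)) && τ (o (2 * i))) := by
        intro τ i hi
        have := run_layer (n := (n + 1) / 2) (cs := fun i => [x (2 * i), o (2 * i)])
          (t := fun i => o (2 * i + 1)) (σ := τ)
          (fun i hi j hj e => by have := h.o_inj _ (by omega) _ (by omega) e; omega)
          (fun i hi j hj hm => by
            simp only [List.mem_cons, List.not_mem_nil, or_false] at hm
            rcases hm with e | e
            · exact h.xo _ (by omega) _ (by omega) e.symm
            · have := h.o_inj _ (by omega) _ (by omega) e; omega) hi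
        simpa using this
      have Bn : ∀ (τ : ℕ → Bool) (w : ℕ), (∀ i < (n + 1) / 2, w ≠ o (2 * i + 1)) →
          run B τ w = τ w := fun τ w hw => run_layer_of_ne hw
      have Ao : ∀ (τ : ℕ → Bool), ∀ j ≤ n, run A τ (o j) = τ (o j) := fun τ j hj =>
        An τ _ fun i hi e => h.zo _ (by omega) _ hj e.symm
      have Ax : ∀ (τ : ℕ → Bool), ∀ j < n, run A τ (x j) = τ (x j) := fun τ j hj =>
        An τ _ fun i hi e => h.xz _ hj _ (by omega) e
      have Bz : ∀ (τ : ℕ → Bool), ∀ j < n, run B τ (z j) = τ (z j) := fun τ j hj =>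
        Bn τ _ fun i hi e => h.zo _ hj _ (by omega) e
      have Bx : ∀ (τ : ℕ → Bool), ∀ j < n, run B τ (x j) = τ (x j) := fun τ j hj =>
        Bn τ _ fun i hi e => h.xo _ hj _ (by omega) e
      have Be : ∀ (τ : ℕ → Bool), ∀ j, 2 * j ≤ n → run B τ (o (2 * j)) = τ (o (2 * j)) :=
        fun τ j hj => Bn τ _ fun i hi e => by
          have := h.o_inj _ hj _ (by omega) e; omega
      obtain ⟨I1, I2⟩ := ih (n / 2) (by omega) h.half (σ := run A σ)
        (fun i hi hi' => by rw [Ao _ _ (by omega)]; exact ho _ (by omega) (by omega))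
        (fun i hi => by
          rw [An]
          · exact hz _ (by omega)
          · intro j hj e
            have := h.z_inj _ (by omega) _ (by omega) e; omega)
      have I1' : ∀ j ≤ n / 2, run (scan (n / 2) z (fun i => o (2 * i)) (fun i => z (n / 2 + i)))
          (run A σ) (o (2 * j)) = (σ (o 0) && pre (fun i => σ (x i)) (2 * j)) := by
        intro j hj
        rw [I1 j hj, Ao _ _ (by omega), ← pre_pairs]
        congr 1
        refine pre_congr fun i hi => ?_
        rw [At _ _ (by omega), hz _ (by omega), Bool.false_xor]
      have I2x : ∀ j < n, run (scan (n / 2) z (fun i => o (2 * i)) (fun i => z (n / 2 + i)))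
          (run A σ) (x j) = σ (x j) := fun j hj => by
        rw [I2 _ fun i _ hi => h.xo _ hj _ (by omega), Ax _ _ hj]
      have I2z : ∀ j < n, run (scan (n / 2) z (fun i => o (2 * i)) (fun i => z (n / 2 + i)))
          (run A σ) (z j) = run A σ (z j) := fun j hj =>
        I2 _ fun i _ hi => h.zo _ hj _ (by omega)
      simp only [run_append]
      refine ⟨fun j hj => ?_, fun w hw => ?_⟩
      · rw [Ao _ _ hj]
        obtain ⟨k, rfl | rfl⟩ : ∃ k, j = 2 * k ∨ j = 2 * k + 1 := ⟨j / 2, by omega⟩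
        · rw [Be _ _ hj, I1' k (by omega)]
        · rw [Bt _ _ (by omega), I1' k (by omega), I2x _ (by omega), I2, Ao _ _ hj,
            ho _ (by omega) hj, pre]
          · cases σ (x (2 * k)) <;> cases σ (o 0) <;> simp
          · intro i _ hi e
            have := h.o_inj _ (by omega) _ (by omega) e; omega
      · by_cases hwz : ∃ i < n / 2, w = z i
        · obtain ⟨i, hi, rfl⟩ := hwz
          rw [At _ _ hi, Bz _ _ (by omega), Bx _ _ (by omega), Bx _ _ (by omega),
            I2x _ (by omega), I2x _ (by omega), I2z _ (by omega), At _ _ hi]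
          cases σ (z i) <;> cases σ (x (2 * i)) <;> cases σ (x (2 * i + 1)) <;> rfl
        · push Not at hwz
          rw [An _ _ hwz, Bn _ _ fun i hi => hw _ (by omega) (by omega),
            I2 _ fun i hi hi' => hw _ (by omega) (by omega), An _ _ hwz]

theorem pre_eq_all (v : ℕ → ℕ) (k : ℕ) (σ : ℕ → Bool) :
    ((List.range k).map v).all σ = pre (fun i => σ (v i)) k := by
  rw [Bool.eq_iff_iff, pre_eq_true]
  simp

/-! ### Multiply controlled gates of logarithmic depth -/

/-- Borrowed wires `d i`, `i < n`, and controls `v i`, `i < n`, are distinct. -/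
structure TwoReg (n : ℕ) (v d : ℕ → ℕ) : Prop where
  v_inj : ∀ i < n, ∀ j < n, v i = v j → i = j
  d_inj : ∀ i < n, ∀ j < n, d i = d j → i = j
  vd : ∀ i < n, ∀ j < n, v i ≠ d j

section Forward

variable (N : ℕ) (v d : ℕ → ℕ)

/-- The number of groups in the block that follows the block of `p + 1` groups starting at `p`. -/
def blockLen (p : ℕ) : ℕ := min (2 * p + 2) (N - (2 * p + 1))

/-- Turns the wires of a block which are all set into clean ones, except for the first. -/
def blockClear (p : ℕ) : NCircuit :=
  layer (3 * blockLen N p) (fun _ => []) (fun i => v (8 * p + 1 + i))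

/-- Stores the conjunctions of the groups of the next block. -/
def blockAnd (p : ℕ) : NCircuit :=
  parN (blockLen N p) fun i =>
    bar ((List.range 8).map fun l => v (8 * (2 * p + 1 + i) + l))
      (fun l => d (8 * (2 * p + 1 + i) + l)) (v (8 * p + blockLen N p + 1 + i))

/-- Stores the conjunction of the next block. -/
def blockScan (p : ℕ) : NCircuit :=
  scan (blockLen N p) (fun i => v (8 * p + blockLen N p + 1 + i)) (fun i => v (8 * p + i))
    (fun i => v (8 * p + 2 * blockLen N p + 1 + i))

/-- Starting with the block of groups `p, …, 2 p`, uses each block as conditionally clean space for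
the conjunction of the next block. -/
def forward (p : ℕ) : NCircuit :=
  if N ≤ 2 * p + 1 then [] else
    blockClear N v p ++ (blockAnd N v d p ++ (blockScan N v p ++ forward (2 * p + 1)))
termination_by N - p

/-- The wires holding the conjunctions of the blocks. -/
def guards (p : ℕ) : List ℕ :=
  if N ≤ 2 * p + 1 then [] else v (8 * p + blockLen N p) :: guards (2 * p + 1)
termination_by N - p

/-- The wires from group `p` on. -/
def fromGroup (p : ℕ) : Set ℕ := {w | ∃ i, 8 * p ≤ i ∧ i < 8 * N ∧ (w = v i ∨ w = d i)}

variable {N v d}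

theorem blockLen_le {p : ℕ} (h : ¬ N ≤ 2 * p + 1) :
    1 ≤ blockLen N p ∧ blockLen N p ≤ 2 * p + 2 ∧ 2 * p + 1 + blockLen N p ≤ N := by
  unfold blockLen; omega

theorem blockAnd_reg {p : ℕ} (hr : TwoReg (8 * N) v d) (h : ¬ N ≤ 2 * p + 1) {i : ℕ}
    (hi : i < blockLen N p) : ChainReg ((List.range 8).map fun l => v (8 * (2 * p + 1 + i) + l))
      (fun l => d (8 * (2 * p + 1 + i) + l)) (v (8 * p + blockLen N p + 1 + i)) := by
  have hb := blockLen_le h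
  constructor
  · simp only [List.mem_map, List.mem_range, not_exists, not_and]
    intro l hl e
    have := hr.v_inj _ (by omega) _ (by omega) e; omega
  · intro l hl e
    simp only [List.length_map, List.length_range] at hl
    exact hr.vd _ (by omega) _ (by omega) e.symm
  · intro l hl hm
    simp only [List.length_map, List.length_range] at hl
    simp only [List.mem_map, List.mem_range] at hm
    obtain ⟨l', hl', e⟩ := hm
    exact hr.vd _ (by omega) _ (by omega) e
  · intro l hl l' hl' e
    simp only [List.length_map, List.length_range] at hl hl'
    have := hr.d_inj _ (by omega) _ (by omega) e; omega

/-- The wires for the conjunction of group `i` of the next block. -/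
def blockAndWires (N : ℕ) (v d : ℕ → ℕ) (p i : ℕ) : Set ℕ :=
  {w | w = v (8 * p + blockLen N p + 1 + i) ∨
    ∃ l < 8, w = v (8 * (2 * p + 1 + i) + l) ∨ w = d (8 * (2 * p + 1 + i) + l)}

theorem blockAnd_bd_single {p : ℕ} (hr : TwoReg (8 * N) v d) (h : ¬ N ≤ 2 * p + 1) {i : ℕ}
    (hi : i < blockLen N p) : Bd (blockAndWires N v d p i)
      (bar ((List.range 8).map fun l => v (8 * (2 * p + 1 + i) + l))
      (fun l => d (8 * (2 * p + 1 + i) + l)) (v (8 * p + blockLen N p + 1 + i))) 33 33 := by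
  refine (bar_bd (blockAnd_reg hr h hi)).mono ?_ (by simp) (by simp)
  rintro w (rfl | hw | ⟨l, hl, rfl⟩)
  · exact Or.inl rfl
  · simp only [List.mem_map, List.mem_range] at hw
    obtain ⟨l, hl, rfl⟩ := hw
    exact Or.inr ⟨l, hl, Or.inl rfl⟩
  · simp only [List.length_map, List.length_range] at hl
    exact Or.inr ⟨l, by omega, Or.inr rfl⟩

theorem blockAnd_disj {p : ℕ} (hr : TwoReg (8 * N) v d) (h : ¬ N ≤ 2 * p + 1) :
    ∀ i < blockLen N p, ∀ j < blockLen N p, i ≠ j →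
      ∀ w ∈ blockAndWires N v d p i, w ∉ blockAndWires N v d p j := by
  have hb := blockLen_le h
  rintro i hi j hj hij w (rfl | ⟨l, hl, rfl | rfl⟩) (e | ⟨l', hl', e | e⟩)
  all_goals first
    | (have := hr.v_inj _ (by omega) _ (by omega) e; omega)
    | (have := hr.d_inj _ (by omega) _ (by omega) e; omega)
    | exact hr.vd _ (by omega) _ (by omega) e
    | exact hr.vd _ (by omega) _ (by omega) e.symm

/-- The workspace fits: with `n = blockLen N p ≤ 2 * p + 2`, the scan occupies `3 * n + 1` of the `8
* (p + 1)` wires of the block, as outputs, inputs and scratch in this order. -/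
theorem blockScan_reg {p : ℕ} (hr : TwoReg (8 * N) v d) (h : ¬ N ≤ 2 * p + 1) :
    ScanReg (blockLen N p) (fun i => v (8 * p + blockLen N p + 1 + i)) (fun i => v (8 * p + i))
      (fun i => v (8 * p + 2 * blockLen N p + 1 + i)) := by
  have hb := blockLen_le h
  constructor <;> intro i hi j hj e <;>
    · have := hr.v_inj _ (by omega) _ (by omega) e; omega

/-- The number of groups doubles from block to block, so `q` bounds the number of rounds. A scan
only touches its own block and runs in parallel with all later rounds. Hence a round adds only 34
time steps, and the cost `E` of a scan is paid once. -/
theorem forward_bd (hr : TwoReg (8 * N) v d) {E : ℕ} (hE : 3 * Nat.clog 2 N + 3 ≤ E) (q : ℕ) :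
    ∀ p, N < (p + 1) * 2 ^ q →
      Bd (fromGroup N v d p) (forward N v d p) (34 * q + E) (80 * (N - p)) := by
  induction q with
  | zero =>
    intro p hp
    rw [forward, if_pos (by omega)]
    exact Bd.nil'
  | succ q ih =>
    intro p hp
    rw [forward]
    split_ifs with h
    · exact Bd.nil'
    have hb := blockLen_le h
    have h1 : Bd (fromGroup N v d p) (blockClear N v p) 1 (3 * blockLen N p) := by
      refine layer_bd (by simp) (by simp) (fun i hi => ⟨8 * p + 1 + i, by omega, by omega, by simp⟩)
        (by simp) ?_
      intro i hi j hj hij w hw hw'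
      simp only [List.mem_singleton] at hw hw'
      have := hr.v_inj _ (by omega) _ (by omega) (hw.symm.trans hw'); omega
    have h2 : Bd (fromGroup N v d p) (blockAnd N v d p) 33 (blockLen N p * 33) := by
      refine Bd.parN (fun i hi => blockAnd_bd_single hr h hi) (blockAnd_disj hr h) ?_
      rintro i hi w (rfl | ⟨l, hl, rfl | rfl⟩)
      · exact ⟨8 * p + blockLen N p + 1 + i, by omega, by omega, by simp⟩
      · exact ⟨8 * (2 * p + 1 + i) + l, by omega, by omega, by simp⟩
      · exact ⟨8 * (2 * p + 1 + i) + l, by omega, by omega, by simp⟩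
    have h3 : Bd {w | ∃ i, 8 * p ≤ i ∧ i < 8 * (2 * p + 1) ∧ w = v i} (blockScan N v p)
        (3 * Nat.clog 2 (blockLen N p) + 3) (4 * blockLen N p) := by
      refine scan_bd (blockScan_reg hr h) ?_ ?_ ?_
      · exact fun i hi => ⟨8 * p + blockLen N p + 1 + i, by omega, by omega, rfl⟩
      · exact fun i hi => ⟨8 * p + i, by omega, by omega, rfl⟩
      · exact fun i hi => ⟨8 * p + 2 * blockLen N p + 1 + i, by omega, by omega, rfl⟩
    have h4 := ih (2 * p + 1) (by rw [pow_succ] at hp; nlinarith)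
    have hlog : Nat.clog 2 (blockLen N p) ≤ Nat.clog 2 N := Nat.clog_mono_right 2 (by omega)
    have h5 := (h3.weaken (e := 34 * q + E) (by omega) le_rfl).par h4 (by
      rw [Set.disjoint_left]
      rintro w ⟨i, hi, hi', rfl⟩ ⟨j, hj, hj', e | e⟩
      · have := hr.v_inj _ (by omega) _ (by omega) e; omega
      · exact hr.vd _ (by omega) _ (by omega) e)
    have h6 := h5.mono (T := fromGroup N v d p) (by
      rintro w (⟨i, hi, hi', rfl⟩ | ⟨j, hj, hj', e⟩)
      · exact ⟨i, by omega, by omega, Or.inl rfl⟩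
      · exact ⟨j, by omega, by omega, e⟩) le_rfl le_rfl
    -- The `40 * blockLen N p` gates of this round are charged to the `p + 1` groups of the current
    -- block, 80 each.
    exact (h1.seq (h2.seq h6)).weaken (by omega) (by omega)

theorem forward_bd' (hr : TwoReg (8 * N) v d) (p : ℕ) :
    ∃ d' k, Bd (fromGroup N v d p) (forward N v d p) d' k :=
  ⟨_, _, forward_bd hr le_rfl (N + 1) p (by
    have := Nat.lt_two_pow_self (n := N + 1)
    nlinarith)⟩

/-- If the next block is not entirely set, its guard is already false, and whatever the later rounds
do on workspace that is not clean is irrelevant. Otherwise the next block is all set and the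
induction continues with it as workspace. -/
theorem run_forward (hr : TwoReg (8 * N) v d) (p : ℕ) (σ : ℕ → Bool)
    (hσ : ∀ i, 8 * p ≤ i → i < 8 * (2 * p + 1) → i < 8 * N → σ (v i) = true) :
    (∀ w ∈ guards N v p, run (forward N v d p) σ w = true) ↔
      ∀ i, 8 * (2 * p + 1) ≤ i → i < 8 * N → σ (v i) = true := by
  induction hm : N - p using Nat.strong_induction_on generalizing p σ with
  | _ m ih =>
    rw [forward, guards]
    split_ifs with h
    · simp only [List.not_mem_nil, false_implies, implies_true, true_iff]
      intro i hi hi'; omega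
    have hb := blockLen_le h
    set n := blockLen N p with hn
    simp only [run_append]
    set σ1 := run (blockClear N v p) σ with hσ1
    have e1 : ∀ i < 3 * n, σ1 (v (8 * p + 1 + i)) = false := by
      intro i hi
      have := run_layer (n := 3 * n) (cs := fun _ => []) (t := fun i => v (8 * p + 1 + i)) (σ := σ)
        (fun i hi j hj e => by have := hr.v_inj _ (by omega) _ (by omega) e; omega) (by simp) hi
      rw [hσ1, blockClear, this, hσ _ (by omega) (by omega) (by omega)]; rfl
    have e1' : ∀ w, (∀ i < 3 * n, w ≠ v (8 * p + 1 + i)) → σ1 w = σ w :=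
      fun w hw => run_layer_of_ne hw
    have e1'' : ∀ i, 8 * (2 * p + 1) ≤ i → i < 8 * N → σ1 (v i) = σ (v i) := by
      intro i hi hi'
      refine e1' _ fun j hj e => ?_
      have := hr.v_inj _ (by omega) _ (by omega) e; omega
    set σ2 := run (blockAnd N v d p) σ1 with hσ2
    have e2 : ∀ i < n, σ2 (v (8 * p + n + 1 + i)) =
        pre (fun l => σ (v (8 * (2 * p + 1 + i) + l))) 8 := by
      intro i hi
      rw [hσ2, blockAnd, run_parN (S := blockAndWires N v d p) (d := fun _ => 33) (k := fun _ => 33)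
        (fun i hi => blockAnd_bd_single hr h hi) (blockAnd_disj hr h) _ hi (Or.inl rfl),
        run_bar (blockAnd_reg hr h hi), Function.update_self, pre_eq_all,
        show 8 * p + n + 1 + i = 8 * p + 1 + (n + i) by ring, e1 _ (by omega), Bool.false_xor]
      exact pre_congr fun l hl => e1'' _ (by omega) (by omega)
    have e2' : ∀ w, (∀ i < n, w ≠ v (8 * p + n + 1 + i)) → σ2 w = σ1 w := by
      intro w hw
      by_cases hw' : ∃ i < n, w ∈ blockAndWires N v d p i
      · obtain ⟨i, hi, hwi⟩ := hw'
        rw [hσ2, blockAnd, run_parN (S := blockAndWires N v d p) (d := fun _ => 33)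
          (k := fun _ => 33) (fun i hi => blockAnd_bd_single hr h hi) (blockAnd_disj hr h) _ hi hwi,
          run_bar (blockAnd_reg hr h hi), Function.update_of_ne (hw i hi)]
      · push Not at hw'
        rw [hσ2, blockAnd, run_parN_of_notMem (S := blockAndWires N v d p) (d := fun _ => 33)
          (k := fun _ => 33) (fun i hi => blockAnd_bd_single hr h hi) _ hw']
    obtain ⟨e3, e3'⟩ := run_scan (blockScan_reg hr h) (σ := σ2)
      (fun i hi hi' => by
        rw [e2', show 8 * p + i = 8 * p + 1 + (i - 1) by omega, e1 _ (by omega)]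
        intro j hj e
        have := hr.v_inj _ (by omega) _ (by omega) e; omega)
      (fun i hi => by
        rw [e2', show 8 * p + 2 * blockLen N p + 1 + i = 8 * p + 1 + (2 * n + i) by omega,
          e1 _ (by omega)]
        intro j hj e
        have := hr.v_inj _ (by omega) _ (by omega) e; omega)
    set σ3 := run (blockScan N v p) σ2 with hσ3
    -- The first wire of the block was not cleared. It is still set and serves as the neutral
    -- initial value of the scan.
    have e4 : σ3 (v (8 * p + n)) =
        pre (fun i => pre (fun l => σ (v (8 * (2 * p + 1 + i) + l))) 8) n := by
      have h0 : σ2 (v (8 * p + 0)) = true := by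
        rw [e2', e1', hσ _ (by omega) (by omega) (by omega)]
        · intro j hj e
          have := hr.v_inj _ (by omega) _ (by omega) e; omega
        · intro j hj e
          have := hr.v_inj _ (by omega) _ (by omega) e; omega
      refine (e3 n le_rfl).trans ?_
      rw [h0, Bool.true_and]
      exact pre_congr fun i hi => e2 i hi
    have e5 : ∀ i, 8 * (2 * p + 1) ≤ i → i < 8 * N → σ3 (v i) = σ (v i) := by
      intro i hi hi'
      refine (e3' _ fun j hj hj' e => ?_).trans ((e2' _ fun j hj e => ?_).trans (e1'' i hi hi'))
      · have := hr.v_inj _ (by omega) _ (by omega) e; omega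
      · have := hr.v_inj _ (by omega) _ (by omega) e; omega
    obtain ⟨d', k', hF⟩ := forward_bd' hr (2 * p + 1)
    have e6 : run (forward N v d (2 * p + 1)) σ3 (v (8 * p + n)) = σ3 (v (8 * p + n)) := by
      refine hF.run_of_notMem ?_
      rintro ⟨i, hi, hi', e | e⟩
      · have := hr.v_inj _ (by omega) _ (by omega) e; omega
      · exact hr.vd _ (by omega) _ (by omega) e
    have e7 : σ3 (v (8 * p + n)) = true ↔
        ∀ i, 8 * (2 * p + 1) ≤ i → i < 8 * (2 * p + 1 + n) → σ (v i) = true := by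
      rw [e4, pre_eq_true]
      simp only [pre_eq_true]
      constructor
      · intro hp i hi hi'
        have := hp ((i - 8 * (2 * p + 1)) / 8) (by omega) (i % 8) (by omega)
        rwa [show 8 * (2 * p + 1 + (i - 8 * (2 * p + 1)) / 8) + i % 8 = i by omega] at this
      · intro hp i hi l hl
        exact hp _ (by omega) (by omega)
    rw [List.forall_mem_cons, e6, e7]
    constructor
    · rintro ⟨hA, hB⟩
      have := (ih (N - (2 * p + 1)) (by omega) (2 * p + 1) σ3 (fun i hi hi1 hi2 => by
        rw [e5 i hi hi2]
        refine hA i hi ?_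
        rw [hn, blockLen]; omega) rfl).1 hB
      intro i hi hi'
      by_cases hin : i < 8 * (2 * p + 1 + n)
      · exact hA i hi hin
      · have h9 := this i (by rw [hn, blockLen] at hin; omega) hi'
        rwa [e5 i hi hi'] at h9
    · intro hA
      refine ⟨fun i hi hi' => hA i hi (by omega), ?_⟩
      refine (ih (N - (2 * p + 1)) (by omega) (2 * p + 1) σ3 (fun i hi hi1 hi2 => by
        rw [e5 i hi hi2]; exact hA i hi hi2) rfl).2 fun i hi hi' => ?_
      rw [e5 i (by omega) hi']
      exact hA i (by omega) hi'

theorem guards_mem (p : ℕ) : ∀ w ∈ guards N v p, ∃ i, i < 8 * N ∧ w = v i := by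
  induction hm : N - p using Nat.strong_induction_on generalizing p with
  | _ m ih =>
    rw [guards]
    split_ifs with h
    · simp
    · have hb := blockLen_le h
      rw [List.forall_mem_cons]
      exact ⟨⟨_, by omega, rfl⟩, ih (N - (2 * p + 1)) (by omega) (2 * p + 1) rfl⟩

theorem guards_length_le (q : ℕ) : ∀ p, N < (p + 1) * 2 ^ q → (guards N v p).length ≤ q := by
  induction q with
  | zero =>
    intro p hp
    rw [guards, if_pos (by omega)]; simp
  | succ q ih =>
    intro p hp
    rw [guards]
    split_ifs with h
    · simp
    · have := ih (2 * p + 1) (by rw [pow_succ] at hp; nlinarith)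
      simpa using this

end Forward

/-- The wires used by `mcx k v d a t` are distinct. -/
structure McxReg (k : ℕ) (v d : ℕ → ℕ) (a t : ℕ) : Prop extends TwoReg k v d where
  av : ∀ i < k, a ≠ v i
  ad : ∀ i < k, a ≠ d i
  tv : ∀ i < k, t ≠ v i
  td : ∀ i < k, t ≠ d i
  ta : t ≠ a

section Mcx

variable (k : ℕ) (v d : ℕ → ℕ) (a t : ℕ)

/-- The wires whose conjunction decides over the flip of the target in `mcxBody`. -/
def mcxGuards : List ℕ :=
  guards (k / 8) v 0 ++ (List.range (k % 8)).map fun i => v (8 * (k / 8) + i)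

/-- Flips `t` if `a` and `v 8, …, v (k - 1)` are set, provided that `v 0, …, v 7` are set. -/
def mcxBody : NCircuit :=
  forward (k / 8) v d 0 ++ bar (a :: mcxGuards k v) d t ++ (forward (k / 8) v d 0).reverse

/-- Flips `t` if `v 0, …, v (k - 1)` are set; the wires `a` and `d i` are borrowed. -/
def mcx : NCircuit :=
  if k < 8 then bar ((List.range k).map v) d t else
    mcxBody k v d a t ++ (bar ((List.range 8).map v) d a ++
      (mcxBody k v d a t ++ bar ((List.range 8).map v) d a))

variable {k v d a t}

theorem TwoReg.mono {m n : ℕ} (h : TwoReg n v d) (hmn : m ≤ n) : TwoReg m v d where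
  v_inj := fun i hi j hj => h.v_inj i (by omega) j (by omega)
  d_inj := fun i hi j hj => h.d_inj i (by omega) j (by omega)
  vd := fun i hi j hj => h.vd i (by omega) j (by omega)

theorem TwoReg.chainReg {n : ℕ} (h : TwoReg n v d) (htv : ∀ i < n, t ≠ v i)
    (htd : ∀ i < n, t ≠ d i) : ChainReg ((List.range n).map v) d t where
  target := by
    simp only [List.mem_map, List.mem_range, not_exists, not_and]
    exact fun i hi e => htv i hi e.symm
  target_ne := fun i hi e => htd i (by simp at hi; omega) e.symm
  notMem := fun i hi => by
    simp only [List.mem_map, List.mem_range, not_exists, not_and]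
    exact fun j hj e => h.vd j hj i (by simp at hi; omega) e
  inj := fun i hi j hj e => h.d_inj i (by simp at hi; omega) j (by simp at hj; omega) e

theorem mcxGuards_mem : ∀ w ∈ mcxGuards k v, ∃ i < k, w = v i := by
  intro w hw
  rw [mcxGuards, List.mem_append] at hw
  rcases hw with hw | hw
  · obtain ⟨i, hi, rfl⟩ := guards_mem 0 w hw
    exact ⟨i, by omega, rfl⟩
  · simp only [List.mem_map, List.mem_range] at hw
    obtain ⟨i, hi, rfl⟩ := hw
    exact ⟨_, by omega, rfl⟩

/-- The 7 accounts for the wires left over when the controls are divided into groups of eight. -/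
theorem mcxGuards_length_le {q : ℕ} (h : k / 8 < 2 ^ q) : (mcxGuards k v).length ≤ q + 7 := by
  have := guards_length_le (N := k / 8) (v := v) q 0 (by omega)
  simp [mcxGuards]; omega

theorem mcxBody_reg (h : McxReg k v d a t) (hk : ¬ k < 8) : ChainReg (a :: mcxGuards k v) d t := by
  have hl := mcxGuards_length_le (k := k) (v := v) (q := k / 8) Nat.lt_two_pow_self
  constructor
  · simp only [List.mem_cons, not_or]
    refine ⟨h.ta, fun hm => ?_⟩
    obtain ⟨i, hi, e⟩ := mcxGuards_mem t hm
    exact h.tv i hi e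
  · intro i hi e
    exact h.td i (by simp at hi; omega) e.symm
  · intro i hi hm
    rcases List.mem_cons.1 hm with e | hm
    · exact h.ad i (by simp at hi; omega) e.symm
    · obtain ⟨j, hj, e⟩ := mcxGuards_mem _ hm
      exact h.vd j hj i (by simp at hi; omega) e.symm
  · intro i hi j hj e
    exact h.d_inj i (by simp at hi; omega) j (by simp at hj; omega) e

theorem mcx_bd {S : Set ℕ} (h : McxReg k v d a t) (hv : ∀ i < k, v i ∈ S) (hd : ∀ i < k, d i ∈ S)
    (ha : a ∈ S) (ht : t ∈ S) : Bd S (mcx k v d a t) (156 * Nat.clog 2 k + 144) (41 * k + 140) := by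
  have hb : ∀ n ≤ k, ∀ t ∈ S, (∀ i < n, t ≠ v i) → (∀ i < n, t ≠ d i) →
      Bd S (bar ((List.range n).map v) d t) (4 * n + 1) (4 * n + 1) := by
    intro n hn t ht h1 h2
    refine (bar_bd ((h.toTwoReg.mono hn).chainReg h1 h2)).mono ?_ (by simp) (by simp)
    rintro w (rfl | hw | ⟨i, hi, rfl⟩)
    · exact ht
    · simp only [List.mem_map, List.mem_range] at hw
      obtain ⟨i, hi, rfl⟩ := hw
      exact hv i (by omega)
    · exact hd i (by simp at hi; omega)
  rw [mcx]
  split_ifs with hk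
  · exact (hb k le_rfl t ht h.tv h.td).weaken (by omega) (by omega)
  have h1 := hb 8 (by omega) a ha (fun i hi => h.av i (by omega)) (fun i hi => h.ad i (by omega))
  have hq : k ≤ 2 ^ Nat.clog 2 k := Nat.le_pow_clog one_lt_two k
  have hq' : Nat.clog 2 (k / 8) ≤ Nat.clog 2 k := Nat.clog_mono_right 2 (by omega)
  have hF := (forward_bd (N := k / 8) (h.toTwoReg.mono (by omega)) le_rfl (Nat.clog 2 k) 0
    (by omega)).mono (T := S) (by
      rintro w ⟨i, hi, hi', rfl | rfl⟩
      · exact hv i (by omega)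
      · exact hd i (by omega)) le_rfl le_rfl
  have hl := mcxGuards_length_le (k := k) (v := v) (q := Nat.clog 2 k) (by omega)
  have hl' := mcxGuards_length_le (k := k) (v := v) (q := k / 8) Nat.lt_two_pow_self
  have hM := (bar_bd (mcxBody_reg h hk)).mono (T := S) (by
    rintro w (rfl | hw | ⟨i, hi, rfl⟩)
    · exact ht
    · rcases List.mem_cons.1 hw with rfl | hw
      · exact ha
      · obtain ⟨i, hi, rfl⟩ := mcxGuards_mem w hw
        exact hv i hi
    · exact hd i (by simp at hi; omega)) le_rfl le_rfl
  have hB : Bd S (mcxBody k v d a t) _ _ := (hF.seq hM).seq hF.reverse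
  refine (hB.seq (h1.seq (hB.seq h1))).weaken ?_ ?_
  · simp only [List.length_cons]; omega
  · simp only [List.length_cons]; omega

/-- The condition under which `mcxBody` flips its target, apart from `a`. -/
def mcxCond (k : ℕ) (v d : ℕ → ℕ) (σ : ℕ → Bool) : Bool :=
  (mcxGuards k v).all (run (forward (k / 8) v d 0) σ)

theorem run_mcxBody (h : McxReg k v d a t) (hk : ¬ k < 8) (σ : ℕ → Bool) :
    run (mcxBody k v d a t) σ = Function.update σ t (xor (σ t) (σ a && mcxCond k v d σ)) := by
  obtain ⟨d', k', hF⟩ := forward_bd' (N := k / 8) (h.toTwoReg.mono (by omega)) 0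
  have hno : ∀ w, (∀ i < k, w ≠ v i) → (∀ i < k, w ≠ d i) → w ∉ fromGroup (k / 8) v d 0 := by
    rintro w h1 h2 ⟨i, hi, hi', e | e⟩
    · exact h1 i (by omega) e
    · exact h2 i (by omega) e
  refine hF.run_conj (hno t h.tv h.td) ?_
  rw [run_bar (mcxBody_reg h hk), hF.run_of_notMem (hno t h.tv h.td)]
  simp [mcxCond, hF.run_of_notMem (hno a h.av h.ad)]

/-- Needed because `mcx` toggles `a` and `t` between its two uses of `mcxBody`; the condition must
be the same both times. -/
theorem mcxCond_update (h : McxReg k v d a t) {w : ℕ} (h1 : ∀ i < k, w ≠ v i)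
    (h2 : ∀ i < k, w ≠ d i) (σ : ℕ → Bool) (b : Bool) :
    mcxCond k v d (Function.update σ w b) = mcxCond k v d σ := by
  obtain ⟨d', k', hF⟩ := forward_bd' (N := k / 8) (h.toTwoReg.mono (by omega)) 0
  rw [mcxCond, mcxCond, hF.run_update, Bool.eq_iff_iff]
  · simp only [List.all_eq_true]
    refine forall₂_congr fun c hc => ?_
    obtain ⟨i, hi, rfl⟩ := mcxGuards_mem c hc
    rw [Function.update_of_ne (h1 i hi).symm]
  · rintro ⟨i, hi, hi', e | e⟩
    · exact h1 i (by omega) e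
    · exact h2 i (by omega) e

/-- The body flips `t` by `a ∧ mcxCond`, before and after `a` is toggled by the conjunction of the
first eight controls; the net flip is their product. `mcxCond` has the intended meaning only if
those eight controls are set, which is the only case in which it matters. -/
theorem run_mcx (h : McxReg k v d a t) (σ : ℕ → Bool) :
    run (mcx k v d a t) σ = Function.update σ t (xor (σ t) (pre (fun i => σ (v i)) k)) := by
  rw [mcx]
  split_ifs with hk
  · rw [run_bar (h.toTwoReg.chainReg h.tv h.td), pre_eq_all]
  have hc := (h.toTwoReg.mono (show 8 ≤ k by omega)).chainReg (t := a)
    (fun i hi => h.av i (by omega)) (fun i hi => h.ad i (by omega))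
  have hcond : (pre (fun i => σ (v i)) 8 && mcxCond k v d σ) = pre (fun i => σ (v i)) k := by
    rw [Bool.eq_iff_iff, Bool.and_eq_true, pre_eq_true, pre_eq_true]
    have hF := run_forward (N := k / 8) (h.toTwoReg.mono (by omega)) 0 σ
    obtain ⟨d', k', hB⟩ := forward_bd' (N := k / 8) (h.toTwoReg.mono (by omega)) 0
    have hrem : ∀ i < k % 8, run (forward (k / 8) v d 0) σ (v (8 * (k / 8) + i)) =
        σ (v (8 * (k / 8) + i)) := by
      intro i hi
      refine hB.run_of_notMem ?_
      rintro ⟨j, hj, hj', e | e⟩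
      · have := h.v_inj _ (by omega) _ (by omega) e; omega
      · exact h.vd _ (by omega) _ (by omega) e
    rw [mcxCond, List.all_eq_true]
    constructor
    · rintro ⟨h1, h2⟩ i hi
      rcases Nat.lt_or_ge i 8 with hi8 | hi8
      · exact h1 i hi8
      rcases Nat.lt_or_ge i (8 * (k / 8)) with hi9 | hi9
      · exact (hF fun i _ hi _ => h1 i (by omega)).1
          (fun w hw => h2 w (by rw [mcxGuards, List.mem_append]; exact Or.inl hw)) i (by omega) hi9
      · have := h2 (v (8 * (k / 8) + (i - 8 * (k / 8)))) (by
          rw [mcxGuards, List.mem_append]; right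
          simp only [List.mem_map, List.mem_range]
          exact ⟨i - 8 * (k / 8), by omega, rfl⟩)
        rw [hrem _ (by omega)] at this
        rwa [show 8 * (k / 8) + (i - 8 * (k / 8)) = i by omega] at this
    · intro hA
      refine ⟨fun i hi => hA i (by omega), fun w hw => ?_⟩
      rw [mcxGuards, List.mem_append] at hw
      rcases hw with hw | hw
      · exact (hF fun i _ hi _ => hA i (by omega)).2 (fun i hi hi' => hA i (by omega)) w hw
      · simp only [List.mem_map, List.mem_range] at hw
        obtain ⟨i, hi, rfl⟩ := hw
        rw [hrem i hi]; exact hA _ (by omega)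
  have h8 : ∀ τ : ℕ → Bool, (∀ i < 8, τ (v i) = σ (v i)) →
      ((List.range 8).map v).all τ = pre (fun i => σ (v i)) 8 := fun τ hτ => by
    rw [pre_eq_all]; exact pre_congr hτ
  rw [run_append, run_append, run_append, run_mcxBody h hk, run_bar hc, run_mcxBody h hk,
    run_bar hc, mcxCond_update h h.av h.ad, mcxCond_update h h.tv h.td, h8, h8, ← hcond]
  · ext w
    have hta := h.ta
    have hta' := h.ta.symm
    by_cases hwt : w = t
    · subst hwt
      simp [hta, hta']
      cases σ w <;> cases σ a <;> cases mcxCond k v d σ <;> cases pre (fun i => σ (v i)) 8 <;> rfl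
    · by_cases hwa : w = a
      · subst hwa; simp [hwt]
      · simp [hwt, hwa]
  · intro i hi
    rw [Function.update_of_ne (h.tv i (by omega)).symm,
      Function.update_of_ne (h.av i (by omega)).symm,
      Function.update_of_ne (h.tv i (by omega)).symm]
  · intro i hi
    rw [Function.update_of_ne (h.tv i (by omega)).symm]

end Mcx

/-! ### Blocks of a register and conditionally clean workspace below them -/

/-- The wires of `incK b R s x y` are distinct, and there are enough of them. -/
structure IncReg (b R s Y : ℕ) (x y : ℕ → ℕ) : Prop where
  hb : 1 ≤ b
  hs : 3 * R + 1 + 3 * b ≤ s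
  hY : 1 + (R / 4 + 1) * b ≤ Y
  x_inj : ∀ i < s + R * b, ∀ j < s + R * b, x i = x j → i = j
  y_inj : ∀ i < Y, ∀ j < Y, y i = y j → i = j
  xy : ∀ i < s + R * b, ∀ j < Y, x i ≠ y j

theorem mul_add_le {i j b : ℕ} (h : i < j) : i * b + b ≤ j * b := by
  have := Nat.mul_le_mul_right b (Nat.succ_le_of_lt h)
  rwa [Nat.succ_mul] at this

/-- Work on a block extends over that block and the three below, so distinct blocks of the same
class modulo 4 do not overlap. The second part keeps their shares of the borrowed wires apart, these
being indexed by `r / 4`. -/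
theorem mul_add_le_four {i j b : ℕ} (h : i < j) (h4 : i % 4 = j % 4) :
    i * b + 4 * b ≤ j * b ∧ (i / 4) * b + b ≤ (j / 4) * b := by
  refine ⟨?_, mul_add_le (by omega)⟩
  have := Nat.mul_le_mul_right b (show i + 4 ≤ j by omega)
  rwa [Nat.add_mul] at this

section Inc

variable (b R s : ℕ) (x y : ℕ → ℕ)

/-- Wire `j` of block `r`. -/
def blk (r j : ℕ) : ℕ := x (s + r * b + j)

/-- Wire `j` of the three blocks below block `r`. -/
def pool (r j : ℕ) : ℕ := x (s + r * b - 3 * b + j)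

/-- The wire that flags whether all blocks below block `r` are set. -/
def flag (r : ℕ) : ℕ := if r = 0 then y 0 else x (R + r)

/-- Computes the prefix conjunctions of block `r` in the blocks below. -/
def local' (r : ℕ) : NCircuit :=
  layer (2 * b) (fun _ => []) (fun j => pool b s x r (1 + j)) ++
    scan b (blk b s x r) (pool b s x r) (fun j => pool b s x r (b + 1 + j))

/-- Block `r` and the three blocks below. -/
def segment (r : ℕ) : Set ℕ := {w | ∃ i, s + r * b - 3 * b ≤ i ∧ i < s + r * b + b ∧ w = x i}

variable {b R s x y} {Y : ℕ} (h : IncReg b R s Y x y) {r : ℕ} (hr : r < R)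

include h hr

theorem local_scanReg : ScanReg b (blk b s x r) (pool b s x r)
    (fun j => pool b s x r (b + 1 + j)) := by
  have h1 := h.hs
  have h2 := mul_add_le (b := b) hr
  have h3 := h.hb
  constructor <;> intro i hi j hj e <;>
    · have := h.x_inj _ (by omega) _ (by omega) e; omega

theorem local_bd : Bd (segment b s x r) (local' b s x r) (3 * Nat.clog 2 b + 4) (6 * b) := by
  have h1 := h.hs
  have h2 := mul_add_le (b := b) hr
  have h3 := h.hb
  have hL : Bd (segment b s x r)
      (layer (2 * b) (fun _ => []) (fun j => pool b s x r (1 + j))) 1 (2 * b) := by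
    refine layer_bd (by simp) (by simp) (fun i hi => ⟨_, by omega, ?_, rfl⟩) (by simp) ?_
    · omega
    · intro i hi j hj hij w hw hw'
      simp only [List.mem_singleton] at hw hw'
      have := h.x_inj _ (by omega) _ (by omega) (hw.symm.trans hw'); omega
  have hS := scan_bd (S := segment b s x r) (local_scanReg h hr)
    (fun i hi => ⟨_, by omega, by omega, rfl⟩) (fun i hi => ⟨_, by omega, by omega, rfl⟩)
    (fun i hi => ⟨_, by omega, by omega, rfl⟩)
  exact (hL.seq hS).weaken (by omega) (by omega)

/-- Once cleared, the `2 * b` pool wires after the first serve as outputs and scratch of a scan; the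
first pool wire stays set as its initial value. -/
theorem run_local {σ : ℕ → Bool} (hσ : ∀ j < 3 * b, σ (pool b s x r j) = true) :
    (∀ j ≤ b, run (local' b s x r) σ (pool b s x r j) = pre (fun i => σ (blk b s x r i)) j) ∧
      (∀ j < b, run (local' b s x r) σ (pool b s x r (b + 1 + j)) = false) ∧
      ∀ w, (∀ j < 2 * b, w ≠ pool b s x r (1 + j)) → run (local' b s x r) σ w = σ w := by
  have h1 := h.hs
  have h2 := mul_add_le (b := b) hr
  have h3 := h.hb
  rw [local', run_append]
  set σ1 := run (layer (2 * b) (fun _ => []) (fun j => pool b s x r (1 + j))) σ with hσ1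
  have e1 : ∀ j < 2 * b, σ1 (pool b s x r (1 + j)) = false := by
    intro j hj
    have := run_layer (n := 2 * b) (cs := fun _ => []) (t := fun j => pool b s x r (1 + j)) (σ := σ)
      (fun i hi j hj e => by have := h.x_inj _ (by omega) _ (by omega) e; omega) (by simp) hj
    rw [hσ1, this, hσ _ (by omega)]; rfl
  have e2 : ∀ w, (∀ j < 2 * b, w ≠ pool b s x r (1 + j)) → σ1 w = σ w :=
    fun w hw => run_layer_of_ne hw
  obtain ⟨s1, s2⟩ := run_scan (local_scanReg h hr) (σ := σ1)
    (fun i hi hi' => by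
      have := e1 (i - 1) (by omega)
      rwa [show 1 + (i - 1) = i by omega] at this)
    (fun i hi => by
      have := e1 (b + i) (by omega)
      rwa [show 1 + (b + i) = b + 1 + i by omega] at this)
  have e3 : ∀ j < b, σ1 (pool b s x r (b + 1 + j)) = false := by
    intro j hj
    have := e1 (b + j) (by omega)
    rwa [show 1 + (b + j) = b + 1 + j by omega] at this
  refine ⟨fun j hj => ?_, fun j hj => ?_, fun w hw => ?_⟩
  · rw [s1 j hj, e2, hσ 0 (by omega), Bool.true_and]
    · refine pre_congr fun i hi => e2 _ fun j hj e => ?_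
      have := h.x_inj _ (by omega) _ (by omega) e; omega
    · intro j hj e
      have := h.x_inj _ (by omega) _ (by omega) e; omega
  · rw [s2, e3 j hj]
    intro i hi hi' e
    have := h.x_inj _ (by omega) _ (by omega) e; omega
  · rw [s2, e2 w hw]
    intro j hj hj'
    have := hw (j - 1) (by omega)
    rwa [show 1 + (j - 1) = j by omega] at this

omit hr in
theorem segment_disj {r r' : ℕ} (hr : r < R) (hr' : r' < R) (hne : r ≠ r') (h4 : r % 4 = r' % 4) :
    ∀ w ∈ segment b s x r, w ∉ segment b s x r' := by
  have h1 := h.hs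
  have h2 := mul_add_le (b := b) hr
  have h2' := mul_add_le (b := b) hr'
  rintro w ⟨i, hi, hi', rfl⟩ ⟨j, hj, hj', e⟩
  have e := h.x_inj _ (by omega) _ (by omega) e
  rcases Nat.lt_or_gt_of_ne hne with hl | hl
  · have := mul_add_le_four (b := b) hl h4; omega
  · have := mul_add_le_four (b := b) hl h4.symm; omega

theorem notMem_segment_of_lt {i : ℕ} (hi : i < s - 3 * b) : x i ∉ segment b s x r := by
  have h1 := h.hs
  have h2 := mul_add_le (b := b) hr
  rintro ⟨j, hj, hj', e⟩
  have := h.x_inj _ (by omega) _ (by omega) e; omega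

theorem y_notMem_segment {i : ℕ} (hi : i < Y) : y i ∉ segment b s x r := by
  have h1 := h.hs
  have h2 := mul_add_le (b := b) hr
  rintro ⟨j, hj, hj', e⟩
  exact h.xy _ (by omega) _ hi e.symm

omit hr

/-! ### The conjunctions of the blocks -/

omit h in
variable (b R s x) in
/-- Adds to wire `x r`, for the blocks `r` of class `k` modulo 4, the conjunction of block `r`,
provided that the three blocks below are set. -/
def andClass (k : ℕ) : NCircuit :=
  parN R fun r => if r % 4 = k then
    local' b s x r ++ [⟨[pool b s x r b], x r⟩] ++ (local' b s x r).reverse else []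

omit h in
variable (b R s x) in
/-- `andClass` for the classes below `k`. -/
def andClasses : ℕ → NCircuit
  | 0 => []
  | k + 1 => andClasses k ++ andClass b R s x k

omit h in
variable (b s x) in
/-- The bit computed by `local'` for the whole of block `r`. -/
def blockBit (r : ℕ) (σ : ℕ → Bool) : Bool := run (local' b s x r) σ (pool b s x r b)

include hr in
theorem run_and_single (σ : ℕ → Bool) :
    run (local' b s x r ++ [⟨[pool b s x r b], x r⟩] ++ (local' b s x r).reverse) σ =
      Function.update σ (x r) (xor (σ (x r)) (blockBit b s x r σ)) := by
  have h1 := h.hs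
  have ht : x r ∉ segment b s x r := notMem_segment_of_lt h hr (by omega)
  refine (local_bd h hr).run_conj ht ?_
  rw [run_single, (local_bd h hr).run_of_notMem ht]
  simp [blockBit]

include hr in
theorem and_single_bd : Bd {w | w = x r ∨ w ∈ segment b s x r}
    (local' b s x r ++ [⟨[pool b s x r b], x r⟩] ++ (local' b s x r).reverse)
      (6 * Nat.clog 2 b + 9) (13 * b) := by
  have h1 := h.hs
  have h2 := mul_add_le (b := b) hr
  have h3 := h.hb
  have hV := (local_bd h hr).mono (T := {w | w = x r ∨ w ∈ segment b s x r})
    (fun w hw => Or.inr hw) le_rfl le_rfl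
  have hpool : pool b s x r b ∈ segment b s x r := ⟨_, by omega, by omega, rfl⟩
  have hg : Bd {w | w = x r ∨ w ∈ segment b s x r} [⟨[pool b s x r b], x r⟩] 1 1 := by
    refine Bd.gate ?_ (by simp) (Or.inl rfl) ?_
    · simp only [List.mem_singleton]
      intro e
      exact notMem_segment_of_lt h hr (i := r) (by omega) (e ▸ hpool)
    · simp only [List.mem_singleton]; rintro w rfl; exact Or.inr hpool
  exact ((hV.seq hg).seq hV.reverse).weaken (by omega) (by omega)

omit h in
variable (b s x) in
/-- The wires of `andClass` for block `r`. -/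
def andWires (k r : ℕ) : Set ℕ := {w | r % 4 = k ∧ (w = x r ∨ w ∈ segment b s x r)}

include hr in
theorem and_class_single_bd (k : ℕ) : Bd (andWires b s x k r) (if r % 4 = k then
    local' b s x r ++ [⟨[pool b s x r b], x r⟩] ++ (local' b s x r).reverse else [])
      (6 * Nat.clog 2 b + 9) (13 * b) := by
  split_ifs with hk
  · exact (and_single_bd h hr).mono (fun w hw => ⟨hk, hw⟩) le_rfl le_rfl
  · exact Bd.nil'

theorem andWires_disj (k : ℕ) : ∀ i < R, ∀ j < R, i ≠ j →
    ∀ w ∈ andWires b s x k i, w ∉ andWires b s x k j := by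
  have h1 := h.hs
  rintro i hi j hj hij w ⟨hk, rfl | hw⟩ ⟨hk', e | hw'⟩
  · exact hij (h.x_inj _ (by omega) _ (by omega) e)
  · exact notMem_segment_of_lt h hj (by omega) hw'
  · subst e; exact notMem_segment_of_lt h hi (by omega) hw
  · exact segment_disj h hi hj hij (hk.trans hk'.symm) w hw hw'

theorem run_andClass (k : ℕ) (σ : ℕ → Bool) :
    (∀ r < R, r % 4 = k → run (andClass b R s x k) σ (x r) = xor (σ (x r)) (blockBit b s x r σ)) ∧
      ∀ w, (∀ r < R, r % 4 = k → w ≠ x r) → run (andClass b R s x k) σ w = σ w := by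
  refine ⟨fun r hr hk => ?_, fun w hw => ?_⟩
  · rw [andClass, run_parN (S := andWires b s x k) (d := fun _ => 6 * Nat.clog 2 b + 9)
      (k := fun _ => 13 * b) (fun i hi => and_class_single_bd h hi k) (andWires_disj h k) σ hr
      ⟨hk, Or.inl rfl⟩, if_pos hk, run_and_single h hr, Function.update_self]
  · by_cases hw' : ∃ r < R, w ∈ andWires b s x k r
    · obtain ⟨r, hr, hwr⟩ := hw'
      rw [andClass, run_parN (S := andWires b s x k) (d := fun _ => 6 * Nat.clog 2 b + 9)
        (k := fun _ => 13 * b) (fun i hi => and_class_single_bd h hi k) (andWires_disj h k) σ hr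
        hwr, if_pos hwr.1, run_and_single h hr, Function.update_of_ne (hw r hr hwr.1)]
    · push Not at hw'
      exact run_parN_of_notMem (S := andWires b s x k) (d := fun _ => 6 * Nat.clog 2 b + 9)
        (k := fun _ => 13 * b) (fun i hi => and_class_single_bd h hi k) σ hw'

include hr in
-- The segments lie above the wires `x r` with `r < R`, so the results written for one class do not
-- disturb the other classes.
theorem blockBit_congr {σ τ : ℕ → Bool} (hστ : ∀ w, (∀ r < R, w ≠ x r) → σ w = τ w) :
    blockBit b s x r σ = blockBit b s x r τ := by
  have h1 := h.hs
  have h2 := mul_add_le (b := b) hr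
  have h3 := h.hb
  refine (local_bd h hr).run_congr (fun w hw => hστ w ?_) _ ⟨_, by omega, by omega, rfl⟩
  rintro i hi rfl
  exact notMem_segment_of_lt h hr (by omega) hw

theorem run_andClasses (k : ℕ) (σ : ℕ → Bool) :
    (∀ r < R, r % 4 < k →
      run (andClasses b R s x k) σ (x r) = xor (σ (x r)) (blockBit b s x r σ)) ∧
      ∀ w, (∀ r < R, r % 4 < k → w ≠ x r) → run (andClasses b R s x k) σ w = σ w := by
  have h1 := h.hs
  induction k with
  | zero => simp [andClasses]
  | succ k ih =>
    obtain ⟨i1, i2⟩ := ih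
    obtain ⟨j1, j2⟩ := run_andClass h k (run (andClasses b R s x k) σ)
    refine ⟨fun r hr hk => ?_, fun w hw => ?_⟩
    · rw [andClasses, run_append]
      rcases Nat.lt_succ_iff_lt_or_eq.1 hk with hk' | hk'
      · rw [j2, i1 r hr hk']
        intro r' hr' hk'' e
        have := h.x_inj _ (by omega) _ (by omega) e; subst this; omega
      · rw [j1 r hr hk', i2, blockBit_congr h hr fun w hw => i2 w fun r hr _ => hw r hr]
        intro r' hr' hk'' e
        have := h.x_inj _ (by omega) _ (by omega) e; subst this; omega
    · rw [andClasses, run_append, j2 w fun r hr hk => hw r hr (by omega),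
        i2 w fun r hr hk => hw r hr (by omega)]

theorem andClasses_bd (k : ℕ) : Bd {w | ∃ i < s + R * b, w = x i} (andClasses b R s x k)
    (k * (6 * Nat.clog 2 b + 9)) (k * (R * (13 * b))) := by
  induction k with
  | zero => exact Bd.nil'
  | succ k ih =>
    refine (ih.seq (Bd.parN (fun i hi => and_class_single_bd h hi k) (andWires_disj h k)
      ?_)).weaken (Nat.succ_mul _ _).ge (Nat.succ_mul _ _).ge
    have h1 := h.hs
    rintro r hr w ⟨hk, rfl | ⟨i, hi, hi', rfl⟩⟩
    · exact ⟨r, by omega, rfl⟩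
    · have h2 := mul_add_le (b := b) hr
      exact ⟨i, by omega, rfl⟩

/-! ### The flags of the blocks -/

omit h in
variable (b R s x y) in
/-- Computes the flags, provided that `x 0, …, x (s - 1)` are set. -/
def flags : NCircuit :=
  layer (3 * R + 1) (fun _ => []) x ++ (andClasses b R s x 4 ++
    (scan R x (flag R x y) (fun j => x (2 * R + 1 + j)) ++ andClasses b R s x 4))

/-- The low part holds the block conjunctions on `x 0, …, x (R - 1)`, the flags `1, …, R` on `x (R +
1), …, x (2 * R)`, and the scratch from `x (2 * R + 1)` on. The wire `x R` stays idle, since flag 0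
is the control `y 0`. -/
theorem flags_scanReg : ScanReg R x (flag R x y) (fun j => x (2 * R + 1 + j)) := by
  have h1 := h.hs
  have h2 := h.hY
  constructor
  · intro i hi j hj e
    exact h.x_inj _ (by omega) _ (by omega) e
  · intro i hi j hj e
    unfold flag at e
    split_ifs at e with hi0 hj0 hj0
    · omega
    · exact absurd e.symm (h.xy _ (by omega) _ (by omega))
    · exact absurd e (h.xy _ (by omega) _ (by omega))
    · have := h.x_inj _ (by omega) _ (by omega) e; omega
  · intro i hi j hj e
    have := h.x_inj _ (by omega) _ (by omega) e; omega
  · intro i hi j hj e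
    unfold flag at e
    split_ifs at e with hj0
    · exact h.xy _ (by omega) _ (by omega) e
    · have := h.x_inj _ (by omega) _ (by omega) e; omega
  · intro i hi j hj e
    have := h.x_inj _ (by omega) _ (by omega) e; omega
  · intro i hi j hj e
    unfold flag at e
    split_ifs at e with hj0
    · exact h.xy _ (by omega) _ (by omega) e
    · have := h.x_inj _ (by omega) _ (by omega) e; omega

theorem flags_bd : Bd {w | w = y 0 ∨ ∃ i < s + R * b, w = x i} (flags b R s x y)
    (48 * Nat.clog 2 b + 3 * Nat.clog 2 R + 76) (7 * R + 1 + 104 * (R * b)) := by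
  have h1 := h.hs
  have hA := (andClasses_bd h 4).mono (T := {w | w = y 0 ∨ ∃ i < s + R * b, w = x i})
    (fun w hw => Or.inr hw) le_rfl le_rfl
  have hL : Bd {w | w = y 0 ∨ ∃ i < s + R * b, w = x i} (layer (3 * R + 1) (fun _ => []) x) 1
      (3 * R + 1) := by
    refine layer_bd (by simp) (by simp) (fun i hi => Or.inr ⟨i, by omega, rfl⟩) (by simp) ?_
    intro i hi j hj hij w hw hw'
    simp only [List.mem_singleton] at hw hw'
    have := h.x_inj _ (by omega) _ (by omega) (hw.symm.trans hw'); omega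
  have hS := scan_bd (S := {w | w = y 0 ∨ ∃ i < s + R * b, w = x i}) (flags_scanReg h)
    (fun i hi => Or.inr ⟨i, by omega, rfl⟩)
    (fun i hi => by
      unfold flag
      split_ifs
      · exact Or.inl rfl
      · exact Or.inr ⟨_, by omega, rfl⟩)
    (fun i hi => Or.inr ⟨_, by omega, rfl⟩)
  refine (hL.seq (hA.seq (hS.seq hA))).weaken (by omega) ?_
  have : R * (13 * b) = 13 * (R * b) := by ring
  omega

/-- After the run, the low part depends on the blocks only through prefix conjunctions, everything
else in it being clean. This is what allows the flags to be uncomputed after a negated increment. -/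
theorem run_flags {σ : ℕ → Bool} (hσ : ∀ i < s, σ (x i) = true) :
    (∀ r ≤ R, run (flags b R s x y) σ (flag R x y r) =
      (σ (y 0) && pre (fun i => σ (x (s + i))) (r * b))) ∧
    (∀ i < 3 * R + 1, (i ≤ R ∨ 2 * R < i) → run (flags b R s x y) σ (x i) = false) ∧
    ∀ w, (∀ i < 3 * R + 1, w ≠ x i) → run (flags b R s x y) σ w = σ w := by
  have h1 := h.hs
  have hY := h.hY
  rw [flags, run_append, run_append, run_append]
  set σ1 := run (layer (3 * R + 1) (fun _ => []) x) σ with hσ1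
  have e1 : ∀ j < 3 * R + 1, σ1 (x j) = false := by
    intro j hj
    have := run_layer (n := 3 * R + 1) (cs := fun _ => []) (t := x) (σ := σ)
      (fun i hi j hj e => h.x_inj _ (by omega) _ (by omega) e) (by simp) hj
    rw [hσ1, this, hσ _ (by omega)]; rfl
  have e1' : ∀ w, (∀ j < 3 * R + 1, w ≠ x j) → σ1 w = σ w := fun w hw => run_layer_of_ne hw
  have e1'' : ∀ i, 3 * R + 1 ≤ i → i < s + R * b → σ1 (x i) = σ (x i) := by
    intro i hi hi'
    refine e1' _ fun j hj e => ?_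
    have := h.x_inj _ (by omega) _ (by omega) e; omega
  obtain ⟨a1, a2⟩ := run_andClasses h 4 σ1
  set σ2 := run (andClasses b R s x 4) σ1 with hσ2
  have a1' : ∀ r < R, σ2 (x r) = blockBit b s x r σ1 := by
    intro r hr
    rw [a1 r hr (by omega), e1 r (by omega), Bool.false_xor]
  have a2' : ∀ w, (∀ r < R, w ≠ x r) → σ2 w = σ1 w := fun w hw => a2 w fun r hr _ => hw r hr
  have a2x : ∀ i, R ≤ i → i < s + R * b → σ2 (x i) = σ1 (x i) := by
    intro i hi hi'
    refine a2' _ fun j hj e => ?_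
    have := h.x_inj _ (by omega) _ (by omega) e; omega
  obtain ⟨s1, s2⟩ := run_scan (flags_scanReg h) (σ := σ2)
    (fun i hi hi' => by
      rw [flag, if_neg (by omega), a2x _ (by omega) (by omega), e1 _ (by omega)])
    (fun i hi => by rw [a2x _ (by omega) (by omega), e1 _ (by omega)])
  set σ3 := run (scan R x (flag R x y) (fun j => x (2 * R + 1 + j))) σ2 with hσ3
  have s2x : ∀ i, i < s + R * b → (i ≤ R ∨ 2 * R < i) → σ3 (x i) = σ2 (x i) := by
    intro i hi hi'
    refine s2 _ fun j hj hj' e => ?_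
    rw [flag, if_neg (by omega)] at e
    have := h.x_inj _ (by omega) _ (by omega) e; omega
  obtain ⟨b1, b2⟩ := run_andClasses h 4 σ3
  set σ4 := run (andClasses b R s x 4) σ3 with hσ4
  have b2' : ∀ w, (∀ r < R, w ≠ x r) → σ4 w = σ3 w := fun w hw => b2 w fun r hr _ => hw r hr
  -- The scan changes no wire of the segments, so the second pass of `andClasses` erases the bits
  -- written by the first.
  have hbit : ∀ r < R, blockBit b s x r σ3 = blockBit b s x r σ1 := by
    intro r hr
    have h2 := mul_add_le (b := b) hr
    refine (local_bd h hr).run_congr ?_ _ ⟨_, by omega, by have := h.hb; omega, rfl⟩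
    rintro w ⟨i, hi, hi', rfl⟩
    rw [s2x i (by omega) (by omega), a2x i (by omega) (by omega)]
  have y1 : σ1 (y 0) = σ (y 0) := e1' _ fun j hj e => h.xy _ (by omega) 0 (by omega) e.symm
  have y2 : σ2 (y 0) = σ1 (y 0) := a2' _ fun j hj e => h.xy _ (by omega) 0 (by omega) e.symm
  have hF : ∀ r ≤ R, (σ (y 0) && pre (fun i => σ2 (x i)) r) =
      (σ (y 0) && pre (fun i => σ (x (s + i))) (r * b)) := by
    intro r
    induction r with
    | zero => simp [pre]
    | succ r ih =>
      intro hr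
      have ih := ih (by omega)
      have h2 := mul_add_le (b := b) (show r < R by omega)
      rw [pre, ← Bool.and_assoc, ih, Nat.succ_mul, pre_add, ← Bool.and_assoc]
      -- The bit stored for block `r` is meaningful only if the blocks below are set; otherwise the
      -- prefix already contains a zero and both sides vanish.
      by_cases hp : pre (fun i => σ (x (s + i))) (r * b) = true
      · congr 1
        rw [a1' r (by omega), blockBit, (run_local h (show r < R by omega) (σ := σ1) _).1 b le_rfl]
        · refine pre_congr fun i hi => ?_
          rw [blk, e1'' _ (by omega) (by omega), add_assoc]
        · intro j hj
          rw [pool, e1'' _ (by omega) (by omega)]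
          rcases Nat.lt_or_ge (s + r * b - 3 * b + j) s with hlt | hge
          · exact hσ _ hlt
          · have := pre_eq_true.1 hp (s + r * b - 3 * b + j - s) (by omega)
            rwa [show s + (s + r * b - 3 * b + j - s) = s + r * b - 3 * b + j by omega] at this
      · simp [hp]
  refine ⟨fun r hr => ?_, fun i hi hi' => ?_, fun w hw => ?_⟩
  · rw [b2', s1 r hr]
    · have : flag R x y 0 = y 0 := rfl
      rw [this, y2, y1, hF r hr]
    · intro j hj e
      exact (flags_scanReg h).xo _ hj _ hr e.symm
  · rcases Nat.lt_or_ge i R with hiR | hiR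
    · rw [b1 i hiR (by omega), s2x i (by omega) (by omega), a1' i hiR, hbit i hiR, Bool.xor_self]
    · rw [b2', s2x i (by omega) hi', a2x i hiR (by omega), e1 i hi]
      intro j hj e
      have := h.x_inj _ (by omega) _ (by omega) e; omega
  · rw [b2' w fun r hr => hw r (by omega), s2, a2' w fun r hr => hw r (by omega), e1' w hw]
    intro j hj hj' e
    rw [flag, if_neg (by omega)] at e
    exact hw _ (by omega) e

end Inc

/-! ### Negated increments -/

theorem exists_set {n : ℕ} {e : ℕ → ℕ} (he : ∀ i < n, ∀ j < n, e i = e j → i = j)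
    (σ v : ℕ → Bool) :
    ∃ σ' : ℕ → Bool, (∀ j < n, σ' (e j) = v j) ∧ ∀ w, (∀ j < n, w ≠ e j) → σ' w = σ w := by
  induction n with
  | zero => exact ⟨σ, by simp, fun _ _ => rfl⟩
  | succ n ih =>
    obtain ⟨τ, h1, h2⟩ := ih fun i hi j hj => he i (by omega) j (by omega)
    refine ⟨Function.update τ (e n) (v n), fun j hj => ?_, fun w hw => ?_⟩
    · rcases Nat.lt_succ_iff_lt_or_eq.1 hj with hj' | rfl
      · rw [Function.update_of_ne, h1 j hj']
        intro e'; have := he _ hj _ (by omega) e'; omega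
      · simp
    · rw [Function.update_of_ne (hw n (by omega)), h2 w fun j hj => hw j (by omega)]

/-- Flipping, if `c` is set, all bits except the lowest unset one and those below it does not affect
the number of set bits at the start. -/
theorem pre_neg (v : ℕ → Bool) (c : Bool) (n : ℕ) :
    pre (fun j => xor (v j) (c && !pre v j)) n = pre v n := by
  induction n with
  | zero => rfl
  | succ n ih => rw [pre, ih, pre]; cases pre v n <;> cases c <;> cases v n <;> rfl

/-- `σ'` arises from `σ` by flipping, if `c` is set, all of the bits `e j` that are above the
lowest unset one. -/
structure NegInc (n : ℕ) (e : ℕ → ℕ) (c : Bool) (σ σ' : ℕ → Bool) : Prop where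
  reg : ∀ j < n, σ' (e j) = xor (σ (e j)) (c && !pre (fun i => σ (e i)) j)
  out : ∀ w, (∀ j < n, w ≠ e j) → σ' w = σ w

section NegInc

variable {n : ℕ} {e : ℕ → ℕ} {c : Bool} {σ σ' : ℕ → Bool}

theorem exists_negInc (he : ∀ i < n, ∀ j < n, e i = e j → i = j) (c : Bool) (σ : ℕ → Bool) :
    ∃ σ', NegInc n e c σ σ' := by
  obtain ⟨σ', h1, h2⟩ := exists_set he σ fun j => xor (σ (e j)) (c && !pre (fun i => σ (e i)) j)
  exact ⟨σ', h1, h2⟩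

/-- The lowest unset bit and the bits below it are never flipped, so all prefix conjunctions
survive. Involutivity and every later uncomputation rest on this. -/
theorem NegInc.pre_eq (h : NegInc n e c σ σ') {j : ℕ} (hj : j ≤ n) :
    pre (fun i => σ' (e i)) j = pre (fun i => σ (e i)) j := by
  rw [← pre_neg (fun i => σ (e i)) c j]
  exact pre_congr fun i hi => h.reg i (by omega)

theorem NegInc.symm (h : NegInc n e c σ σ') : NegInc n e c σ' σ where
  reg := fun j hj => by rw [h.reg j hj, h.pre_eq hj.le, Bool.xor_assoc, Bool.xor_self, Bool.xor_false]
  out := fun w hw => (h.out w hw).symm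

theorem NegInc.unique (h : NegInc n e c σ σ') {σ'' : ℕ → Bool} (h' : NegInc n e c σ σ'') :
    σ' = σ'' := by
  ext w
  by_cases hw : ∃ j < n, w = e j
  · obtain ⟨j, hj, rfl⟩ := hw; rw [h.reg j hj, h'.reg j hj]
  · push Not at hw; rw [h.out w hw, h'.out w hw]

theorem negInc_false (σ : ℕ → Bool) : NegInc n e false σ σ := ⟨by simp, fun _ _ => rfl⟩

end NegInc

section Inc

variable (b R s : ℕ) (x y : ℕ → ℕ)

/-! ### Negated increment of the blocks, one class modulo 4 at a time -/

/-- Borrowed wire `j` for block `r`. -/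
def aux (r j : ℕ) : ℕ := y (1 + r / 4 * b + j)

/-- Adds to wire `j` of block `r` the conjunction of the wire `aux b y r j` and the negation of
`pool b s x r j`. -/
def negLayer (r : ℕ) : NCircuit :=
  layer b (fun j => [aux b y r j]) (blk b s x r) ++
    layer b (fun j => [aux b y r j, pool b s x r j]) (blk b s x r)

/-- Adds to wire `j` of block `r` the conjunction of the flag and the negation of `pool b s x r j`. -/
def negAdd (r : ℕ) : NCircuit :=
  negLayer b s x y r ++ fan (flag R x y r) b (aux b y r) ++
    (negLayer b s x y r ++ fan (flag R x y r) b (aux b y r))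

/-- Negated increment of block `r`. -/
def negBlock (r : ℕ) : NCircuit :=
  local' b s x r ++ negAdd b R s x y r ++ (local' b s x r).reverse

/-- The wires of `negBlock b R s x y r`. -/
def negWires (r : ℕ) : Set ℕ :=
  {w | w = flag R x y r ∨ w ∈ segment b s x r ∨ ∃ j < b, w = aux b y r j}

/-- Negated increment of the blocks of class `k` modulo 4. -/
def negClass (k : ℕ) : NCircuit := parN R fun r => if r % 4 = k then negBlock b R s x y r else []

/-- `negClass` for the classes below `k`. -/
def negClasses : ℕ → NCircuit
  | 0 => []
  | k + 1 => negClasses k ++ negClass b R s x y k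

variable {b R s x y} {Y : ℕ} (h : IncReg b R s Y x y) {r : ℕ} (hr : r < R)

include h hr

theorem aux_lt {j : ℕ} (hj : j < b) : 1 + r / 4 * b + j < Y := by
  have h1 := h.hY
  have := mul_add_le (b := b) (show r / 4 < R / 4 + 1 by omega)
  omega

omit h in
theorem blk_lt {j : ℕ} (hj : j < b) : s + r * b + j < s + R * b := by
  have := mul_add_le (b := b) hr
  omega

omit h hr in
theorem blk_mem {j : ℕ} (hj : j < b) : blk b s x r j ∈ segment b s x r :=
  ⟨_, by omega, by omega, rfl⟩

theorem flag_notMem : flag R x y r ∉ segment b s x r := by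
  have h1 := h.hs
  have h2 := h.hY
  unfold flag
  split_ifs
  · exact y_notMem_segment h hr (by omega)
  · exact notMem_segment_of_lt h hr (by omega)

theorem flag_ne_aux {j : ℕ} (hj : j < b) : flag R x y r ≠ aux b y r j := by
  have h1 := h.hs
  have h2 := aux_lt h hr hj
  unfold flag
  split_ifs
  · intro e; have := h.y_inj _ (by omega) _ h2 e; omega
  · exact h.xy _ (by omega) _ h2

theorem aux_inj : ∀ i < b, ∀ j < b, aux b y r i = aux b y r j → i = j := by
  intro i hi j hj e
  have := h.y_inj _ (aux_lt h hr hi) _ (aux_lt h hr hj) e; omega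

theorem blk_inj : ∀ i < b, ∀ j < b, blk b s x r i = blk b s x r j → i = j := by
  intro i hi j hj e
  have := h.x_inj _ (blk_lt hr hi) _ (blk_lt hr hj) e; omega

theorem blk_ne_aux {i j : ℕ} (hi : i < b) (hj : j < b) : blk b s x r i ≠ aux b y r j :=
  h.xy _ (blk_lt hr hi) _ (aux_lt h hr hj)

theorem blk_ne_pool {i j : ℕ} (hi : i < b) (hj : j < 3 * b) : blk b s x r i ≠ pool b s x r j := by
  have h1 := h.hs
  intro e
  have := mul_add_le (b := b) hr
  have := h.x_inj _ (blk_lt hr hi) _ (by omega) e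
  omega

theorem pool_ne_aux {i j : ℕ} (hi : i < 3 * b) (hj : j < b) : pool b s x r i ≠ aux b y r j := by
  have h1 := h.hs
  have := mul_add_le (b := b) hr
  exact h.xy _ (by omega) _ (aux_lt h hr hj)

theorem negLayer_bd : Bd (negWires b R s x y r) (negLayer b s x y r) 2 (2 * b) := by
  have h1 := h.hs
  have h3 := h.hb
  have hl : ∀ cs : ℕ → List ℕ, (∀ j < b, cs j = [aux b y r j] ∨
      cs j = [aux b y r j, pool b s x r j]) →
      Bd (negWires b R s x y r) (layer b cs (blk b s x r)) 1 b := by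
    intro cs hcs
    have hm : ∀ j < b, ∀ w ∈ cs j, w = aux b y r j ∨ w = pool b s x r j := by
      intro j hj w hw
      rcases hcs j hj with e | e <;> rw [e] at hw <;> simp at hw <;> tauto
    refine layer_bd ?_ ?_ ?_ ?_ ?_
    · intro j hj hw
      rcases hm j hj _ hw with e | e
      · exact blk_ne_aux h hr hj hj e
      · exact blk_ne_pool h hr hj (by omega) e
    · intro j hj; rcases hcs j hj with e | e <;> simp [e]
    · intro j hj; exact Or.inr (Or.inl (blk_mem hj))
    · intro j hj w hw
      rcases hm j hj _ hw with rfl | rfl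
      · exact Or.inr (Or.inr ⟨j, hj, rfl⟩)
      · exact Or.inr (Or.inl ⟨_, by omega, by omega, rfl⟩)
    · intro i hi j hj hij w hw hw'
      have hw1 : w = blk b s x r i ∨ w = aux b y r i ∨ w = pool b s x r i := by
        rcases List.mem_cons.1 hw with e | e
        · exact Or.inl e
        · exact Or.inr (hm i hi w e)
      have hw2 : w = blk b s x r j ∨ w = aux b y r j ∨ w = pool b s x r j := by
        rcases List.mem_cons.1 hw' with e | e
        · exact Or.inl e
        · exact Or.inr (hm j hj w e)
      rcases hw1 with rfl | rfl | rfl <;> rcases hw2 with e | e | e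
      · exact hij (blk_inj h hr _ hi _ hj e)
      · exact blk_ne_aux h hr hi hj e
      · exact blk_ne_pool h hr hi (by omega) e
      · exact blk_ne_aux h hr hj hi e.symm
      · exact hij (aux_inj h hr _ hi _ hj e)
      · exact pool_ne_aux h hr (by omega) hi e.symm
      · exact blk_ne_pool h hr hj (by omega) e.symm
      · exact pool_ne_aux h hr (by omega) hj e
      · have := mul_add_le (b := b) hr
        have := h.x_inj _ (by omega) _ (by omega) e; omega
  exact ((hl _ fun j hj => Or.inl rfl).seq (hl _ fun j hj => Or.inr rfl)).weaken (by omega)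
    (by omega)

theorem run_negLayer (σ : ℕ → Bool) :
    (∀ j < b, run (negLayer b s x y r) σ (blk b s x r j) =
      xor (σ (blk b s x r j)) (σ (aux b y r j) && !σ (pool b s x r j))) ∧
    ∀ w, (∀ j < b, w ≠ blk b s x r j) → run (negLayer b s x y r) σ w = σ w := by
  rw [negLayer, run_append]
  refine ⟨fun j hj => ?_, fun w hw => ?_⟩
  · rw [run_layer (blk_inj h hr) _ hj, run_layer (blk_inj h hr) _ hj]
    · simp only [List.all_cons, List.all_nil, Bool.and_true]
      rw [run_layer_of_ne fun i hi => (blk_ne_aux h hr hi hj).symm,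
        run_layer_of_ne fun i hi => (blk_ne_pool h hr hi (by omega)).symm]
      cases σ (blk b s x r j) <;> cases σ (aux b y r j) <;> cases σ (pool b s x r j) <;> rfl
    · intro i hi k hk
      simpa using blk_ne_aux h hr hi hk
    · intro i hi k hk
      simpa using ⟨blk_ne_aux h hr hi hk, blk_ne_pool h hr hi (by omega)⟩
  · rw [run_layer_of_ne hw, run_layer_of_ne hw]

theorem negAdd_bd : Bd (negWires b R s x y r) (negAdd b R s x y r) (4 * Nat.clog 2 b + 6)
    (8 * b) := by
  have hF := fan_bd (S := negWires b R s x y r) (c := flag R x y r) (n := b) (e := aux b y r)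
    (Or.inl rfl) (fun i hi => Or.inr (Or.inr ⟨i, hi, rfl⟩)) (fun i hi => flag_ne_aux h hr hi)
    (aux_inj h hr)
  have hL := negLayer_bd h hr
  exact ((hL.seq hF).seq (hL.seq hF)).weaken (by omega) (by omega)

/-- The flag has to act on `b` gates at once, so it is fanned out onto borrowed wires. Adding the
layer before and after the fan-out cancels their unknown contents, and a second fan-out restores
them. -/
theorem run_negAdd (σ : ℕ → Bool) :
    (∀ j < b, run (negAdd b R s x y r) σ (blk b s x r j) =
      xor (σ (blk b s x r j)) (σ (flag R x y r) && !σ (pool b s x r j))) ∧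
    ∀ w, (∀ j < b, w ≠ blk b s x r j) → run (negAdd b R s x y r) σ w = σ w := by
  rw [negAdd, run_append, run_append, run_append]
  have hfb : ∀ j < b, flag R x y r ≠ blk b s x r j := fun j hj e =>
    flag_notMem h hr (e ▸ blk_mem hj)
  obtain ⟨a1, a2⟩ := run_negLayer h hr σ
  set σ1 := run (negLayer b s x y r) σ
  obtain ⟨b1, b2⟩ := run_fan (fun i hi => flag_ne_aux h hr hi) (aux_inj h hr) σ1
  set σ2 := run (fan (flag R x y r) b (aux b y r)) σ1
  obtain ⟨c1, c2⟩ := run_negLayer h hr σ2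
  set σ3 := run (negLayer b s x y r) σ2
  obtain ⟨d1, d2⟩ := run_fan (fun i hi => flag_ne_aux h hr hi) (aux_inj h hr) σ3
  refine ⟨fun j hj => ?_, fun w hw => ?_⟩
  · rw [d2 _ fun i hi => blk_ne_aux h hr hj hi, c1 j hj, b2 _ fun i hi => blk_ne_aux h hr hj hi,
      a1 j hj, b1 j hj, b2 _ fun i hi => pool_ne_aux h hr (by omega) hi,
      a2 _ fun i hi => (blk_ne_aux h hr hi hj).symm, a2 _ hfb,
      a2 _ fun i hi => (blk_ne_pool h hr hi (by omega)).symm]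
    cases σ (blk b s x r j) <;> cases σ (aux b y r j) <;> cases σ (pool b s x r j) <;>
      cases σ (flag R x y r) <;> rfl
  · by_cases hw' : ∃ j < b, w = aux b y r j
    · obtain ⟨j, hj, rfl⟩ := hw'
      rw [d1 j hj, c2 _ hw, b1 j hj, c2 _ hfb, b2 _ fun i hi => flag_ne_aux h hr hi, a2 _ hw,
        Bool.xor_assoc, Bool.xor_self, Bool.xor_false]
    · push Not at hw'
      rw [d2 _ hw', c2 _ hw, b2 _ hw', a2 _ hw]

theorem negBlock_bd : Bd (negWires b R s x y r) (negBlock b R s x y r) (10 * Nat.clog 2 b + 14)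
    (20 * b) := by
  have hL := (local_bd h hr).mono (T := negWires b R s x y r) (fun w hw => Or.inr (Or.inl hw))
    le_rfl le_rfl
  exact ((hL.seq (negAdd_bd h hr)).seq hL.reverse).weaken (by omega) (by omega)

/-- If the flag is set, the pool contents computed by `local'` are functions of prefix conjunctions
and hence the same for the old and the new block, so reversing `local'` cleans up. If it is not set,
nothing happens between `local'` and its inverse, whatever the pool contains. -/
theorem run_negBlock {σ : ℕ → Bool}
    (hσ : σ (flag R x y r) = true → ∀ j < 3 * b, σ (pool b s x r j) = true) :
    NegInc b (blk b s x r) (σ (flag R x y r)) σ (run (negBlock b R s x y r) σ) := by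
  have h1 := h.hs
  have h2 := mul_add_le (b := b) hr
  have h3 := h.hb
  rw [negBlock, run_append, run_append]
  set τ := run (local' b s x r) σ with hτ
  obtain ⟨a1, a2⟩ := run_negAdd h hr τ
  have hflag : τ (flag R x y r) = σ (flag R x y r) := (local_bd h hr).run_of_notMem (flag_notMem h hr)
  by_cases hf : σ (flag R x y r) = true
  · obtain ⟨σ', hσ'⟩ := exists_negInc (blk_inj h hr) (σ (flag R x y r)) σ
    have hpool : ∀ j < 3 * b, σ' (pool b s x r j) = true := fun j hj => by
      rw [hσ'.out _ fun i hi => (blk_ne_pool h hr hi hj).symm, hσ hf j hj]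
    obtain ⟨l1, l2, l3⟩ := run_local h hr (hσ hf)
    obtain ⟨m1, m2, m3⟩ := run_local h hr hpool
    simp only [← hτ] at l1 l2 l3
    have key : run (negAdd b R s x y r) τ = run (local' b s x r) σ' := by
      ext w
      by_cases hw : ∃ j < b, w = blk b s x r j
      · obtain ⟨j, hj, rfl⟩ := hw
        rw [a1 j hj, m3 _ fun i hi => blk_ne_pool h hr hj (by omega), hσ'.reg j hj, hflag,
          l1 j hj.le, l3 _ fun i hi => blk_ne_pool h hr hj (by omega)]
      · push Not at hw
        rw [a2 w hw]
        by_cases hw' : ∃ j < 2 * b, w = pool b s x r (1 + j)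
        · obtain ⟨j, hj, rfl⟩ := hw'
          rcases Nat.lt_or_ge j b with hjb | hjb
          · rw [l1 _ (by omega), m1 _ (by omega), hσ'.pre_eq (by omega)]
          · rw [show 1 + j = b + 1 + (j - b) by omega, l2 _ (by omega), m2 _ (by omega)]
        · push Not at hw'
          rw [m3 w hw', l3 w hw', hσ'.out w hw]
    rw [key, (local_bd h hr).run_reverse_run]
    exact hσ'
  · rw [Bool.not_eq_true] at hf
    have key : run (negAdd b R s x y r) τ = τ := by
      ext w
      by_cases hw : ∃ j < b, w = blk b s x r j
      · obtain ⟨j, hj, rfl⟩ := hw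
        rw [a1 j hj, hflag, hf, Bool.false_and, Bool.xor_false]
      · push Not at hw
        exact a2 w hw
    rw [key, (local_bd h hr).run_reverse_run, hf]
    exact negInc_false σ

omit hr

/-- Each block has its own flag, segment and share of the borrowed wires, so all blocks of a class
can be processed at the same time. -/
theorem negWires_disj {r r' : ℕ} (hr : r < R) (hr' : r' < R) (hne : r ≠ r') (h4 : r % 4 = r' % 4) :
    ∀ w ∈ negWires b R s x y r, w ∉ negWires b R s x y r' := by
  have h1 := h.hs
  have h2 := h.hY
  have fa : ∀ {r r'}, r < R → r' < R → ∀ j < b, flag R x y r ≠ aux b y r' j := by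
    intro r r' hr hr' j hj
    have := aux_lt h hr' hj
    unfold flag
    split_ifs
    · intro e; have := h.y_inj _ (by omega) _ this e; omega
    · exact h.xy _ (by omega) _ this
  have fs : ∀ {r r'}, r < R → r' < R → flag R x y r ∉ segment b s x r' := by
    intro r r' hr hr'
    unfold flag
    split_ifs
    · exact y_notMem_segment h hr' (by omega)
    · exact notMem_segment_of_lt h hr' (by omega)
  rintro w (rfl | hw | ⟨i, hi, rfl⟩) (e | hw' | ⟨j, hj, e⟩)
  · exact hne ((flags_scanReg h).o_inj _ hr.le _ hr'.le e)
  · exact fs hr hr' hw'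
  · exact fa hr hr' j hj e
  · subst e; exact fs hr' hr hw
  · exact segment_disj h hr hr' hne h4 w hw hw'
  · subst e; exact y_notMem_segment h hr (aux_lt h hr' hj) hw
  · exact fa hr' hr i hi e.symm
  · exact y_notMem_segment h hr' (aux_lt h hr hi) hw'
  · have e := h.y_inj _ (aux_lt h hr hi) _ (aux_lt h hr' hj) e
    have a : ∀ {r r'}, r < r' → r % 4 = r' % 4 → r / 4 * b + b ≤ r' / 4 * b := fun hl h4 =>
      (mul_add_le_four (b := b) hl h4).2
    rcases Nat.lt_or_gt_of_ne hne with hl | hl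
    · have := a hl h4; omega
    · have := a hl h4.symm; omega

omit h in
variable (b R s x y) in
/-- The wires of `negClass` for block `r`. -/
def negClassWires (k r : ℕ) : Set ℕ := {w | r % 4 = k ∧ w ∈ negWires b R s x y r}

include hr in
theorem negClass_single_bd (k : ℕ) : Bd (negClassWires b R s x y k r)
    (if r % 4 = k then negBlock b R s x y r else []) (10 * Nat.clog 2 b + 14) (20 * b) := by
  split_ifs with hk
  · exact (negBlock_bd h hr).mono (fun w hw => ⟨hk, hw⟩) le_rfl le_rfl
  · exact Bd.nil'

theorem negClassWires_disj (k : ℕ) : ∀ i < R, ∀ j < R, i ≠ j →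
    ∀ w ∈ negClassWires b R s x y k i, w ∉ negClassWires b R s x y k j := by
  rintro i hi j hj hij w ⟨hk, hw⟩ ⟨hk', hw'⟩
  exact negWires_disj h hi hj hij (hk.trans hk'.symm) w hw hw'

omit h in
variable (b R s x y) in
/-- The wires below a flagged block are set. -/
def Flagged (σ : ℕ → Bool) : Prop :=
  ∀ r < R, σ (flag R x y r) = true → ∀ i, s - 3 * b ≤ i → i < s + r * b → σ (x i) = true

theorem run_negClass (k : ℕ) {σ : ℕ → Bool} (hσ : Flagged b R s x y σ) :
    (∀ r < R, r % 4 = k → ∀ j < b, run (negClass b R s x y k) σ (blk b s x r j) =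
      xor (σ (blk b s x r j)) (σ (flag R x y r) && !pre (fun i => σ (blk b s x r i)) j)) ∧
    ∀ w, (∀ r < R, r % 4 = k → ∀ j < b, w ≠ blk b s x r j) →
      run (negClass b R s x y k) σ w = σ w := by
  have h1 := h.hs
  have single : ∀ r < R,
      NegInc b (blk b s x r) (σ (flag R x y r)) σ (run (negBlock b R s x y r) σ) := fun r hr =>
    run_negBlock h hr fun hf j hj => hσ r hr hf _ (by omega) (by omega)
  refine ⟨fun r hr hk j hj => ?_, fun w hw => ?_⟩
  · rw [negClass, run_parN (S := negClassWires b R s x y k) (d := fun _ => 10 * Nat.clog 2 b + 14)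
      (k := fun _ => 20 * b) (fun i hi => negClass_single_bd h hi k) (negClassWires_disj h k) σ hr
      ⟨hk, Or.inr (Or.inl (blk_mem hj))⟩, if_pos hk, (single r hr).reg j hj]
  · by_cases hw' : ∃ r < R, w ∈ negClassWires b R s x y k r
    · obtain ⟨r, hr, hwr⟩ := hw'
      rw [negClass, run_parN (S := negClassWires b R s x y k)
        (d := fun _ => 10 * Nat.clog 2 b + 14) (k := fun _ => 20 * b)
        (fun i hi => negClass_single_bd h hi k) (negClassWires_disj h k) σ hr hwr, if_pos hwr.1,
        (single r hr).out w (hw r hr hwr.1)]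
    · push Not at hw'
      exact run_parN_of_notMem (S := negClassWires b R s x y k)
        (d := fun _ => 10 * Nat.clog 2 b + 14) (k := fun _ => 20 * b)
        (fun i hi => negClass_single_bd h hi k) σ hw'

theorem blk_disj {r r' : ℕ} (hr : r < R) (hr' : r' < R) {i j : ℕ} (hi : i < b) (hj : j < b)
    (e : blk b s x r i = blk b s x r' j) : r = r' := by
  have e := h.x_inj _ (blk_lt hr hi) _ (blk_lt hr' hj) e
  by_contra hne
  rcases Nat.lt_or_gt_of_ne hne with hl | hl
  · have := mul_add_le (b := b) hl; omega
  · have := mul_add_le (b := b) hl; omega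

theorem flag_ne_blk {r r' : ℕ} (hr : r ≤ R) (hr' : r' < R) {j : ℕ} (hj : j < b) :
    flag R x y r ≠ blk b s x r' j := by
  have h1 := h.hs
  have h2 := h.hY
  have h3 := mul_add_le (b := b) hr'
  unfold flag
  split_ifs
  · exact fun e => h.xy _ (blk_lt hr' hj) 0 (by omega) e.symm
  · intro e
    have := h.x_inj _ (by omega) _ (blk_lt hr' hj) e; omega

/-- `Flagged` is preserved: wires below a flagged block belong to the low part or to blocks that are
entirely set, and a negated increment leaves such blocks alone. Later classes therefore still find
valid workspace. -/
theorem run_negClasses (k : ℕ) {σ : ℕ → Bool} (hσ : Flagged b R s x y σ) :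
    (∀ r < R, r % 4 < k → ∀ j < b, run (negClasses b R s x y k) σ (blk b s x r j) =
      xor (σ (blk b s x r j)) (σ (flag R x y r) && !pre (fun i => σ (blk b s x r i)) j)) ∧
    (∀ w, (∀ r < R, r % 4 < k → ∀ j < b, w ≠ blk b s x r j) →
      run (negClasses b R s x y k) σ w = σ w) := by
  have h1 := h.hs
  induction k with
  | zero => simp [negClasses]
  | succ k ih =>
    obtain ⟨i1, i2⟩ := ih
    set τ := run (negClasses b R s x y k) σ with hτ
    have tf : ∀ r < R, τ (flag R x y r) = σ (flag R x y r) := fun r hr =>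
      i2 _ fun r' hr' _ j hj => flag_ne_blk h hr.le hr' hj
    have hF : Flagged b R s x y τ := by
      intro r hr hf i hi hi'
      rw [tf r hr] at hf
      by_cases hw : ∃ r' < R, r' % 4 < k ∧ ∃ j < b, x i = blk b s x r' j
      · obtain ⟨r', hr', hk', j, hj, e⟩ := hw
        have e' := h.x_inj _ (by have := mul_add_le (b := b) hr; omega) _ (blk_lt hr' hj) e
        have hrr : r' < r := by
          by_contra hcon
          have := Nat.mul_le_mul_right b (Nat.le_of_not_lt hcon); omega
        have hm := mul_add_le (b := b) hrr
        rw [e, i1 r' hr' hk' j hj, blk, hσ r hr hf _ (by omega) (by omega), pre_eq_true.2]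
        · simp
        · intro l hl; exact hσ r hr hf _ (by omega) (by omega)
      · push Not at hw
        rw [i2 _ fun r' hr' hk' j hj => hw r' hr' hk' j hj]
        exact hσ r hr hf i hi hi'
    obtain ⟨j1, j2⟩ := run_negClass h k hF
    refine ⟨fun r hr hk j hj => ?_, fun w hw => ?_⟩
    · rw [negClasses, run_append]
      rcases Nat.lt_succ_iff_lt_or_eq.1 hk with hk' | hk'
      · rw [j2, i1 r hr hk' j hj]
        intro r' hr' hk'' j' hj' e
        have := blk_disj h hr hr' hj hj' e; subst this; omega
      · have hb : ∀ i < b, τ (blk b s x r i) = σ (blk b s x r i) := by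
          intro i hi
          refine i2 _ fun r' hr' hk'' j' hj' e => ?_
          have := blk_disj h hr hr' hi hj' e; subst this; omega
        rw [j1 r hr hk' j hj, hb j hj, tf r hr, pre_congr fun i hi => hb i (by omega)]
    · rw [negClasses, run_append, j2 w fun r hr hk => hw r hr (by omega),
        i2 w fun r hr hk => hw r hr (by omega)]

omit h in
variable (b R s x y Y) in
/-- All wires of the increment. -/
def incWires : Set ℕ := {w | (∃ i < s + R * b, w = x i) ∨ ∃ i < Y, w = y i}

theorem negClasses_bd (k : ℕ) : Bd (incWires b R s x y Y) (negClasses b R s x y k)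
    (k * (10 * Nat.clog 2 b + 14)) (k * (R * (20 * b))) := by
  induction k with
  | zero => exact Bd.nil'
  | succ k ih =>
    refine (ih.seq (Bd.parN (fun i hi => negClass_single_bd h hi k) (negClassWires_disj h k)
      ?_)).weaken (Nat.succ_mul _ _).ge (Nat.succ_mul _ _).ge
    have h1 := h.hs
    have h2 := h.hY
    rintro r hr w ⟨hk, rfl | ⟨i, hi, hi', rfl⟩ | ⟨j, hj, rfl⟩⟩
    · unfold flag
      split_ifs
      · exact Or.inr ⟨0, by omega, rfl⟩
      · exact Or.inl ⟨_, by omega, rfl⟩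
    · have h2 := mul_add_le (b := b) hr
      exact Or.inl ⟨i, by omega, rfl⟩
    · exact Or.inr ⟨_, aux_lt h hr hj, rfl⟩

end Inc

section Inc

variable (b R s : ℕ) (x y : ℕ → ℕ)

/-! ### Negated increment of all blocks together -/

/-- Adds to every wire of block `r` its flag, and to every wire of every block the wire `y 0`. -/
def flagFans : NCircuit :=
  parN R (fun r => fan (flag R x y r) b (blk b s x r)) ++ fan (y 0) (R * b) fun t => x (s + t)

/-- Negated increment of the blocks, controlled by `y 0`, provided that `x 0, …, x (s - 1)` are
set. -/
def negIncBlocks : NCircuit :=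
  flags b R s x y ++ (negClasses b R s x y 4 ++ (flagFans b R s x y ++ (flags b R s x y).reverse))

variable {b R s x y} {Y : ℕ} (h : IncReg b R s Y x y)

include h

theorem high_inj : ∀ i < R * b, ∀ j < R * b, x (s + i) = x (s + j) → i = j := by
  intro i hi j hj e
  have := h.x_inj _ (by omega) _ (by omega) e; omega

theorem y_ne_high {i t : ℕ} (hi : i < Y) (ht : t < R * b) : y i ≠ x (s + t) := fun e =>
  h.xy _ (by omega) _ hi e.symm

theorem exists_blk {t : ℕ} (ht : t < R * b) : ∃ r < R, ∃ j < b, t = r * b + j := by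
  have := h.hb
  refine ⟨t / b, ?_, t % b, Nat.mod_lt _ (by omega), (Nat.div_add_mod' t b).symm⟩
  exact Nat.div_lt_of_lt_mul (by rwa [mul_comm])

theorem flagFan_bd {r : ℕ} (hr : r < R) :
    Bd {w | w = flag R x y r ∨ ∃ j < b, w = blk b s x r j}
      (fan (flag R x y r) b (blk b s x r)) (2 * Nat.clog 2 b + 1) (2 * b) :=
  fan_bd (Or.inl rfl) (fun i hi => Or.inr ⟨i, hi, rfl⟩)
    (fun _ hi => flag_ne_blk h hr.le hr hi) (blk_inj h hr)

theorem flagFan_disj : ∀ i < R, ∀ j < R, i ≠ j →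
    ∀ w ∈ {w | w = flag R x y i ∨ ∃ k < b, w = blk b s x i k},
      w ∉ {w | w = flag R x y j ∨ ∃ k < b, w = blk b s x j k} := by
  rintro i hi j hj hij w (rfl | ⟨k, hk, rfl⟩) (e | ⟨l, hl, e⟩)
  · exact hij ((flags_scanReg h).o_inj _ hi.le _ hj.le e)
  · exact flag_ne_blk h hi.le hj hl e
  · exact flag_ne_blk h hj.le hi hk e.symm
  · exact hij (blk_disj h hi hj hk hl e)

theorem flagFans_bd : Bd (incWires b R s x y Y) (flagFans b R s x y)
    (2 * Nat.clog 2 b + 2 * Nat.clog 2 (R * b) + 2) (4 * (R * b)) := by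
  have h1 := h.hs
  have h2 := h.hY
  have hF := fan_bd (S := incWires b R s x y Y) (c := y 0) (n := R * b) (e := fun t => x (s + t))
    (Or.inr ⟨0, by omega, rfl⟩) (fun i hi => Or.inl ⟨_, by omega, rfl⟩)
    (fun i hi => y_ne_high h (by omega) hi) (high_inj h)
  refine ((Bd.parN (T := incWires b R s x y Y) (fun r hr => flagFan_bd h hr) (flagFan_disj h)
    ?_).seq hF).weaken (by omega) (by rw [Nat.mul_left_comm]; omega)
  rintro r hr w (rfl | ⟨j, hj, rfl⟩)
  · unfold flag
    split_ifs
    · exact Or.inr ⟨0, by omega, rfl⟩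
    · exact Or.inl ⟨_, by omega, rfl⟩
  · exact Or.inl ⟨_, blk_lt hr hj, rfl⟩

theorem run_flagFans (σ : ℕ → Bool) :
    (∀ r < R, ∀ j < b, run (flagFans b R s x y) σ (blk b s x r j) =
      xor (xor (σ (blk b s x r j)) (σ (flag R x y r))) (σ (y 0))) ∧
    ∀ w, (∀ t < R * b, w ≠ x (s + t)) → run (flagFans b R s x y) σ w = σ w := by
  have h1 := h.hs
  have h2 := h.hY
  rw [flagFans, run_append]
  set τ := run (parN R fun r => fan (flag R x y r) b (blk b s x r)) σ with hτ
  obtain ⟨f1, f2⟩ := run_fan (c := y 0) (n := R * b) (e := fun t => x (s + t))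
    (fun i hi => y_ne_high h (by omega) hi) (high_inj h) τ
  have t1 : ∀ r < R, ∀ j < b, τ (blk b s x r j) = xor (σ (blk b s x r j)) (σ (flag R x y r)) := by
    intro r hr j hj
    rw [hτ, run_parN (d := fun _ => 2 * Nat.clog 2 b + 1) (k := fun _ => 2 * b)
      (fun i hi => flagFan_bd h hi) (flagFan_disj h) σ hr (Or.inr ⟨j, hj, rfl⟩),
      (run_fan (fun i hi => flag_ne_blk h hr.le hr hi) (blk_inj h hr) σ).1 j hj]
  have t2 : ∀ w, (∀ r < R, ∀ j < b, w ≠ blk b s x r j) → τ w = σ w := by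
    intro w hw
    by_cases hw' : ∃ r < R, w ∈ {w | w = flag R x y r ∨ ∃ j < b, w = blk b s x r j}
    · obtain ⟨r, hr, hwr⟩ := hw'
      rw [hτ, run_parN (d := fun _ => 2 * Nat.clog 2 b + 1) (k := fun _ => 2 * b)
        (fun i hi => flagFan_bd h hi) (flagFan_disj h) σ hr hwr,
        (run_fan (fun i hi => flag_ne_blk h hr.le hr hi) (blk_inj h hr) σ).2 w (hw r hr)]
    · push Not at hw'
      exact run_parN_of_notMem (d := fun _ => 2 * Nat.clog 2 b + 1) (k := fun _ => 2 * b)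
        (fun i hi => flagFan_bd h hi) σ hw'
  refine ⟨fun r hr j hj => ?_, fun w hw => ?_⟩
  · have := f1 (r * b + j) (by have := mul_add_le (b := b) hr; omega)
    have e : x (s + (r * b + j)) = blk b s x r j := by rw [blk, add_assoc]
    rw [e] at this
    rw [this, t1 r hr j hj, t2 (y 0) fun r' hr' j' hj' => ?_]
    exact fun e => h.xy _ (blk_lt hr' hj') 0 (by omega) e.symm
  · rw [f2 w hw, t2 w]
    intro r hr j hj e
    have hm := mul_add_le (b := b) hr
    exact hw (r * b + j) (by omega) (by rw [e, blk, add_assoc])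

theorem flags_bd' : Bd (incWires b R s x y Y) (flags b R s x y)
    (48 * Nat.clog 2 b + 3 * Nat.clog 2 R + 76) (7 * R + 1 + 104 * (R * b)) := by
  have h2 := h.hY
  refine (flags_bd h).mono ?_ le_rfl le_rfl
  rintro w (rfl | hw)
  · exact Or.inr ⟨0, by omega, rfl⟩
  · exact Or.inl hw

theorem negIncBlocks_bd : Bd (incWires b R s x y Y) (negIncBlocks b R s x y)
    (146 * Nat.clog 2 (s + R * b) + 210) (306 * (R * b) + 2) := by
  have h1 := h.hs
  have h3 := h.hb
  have c1 : Nat.clog 2 b ≤ Nat.clog 2 (s + R * b) := Nat.clog_mono_right 2 (by omega)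
  have c2 : Nat.clog 2 R ≤ Nat.clog 2 (s + R * b) := Nat.clog_mono_right 2 (by omega)
  have c3 : Nat.clog 2 (R * b) ≤ Nat.clog 2 (s + R * b) := Nat.clog_mono_right 2 (by omega)
  have hRb : R ≤ R * b := Nat.le_mul_of_pos_right R h3
  have hU := flags_bd' h
  refine (hU.seq ((negClasses_bd h 4).seq ((flagFans_bd h).seq hU.reverse))).weaken (by omega) ?_
  rw [show R * (20 * b) = 20 * (R * b) by ring]
  omega

/-- Within block `r`, bit `j` has been flipped by `flag r ∧ ¬ pre j`. Adding `flag r` and `y 0`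
gives `y 0 ∧ ¬ (pre (r * b) ∧ pre j)`, since `flag r = y 0 ∧ pre (r * b)`; this is the negated
increment across blocks. -/
theorem run_negIncBlocks {σ : ℕ → Bool} (hσ : ∀ i < s, σ (x i) = true) :
    NegInc (R * b) (fun t => x (s + t)) (σ (y 0)) σ (run (negIncBlocks b R s x y) σ) := by
  have h1 := h.hs
  have h2 := h.hY
  rw [negIncBlocks, run_append, run_append, run_append]
  obtain ⟨a1, a2, a3⟩ := run_flags h hσ
  set τ := run (flags b R s x y) σ
  have τx : ∀ i, 3 * R + 1 ≤ i → i < s + R * b → τ (x i) = σ (x i) := by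
    intro i hi hi'
    refine a3 _ fun j hj e => ?_
    have := h.x_inj _ hi' _ (by omega) e; omega
  have hF : Flagged b R s x y τ := by
    intro r hr hf i hi hi'
    have hm := mul_add_le (b := b) hr
    rw [a1 r hr.le, Bool.and_eq_true] at hf
    rw [τx i (by omega) (by omega)]
    rcases Nat.lt_or_ge i s with his | his
    · exact hσ i his
    · have := pre_eq_true.1 hf.2 (i - s) (by omega)
      rwa [show s + (i - s) = i by omega] at this
  obtain ⟨b1, b2⟩ := run_negClasses h 4 hF
  set τ1 := run (negClasses b R s x y 4) τ
  obtain ⟨c1, c2⟩ := run_flagFans h τ1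
  set τ2 := run (flagFans b R s x y) τ1
  obtain ⟨σ', hσ'⟩ := exists_negInc (high_inj h) (σ (y 0)) σ
  have hσ1 : ∀ i < s, σ' (x i) = true := by
    intro i hi
    rw [hσ'.out, hσ i hi]
    intro t ht e
    have := h.x_inj _ (by omega) _ (by omega) e; omega
  have hy0 : σ' (y 0) = σ (y 0) := hσ'.out _ fun t ht => y_ne_high h (by omega) ht
  obtain ⟨d1, d2, d3⟩ := run_flags h hσ1
  -- Computing the flags from the final register gives the same low part as from the initial one, so
  -- reversing `flags` leads to `σ'`.
  have key : τ2 = run (flags b R s x y) σ' := by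
    have lowout : ∀ w, (∀ t < R * b, w ≠ x (s + t)) → τ2 w = τ w := by
      intro w hw
      rw [c2 w hw, b2]
      intro r hr _ j hj e
      have hm := mul_add_le (b := b) hr
      exact hw (r * b + j) (by omega) (by rw [e, blk, add_assoc])
    have low : ∀ i < s, τ2 (x i) = τ (x i) := by
      intro i hi
      refine lowout _ fun t ht e => ?_
      have := h.x_inj _ (by omega) _ (by omega) e; omega
    have flg : ∀ r ≤ R, τ (flag R x y r) = run (flags b R s x y) σ' (flag R x y r) := by
      intro r hr
      rw [a1 r hr, d1 r hr, hy0, hσ'.pre_eq (Nat.mul_le_mul_right b hr)]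
    ext w
    by_cases hw : ∃ t < R * b, w = x (s + t)
    · obtain ⟨t, ht, rfl⟩ := hw
      obtain ⟨r, hr, j, hj, rfl⟩ := exists_blk h ht
      have e : x (s + (r * b + j)) = blk b s x r j := by rw [blk, add_assoc]
      rw [d3, hσ'.reg _ ht, e, c1 r hr j hj, b1 r hr (by omega) j hj,
        b2 _ fun r' hr' _ j' hj' => flag_ne_blk h hr.le hr' hj',
        b2 (y 0) fun r' hr' _ j' hj' e => h.xy _ (blk_lt hr' hj') 0 (by omega) e.symm]
      · have e0 : τ (y 0) = σ (y 0) := a3 _ fun j hj e => h.xy _ (by omega) 0 (by omega) e.symm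
        have eb : ∀ i ≤ j, τ (blk b s x r i) = σ (blk b s x r i) := fun i hi =>
          τx _ (by omega) (blk_lt hr (by omega))
        rw [eb j le_rfl, a1 r hr.le, e0, pre_add, pre_congr fun i hi => eb i (by omega)]
        simp only [blk, add_assoc]
        generalize σ (x _) = p
        generalize σ (y 0) = q
        generalize pre _ (r * b) = u
        generalize pre _ j = v
        revert p q u v; decide
      · intro i hi e
        have := h.x_inj _ (by omega) _ (by omega) e; omega
    · push Not at hw
      rw [lowout w hw]
      by_cases hw' : ∃ i < 3 * R + 1, w = x i
      · obtain ⟨i, hi, rfl⟩ := hw'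
        by_cases hi' : i ≤ R ∨ 2 * R < i
        · rw [a2 i hi hi', d2 i hi hi']
        · have := flg (i - R) (by omega)
          rwa [flag, if_neg (by omega), show R + (i - R) = i by omega] at this
      · push Not at hw'
        rw [a3 w hw', d3 w hw', hσ'.out w hw]
  rw [key, (flags_bd h).run_reverse_run]
  exact hσ'

end Inc

/-! ### Controlled increment of the part above the low wires -/

/-- The wires of `incHigh b R s f x y` are distinct. -/
structure IncHighReg (b R s Y f : ℕ) (x y : ℕ → ℕ) : Prop extends IncReg b R s Y x y where
  hs' : s + 3 ≤ Y
  fx : ∀ i < s + R * b, f ≠ x i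
  fy : ∀ i < Y, f ≠ y i

section IncHigh

variable (b R s f : ℕ) (x y : ℕ → ℕ)

/-- The wires `f, x 0, x 1, …`. -/
def withCtrl (i : ℕ) : ℕ := if i = 0 then f else x (i - 1)

/-- Flips `y 0` if `f` and `x 0, …, x (s - 1)` are set. -/
def lowAnd : NCircuit := mcx (s + 1) (withCtrl f x) (fun i => y (2 + i)) (y 1) (y 0)

/-- Adds to `x (s + t)`, for `t < R * b`, the conjunction of `f` and the wires `x i` below. -/
def incHigh : NCircuit :=
  (negIncBlocks b R s x y).reverse ++ (lowAnd s f x y ++ (negIncBlocks b R s x y ++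
    (fan (y 0) (R * b) (fun t => x (s + t)) ++ (lowAnd s f x y ++
      fan (y 0) (R * b) (fun t => x (s + t))))))

variable {b R s f x y} {Y : ℕ} (h : IncHighReg b R s Y f x y)

theorem pre_withCtrl (σ : ℕ → Bool) (n : ℕ) :
    pre (fun i => σ (withCtrl f x i)) (n + 1) = (σ f && pre (fun i => σ (x i)) n) := by
  rw [add_comm, pre_add]
  simp only [pre, Bool.true_and]
  congr 1
  exact pre_congr fun i hi => by rw [withCtrl, if_neg (by omega), Nat.add_sub_cancel_left]

include h

theorem lowAnd_reg : McxReg (s + 1) (withCtrl f x) (fun i => y (2 + i)) (y 1) (y 0) := by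
  have h1 := h.hs'
  have hv : ∀ i < s + 1, ∀ j < Y, withCtrl f x i ≠ y j := by
    intro i hi j hj
    unfold withCtrl
    split_ifs
    · exact h.fy j hj
    · exact h.xy _ (by omega) j hj
  constructor
  · constructor
    · intro i hi j hj e
      unfold withCtrl at e
      split_ifs at e
      · omega
      · exact absurd e (h.fx _ (by omega))
      · exact absurd e.symm (h.fx _ (by omega))
      · have := h.x_inj _ (by omega) _ (by omega) e; omega
    · intro i hi j hj e
      have := h.y_inj _ (by omega) _ (by omega) e; omega
    · intro i hi j hj; exact hv i hi _ (by omega)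
  · intro i hi e; exact hv i hi _ (by omega) e.symm
  · intro i hi e
    have := h.y_inj _ (by omega) _ (by omega) e; omega
  · intro i hi e; exact hv i hi _ (by omega) e.symm
  · intro i hi e
    have := h.y_inj _ (by omega) _ (by omega) e; omega
  · intro e
    have := h.y_inj _ (by omega) _ (by omega) e; omega

theorem run_lowAnd (σ : ℕ → Bool) : run (lowAnd s f x y) σ =
    Function.update σ (y 0) (xor (σ (y 0)) (σ f && pre (fun i => σ (x i)) s)) := by
  rw [lowAnd, run_mcx (lowAnd_reg h), pre_withCtrl]

theorem incHigh_bd : Bd {w | w = f ∨ w ∈ incWires b R s x y Y} (incHigh b R s f x y)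
    (608 * Nat.clog 2 (s + R * b + 1) + 710) (616 * (R * b) + 82 * s + 366) := by
  have h1 := h.hs'
  have c1 : Nat.clog 2 (s + R * b) ≤ Nat.clog 2 (s + R * b + 1) := Nat.clog_mono_right 2 (by omega)
  have c2 : Nat.clog 2 (s + 1) ≤ Nat.clog 2 (s + R * b + 1) := Nat.clog_mono_right 2 (by omega)
  have c3 : Nat.clog 2 (R * b) ≤ Nat.clog 2 (s + R * b + 1) := Nat.clog_mono_right 2 (by omega)
  have hK := (negIncBlocks_bd h.toIncReg).mono (T := {w | w = f ∨ w ∈ incWires b R s x y Y})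
    (fun w hw => Or.inr hw) le_rfl le_rfl
  have hF := fan_bd (S := {w | w = f ∨ w ∈ incWires b R s x y Y}) (c := y 0) (n := R * b)
    (e := fun t => x (s + t)) (Or.inr (Or.inr ⟨0, by omega, rfl⟩))
    (fun i hi => Or.inr (Or.inl ⟨_, by omega, rfl⟩))
    (fun i hi => y_ne_high h.toIncReg (by omega) hi) (high_inj h.toIncReg)
  have hP := mcx_bd (S := {w | w = f ∨ w ∈ incWires b R s x y Y}) (lowAnd_reg h)
    (fun i hi => by
      unfold withCtrl
      split_ifs
      · exact Or.inl rfl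
      · exact Or.inr (Or.inl ⟨_, by omega, rfl⟩))
    (fun i hi => Or.inr (Or.inr ⟨_, by omega, rfl⟩)) (Or.inr (Or.inr ⟨_, by omega, rfl⟩))
    (Or.inr (Or.inr ⟨_, by omega, rfl⟩))
  exact (hK.reverse.seq (hP.seq (hK.seq (hF.seq (hP.seq hF))))).weaken (by omega) (by omega)

/-- If `f` and the low wires are set, `y 0` is toggled between two negated increments, so exactly
one takes effect; the two fan-outs contribute the complement and turn it into an increment.
Otherwise `y 0` is never toggled and the circuit cancels in pairs, even where the blocks act on
workspace that is not clean. -/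
theorem run_incHigh (σ : ℕ → Bool) :
    (∀ t < R * b, run (incHigh b R s f x y) σ (x (s + t)) =
      xor (σ (x (s + t))) (σ f && pre (fun i => σ (x i)) (s + t))) ∧
    ∀ w, (∀ t < R * b, w ≠ x (s + t)) → run (incHigh b R s f x y) σ w = σ w := by
  have h1 := h.hs'
  have hI := h.toIncReg
  have hb := (negIncBlocks_bd hI)
  have hyx : ∀ t < R * b, y 0 ≠ x (s + t) := fun t ht => y_ne_high hI (by omega) ht
  have hfx : ∀ t < R * b, f ≠ x (s + t) := fun t ht => h.fx _ (by omega)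
  have hxx : ∀ i < s, ∀ t < R * b, x i ≠ x (s + t) := fun i hi t ht e => by
    have := h.x_inj _ (by omega) _ (by omega) e; omega
  have hyf : y 0 ≠ f := fun e => h.fy 0 (by omega) e.symm
  have hxy : ∀ i < s + R * b, x i ≠ y 0 := fun i hi => h.xy i hi 0 (by omega)
  set cond : (ℕ → Bool) → Bool := fun σ => σ f && pre (fun i => σ (x i)) s with hcond
  have cond_congr : ∀ σ τ : ℕ → Bool, (∀ w, (∀ t < R * b, w ≠ x (s + t)) → w ≠ y 0 → σ w = τ w) →
      cond σ = cond τ := by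
    intro σ τ e
    simp only [hcond]
    rw [e f hfx hyf.symm, pre_congr fun i hi => e _ (hxx i hi) (hxy i (by omega))]
  have hP : ∀ σ, run (lowAnd s f x y) σ = Function.update σ (y 0) (xor (σ (y 0)) (cond σ)) :=
    run_lowAnd h
  have low : ∀ σ, cond σ = true → ∀ i < s, σ (x i) = true := fun σ hσ =>
    pre_eq_true.1 ((Bool.and_eq_true _ _).mp hσ).2
  have fanspec := fun σ => run_fan (c := y 0) (n := R * b) (e := fun t => x (s + t)) hyx (high_inj hI) σ
  rw [incHigh, run_append, run_append, run_append, run_append, run_append]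
  by_cases hc : cond σ = true
  · obtain ⟨σ1, hσ1⟩ := exists_negInc (high_inj hI) (σ (y 0)) σ
    have c1 : cond σ1 = true := by
      rw [← hc]; exact cond_congr _ _ fun w hw _ => hσ1.out w hw
    have y1 : σ1 (y 0) = σ (y 0) := hσ1.out _ hyx
    have r1 : run (negIncBlocks b R s x y).reverse σ = σ1 := by
      have := run_negIncBlocks hI (low _ c1)
      rw [y1] at this
      rw [hσ1.symm.unique this, hb.run_reverse_run]
    rw [r1, hP σ1, c1, Bool.xor_true, y1]
    set σ2 := Function.update σ1 (y 0) (!σ (y 0)) with hσ2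
    have e2 : ∀ w, w ≠ y 0 → σ2 w = σ1 w := fun w hw => Function.update_of_ne hw _ _
    have c2 : cond σ2 = true := by rw [← c1]; exact cond_congr _ _ fun w _ hw => e2 w hw
    have y2 : σ2 (y 0) = !σ (y 0) := Function.update_self _ _ _
    have r2 := run_negIncBlocks hI (low _ c2)
    rw [y2] at r2
    set σ3 := run (negIncBlocks b R s x y) σ2
    obtain ⟨f1, f2⟩ := fanspec σ3
    set σ4 := run (fan (y 0) (R * b) fun t => x (s + t)) σ3
    have y4 : σ4 (y 0) = !σ (y 0) := by rw [f2 _ hyx, r2.out _ hyx, y2]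
    have c4 : cond σ4 = true := by
      rw [← c2]; exact cond_congr _ _ fun w hw _ => by rw [f2 w hw, r2.out w hw]
    rw [hP σ4, c4, y4]
    set σ5 := Function.update σ4 (y 0) (xor (!σ (y 0)) true) with hσ5
    have e5 : ∀ w, w ≠ y 0 → σ5 w = σ4 w := fun w hw => Function.update_of_ne hw _ _
    have y5 : σ5 (y 0) = σ (y 0) := by rw [hσ5, Function.update_self]; simp
    obtain ⟨g1, g2⟩ := fanspec σ5
    refine ⟨fun t ht => ?_, fun w hw => ?_⟩
    · have e := g1 t ht
      have hp : pre (fun i => σ2 (x (s + i))) t = pre (fun i => σ (x (s + i))) t := by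
        rw [← hσ1.pre_eq ht.le]
        exact pre_congr fun i hi => e2 _ (hxy _ (by omega))
      rw [e, e5 _ (hxy _ (by omega)), f1 t ht, r2.reg t ht, r2.out _ hyx, y2, y5,
        e2 _ (hxy _ (by omega)), hσ1.reg t ht, hp, pre_add, ← Bool.and_assoc]
      change _ = xor _ (cond σ && _)
      rw [hc]
      generalize σ (x _) = p
      generalize σ (y 0) = q
      generalize pre _ t = u
      revert p q u; decide
    · rw [g2 w hw]
      by_cases hy : w = y 0
      · rw [hy, y5]
      · rw [e5 w hy, f2 w hw, r2.out w hw, e2 w hy, hσ1.out w hw]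
  · have r0 := hb.run_run_reverse σ
    set σ1 := run (negIncBlocks b R s x y).reverse σ
    have c1 : cond σ1 = false := by
      rw [← Bool.not_eq_true]
      -- The inverse circuit cannot make the condition true: from such a state `negIncBlocks` would
      -- be a genuine negated increment, which preserves the condition and leads back to `σ`.
      intro hc1
      have := run_negIncBlocks hI (low _ hc1)
      rw [r0] at this
      exact hc (by rw [← hc1]; exact cond_congr _ _ fun w hw _ => this.out w hw)
    rw [Bool.not_eq_true] at hc
    rw [hP σ1, c1, Bool.xor_false, Function.update_eq_self, r0]
    obtain ⟨f1, f2⟩ := fanspec σ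
    set σ2 := run (fan (y 0) (R * b) fun t => x (s + t)) σ
    have c2 : cond σ2 = false := by rw [← hc]; exact cond_congr _ _ fun w hw _ => f2 w hw
    rw [hP σ2, c2, Bool.xor_false, Function.update_eq_self]
    obtain ⟨g1, g2⟩ := fanspec σ2
    refine ⟨fun t ht => ?_, fun w hw => ?_⟩
    · have e := g1 t ht
      rw [e, f1 t ht, f2 _ hyx, Bool.xor_assoc, Bool.xor_self, pre_add, ← Bool.and_assoc]
      change _ = xor _ (cond σ && _)
      rw [hc, Bool.false_and]
    · rw [g2 w hw, f2 w hw]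

end IncHigh

/-! ### Controlled increment of a whole register -/

/-- The wires of an increment of the register `x` of length `m` with control `f` are distinct, and
there are `Y` further wires `y` to borrow. -/
structure CtrlReg (m Y f : ℕ) (x y : ℕ → ℕ) : Prop where
  x_inj : ∀ i < m, ∀ j < m, x i = x j → i = j
  y_inj : ∀ i < Y, ∀ j < Y, y i = y j → i = j
  xy : ∀ i < m, ∀ j < Y, x i ≠ y j
  fx : ∀ i < m, f ≠ x i
  fy : ∀ i < Y, f ≠ y i

theorem CtrlReg.mono {m m' Y f : ℕ} {x y : ℕ → ℕ} (h : CtrlReg m Y f x y) (hm : m' ≤ m) :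
    CtrlReg m' Y f x y where
  x_inj := fun i hi j hj => h.x_inj i (by omega) j (by omega)
  y_inj := h.y_inj
  xy := fun i hi => h.xy i (by omega)
  fx := fun i hi => h.fx i (by omega)
  fy := h.fy

/-- The wires of an increment. -/
def ctrlWires (m Y f : ℕ) (x y : ℕ → ℕ) : Set ℕ :=
  {w | w = f ∨ (∃ i < m, w = x i) ∨ ∃ i < Y, w = y i}

theorem ctrlWires_mono {m m' Y f : ℕ} {x y : ℕ → ℕ} (hm : m' ≤ m) :
    ctrlWires m' Y f x y ⊆ ctrlWires m Y f x y := by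
  rintro w (h | ⟨i, hi, h⟩ | h)
  · exact Or.inl h
  · exact Or.inr (Or.inl ⟨i, by omega, h⟩)
  · exact Or.inr (Or.inr h)

/-- Increments the register `x` if `f` is set, with quadratic depth. -/
def slowInc (f : ℕ) (x y : ℕ → ℕ) : ℕ → NCircuit
  | 0 => []
  | m + 1 => bar (f :: (List.range m).map x) y (x m) ++ slowInc f x y m

section SlowInc

variable {m Y f : ℕ} {x y : ℕ → ℕ}

theorem slowInc_chainReg (h : CtrlReg (m + 1) Y f x y) (hm : m ≤ Y) :
    ChainReg (f :: (List.range m).map x) y (x m) where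
  target := by
    simp only [List.mem_cons, List.mem_map, List.mem_range, not_or, not_exists, not_and]
    refine ⟨(h.fx m (by omega)).symm, fun i hi e => ?_⟩
    have := h.x_inj _ (by omega) _ (by omega) e; omega
  target_ne := fun i hi e => h.xy m (by omega) i (by simp at hi; omega) e.symm
  notMem := fun i hi => by
    simp only [List.mem_cons, List.mem_map, List.mem_range, not_or, not_exists, not_and]
    simp at hi
    exact ⟨(h.fy i (by omega)).symm, fun j hj => h.xy j (by omega) i (by omega)⟩
  inj := fun i hi j hj e => h.y_inj i (by simp at hi; omega) j (by simp at hj; omega) e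

theorem slowInc_bd (h : CtrlReg m Y f x y) (hm : m ≤ Y + 1) :
    Bd (ctrlWires m Y f x y) (slowInc f x y m) (m * (4 * m + 1)) (m * (4 * m + 1)) := by
  induction m with
  | zero => exact Bd.nil'
  | succ m ih =>
    have h1 := (bar_bd (slowInc_chainReg h (Nat.le_of_succ_le_succ hm))).mono (T := ctrlWires (m + 1) Y f x y) (by
      rintro w (rfl | hw | ⟨i, hi, rfl⟩)
      · exact Or.inr (Or.inl ⟨m, by omega, rfl⟩)
      · simp only [List.mem_cons, List.mem_map, List.mem_range] at hw
        rcases hw with rfl | ⟨i, hi, rfl⟩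
        · exact Or.inl rfl
        · exact Or.inr (Or.inl ⟨i, by omega, rfl⟩)
      · exact Or.inr (Or.inr ⟨i, by simp at hi; omega, rfl⟩)) le_rfl le_rfl
    have h2 := (ih (h.mono (by omega)) (by omega)).mono (ctrlWires_mono (Nat.le_succ m)) le_rfl le_rfl
    refine (h1.seq h2).weaken ?_ ?_ <;> simp <;> nlinarith

/-- The bits are treated from the top down, so each conjunction still sees the original lower bits.
-/
theorem run_slowInc (h : CtrlReg m Y f x y) (hm : m ≤ Y + 1) (σ : ℕ → Bool) :
    (∀ j < m, run (slowInc f x y m) σ (x j) = xor (σ (x j)) (σ f && pre (fun i => σ (x i)) j)) ∧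
      ∀ w, (∀ j < m, w ≠ x j) → run (slowInc f x y m) σ w = σ w := by
  induction m generalizing σ with
  | zero => simp [slowInc]
  | succ m ih =>
    have hb := run_bar (slowInc_chainReg h (Nat.le_of_succ_le_succ hm)) σ
    rw [List.all_cons, pre_eq_all] at hb
    rw [slowInc, run_append, hb]
    set τ := Function.update σ (x m) (xor (σ (x m)) (σ f && pre (fun i => σ (x i)) m)) with hτ
    have hτ' : ∀ w, w ≠ x m → τ w = σ w := fun w hw => Function.update_of_ne hw _ _
    obtain ⟨i1, i2⟩ := ih (h.mono (by omega)) (by omega) τ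
    have hx : ∀ i < m, x i ≠ x m := fun i hi e => by
      have := h.x_inj _ (by omega) _ (by omega) e; omega
    refine ⟨fun j hj => ?_, fun w hw => ?_⟩
    · rcases Nat.lt_succ_iff_lt_or_eq.1 hj with hj' | rfl
      · rw [i1 j hj', hτ' _ (hx j hj'), hτ' f (h.fx m (by omega)),
          pre_congr fun i hi => hτ' _ (hx i (by omega))]
      · rw [i2 _ fun i hi => (hx i hi).symm, hτ, Function.update_self]
    · rw [i2 w fun j hj => hw j (by omega), hτ' w (hw m (by omega))]

end SlowInc

/-- The block length in an increment of length `m`. -/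
def incLen (m : ℕ) : ℕ := Nat.sqrt m + 1

/-- The number of blocks in an increment of length `m`. -/
def incCount (m : ℕ) : ℕ := (m - 7 * incLen m) / incLen m

/-- The length of the part below the blocks in an increment of length `m`. -/
def incLow (m : ℕ) : ℕ := m - incCount m * incLen m

/-- Blocks are slightly longer than √m and fewer than their length. The low part of seven to eight
block lengths then contains the `3 * R + 1` wires for the flags and the `3 * b` wires for the pools,
and has less than half the length of the register. -/
theorem incLow_spec {m : ℕ} (hm : 400 ≤ m) :
    incLow m + incCount m * incLen m = m ∧ 7 * incLen m ≤ incLow m ∧ incLow m < 8 * incLen m ∧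
      incCount m + 7 ≤ incLen m ∧ 16 * incLen m + 4 ≤ m ∧ 21 ≤ incLen m := by
  have h1 : 20 ≤ Nat.sqrt m := Nat.le_sqrt.2 (by omega)
  have h2 : Nat.sqrt m * Nat.sqrt m ≤ m := Nat.sqrt_le m
  have h3 : m < (Nat.sqrt m + 1) * (Nat.sqrt m + 1) := Nat.lt_succ_sqrt m
  unfold incLow incCount incLen
  generalize Nat.sqrt m = q at *
  have h4 : 20 * q ≤ q * q := Nat.mul_le_mul_right q h1
  have h5 := Nat.div_add_mod' (m - 7 * (q + 1)) (q + 1)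
  have h6 := Nat.mod_lt (m - 7 * (q + 1)) (show q + 1 > 0 by omega)
  generalize (m - 7 * (q + 1)) / (q + 1) = R at *
  have h7 : R + 7 ≤ q + 1 := by
    by_contra hcon
    have : (q + 1) * (q + 1) ≤ (R + 7) * (q + 1) := Nat.mul_le_mul_right _ (by omega)
    rw [Nat.add_mul R 7] at this
    omega
  refine ⟨by omega, by omega, by omega, by omega, by omega, by omega⟩

/-- Increments the register `x` of length `m` if `f` is set; the wires `y` are borrowed. -/
def inc (f : ℕ) (x y : ℕ → ℕ) (m : ℕ) : NCircuit :=
  if h : m < 1029 then slowInc f x y m else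
    have : incLow m < m := by
      have := incLow_spec (m := m) (by omega); omega
    incHigh (incLen m) (incCount m) (incLow m) f x y ++ inc f x y (incLow m)
termination_by m

section Inc

variable {m Y f : ℕ} {x y : ℕ → ℕ}

/-- The blocks of one class need about a quarter of the register in borrowed wires, and the
conjunction of the low part needs fewer than half. Both alternatives in `hY` pass to a shorter
register; below the threshold 1029 the second implies the first, as `slowInc` requires. -/
theorem CtrlReg.incHighReg (h : CtrlReg m Y f x y) (hY : m ≤ Y + 1 ∨ m / 2 + 513 ≤ Y) (hm : ¬ m < 1029) :
    IncHighReg (incLen m) (incCount m) (incLow m) Y f x y := by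
  obtain ⟨h1, h2, h3, h4, h5, h6⟩ := incLow_spec (m := m) (by omega)
  have h7 : (incCount m / 4 + 1) * incLen m ≤ incCount m * incLen m / 4 + incLen m := by
    rw [Nat.add_mul, one_mul]
    gcongr
    rw [Nat.le_div_iff_mul_le (by omega), mul_right_comm]
    exact Nat.mul_le_mul_right _ (Nat.div_mul_le_self _ _)
  generalize incCount m = R at *
  generalize incLen m = b at *
  generalize incLow m = s at *
  constructor
  · constructor
    · omega
    · omega
    · omega
    · rw [h1]; exact h.x_inj
    · exact h.y_inj
    · rw [h1]; exact h.xy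
  · omega
  · rw [h1]; exact h.fx
  · exact h.fy

theorem clog_incLow (hm : 400 ≤ m) : Nat.clog 2 (incLow m) ≤ Nat.clog 2 m / 2 + 5 := by
  obtain ⟨-, -, h3, -, -, h6⟩ := incLow_spec hm
  have h1 : m ≤ 2 ^ Nat.clog 2 m := Nat.le_pow_clog one_lt_two m
  have h2 : Nat.sqrt m < 2 ^ (Nat.clog 2 m / 2 + 1) := by
    rw [Nat.sqrt_lt', ← pow_mul]
    refine lt_of_le_of_lt h1 (Nat.pow_lt_pow_right one_lt_two (by omega))
  refine Nat.clog_le_of_le_pow ?_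
  rw [show Nat.clog 2 m / 2 + 5 = Nat.clog 2 m / 2 + 1 + 1 + 3 by ring, pow_add _ _ 3, pow_succ]
  unfold incLen at *
  omega

/-- One level costs O(log m) depth and O(m) gates. The recursion goes to a length with about half
the logarithm and less than half the size, so both costs sum geometrically; the additive constant
covers the quadratic base case. -/
theorem inc_bd (h : CtrlReg m Y f x y) (hY : m ≤ Y + 1 ∨ m / 2 + 513 ≤ Y) :
    Bd (ctrlWires m Y f x y) (inc f x y m) (20000 * Nat.clog 2 m + 4400000) (5000 * m) := by
  induction m using Nat.strong_induction_on with
  | _ m ih =>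
    rw [inc]
    split_ifs with hm
    · have : m * (4 * m + 1) ≤ m * 4200 := Nat.mul_le_mul_left _ (by omega)
      exact (slowInc_bd h (by omega)).weaken (by omega) (by omega)
    · have hm' : 400 ≤ m := by omega
      obtain ⟨h1, h2, h3, h4, h5, h6⟩ := incLow_spec hm'
      have hc := clog_incLow hm'
      have hh := (h.incHighReg hY hm)
      have hi := (ih (incLow m) (by omega) (h.mono (by omega)) (by omega)).mono
        (ctrlWires_mono (show incLow m ≤ m by omega)) le_rfl le_rfl
      have hb := (incHigh_bd hh).mono (T := ctrlWires m Y f x y) (by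
        rintro w (hw | hw | hw)
        · exact Or.inl hw
        · rw [h1] at hw; exact Or.inr (Or.inl hw)
        · exact Or.inr (Or.inr hw)) le_rfl le_rfl
      have c1 : Nat.clog 2 (m + 1) ≤ Nat.clog 2 m + 1 := by
        refine Nat.clog_le_of_le_pow ?_
        have := Nat.le_pow_clog one_lt_two m
        rw [pow_succ]; omega
      -- From 11 on, the shift by 5 in `clog_incLow` leaves a definite decrease of the logarithm,
      -- which pays for the level.
      have c2 : 11 ≤ Nat.clog 2 m := by
        by_contra hcon
        have h7 := (Nat.le_pow_clog one_lt_two m).trans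
          (Nat.pow_le_pow_right two_pos (show Nat.clog 2 m ≤ 10 by omega))
        rw [show 2 ^ 10 = 1024 from rfl] at h7
        omega
      rw [h1] at hb
      refine (hb.seq hi).weaken ?_ ?_
      · have : Nat.clog 2 m + 12 * Nat.clog 2 (incLow m) ≤ 12 * Nat.clog 2 m := by omega
        linarith
      · linarith [Nat.mul_le_mul_left 5000 (show 2 * incLow m ≤ m by omega)]

/-- The upper part is updated first, while the low part still has its original value. -/
theorem run_inc (h : CtrlReg m Y f x y) (hY : m ≤ Y + 1 ∨ m / 2 + 513 ≤ Y) (σ : ℕ → Bool) :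
    (∀ j < m, run (inc f x y m) σ (x j) = xor (σ (x j)) (σ f && pre (fun i => σ (x i)) j)) ∧
      ∀ w, (∀ j < m, w ≠ x j) → run (inc f x y m) σ w = σ w := by
  induction m using Nat.strong_induction_on generalizing σ with
  | _ m ih =>
    rw [inc]
    split_ifs with hm
    · exact run_slowInc h (by omega) σ
    · obtain ⟨h1, h2, h3, h4, h5, h6⟩ := incLow_spec (m := m) (by omega)
      obtain ⟨a1, a2⟩ := run_incHigh (h.incHighReg hY hm) σ
      rw [run_append]
      set τ := run (incHigh (incLen m) (incCount m) (incLow m) f x y) σ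
      obtain ⟨i1, i2⟩ := ih (incLow m) (by omega) (h.mono (by omega)) (by omega) τ
      have low : ∀ i < incLow m, τ (x i) = σ (x i) := by
        intro i hi
        refine a2 _ fun t ht e => ?_
        have := h.x_inj _ (by omega) _ (by omega) e; omega
      refine ⟨fun j hj => ?_, fun w hw => ?_⟩
      · rcases Nat.lt_or_ge j (incLow m) with hj' | hj'
        · rw [i1 j hj', low j hj', a2 f fun t ht => h.fx _ (by omega),
            pre_congr fun i hi => low i (by omega)]
        · have := a1 (j - incLow m) (by omega)
          rw [show incLow m + (j - incLow m) = j by omega] at this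
          rw [i2, this]
          intro i hi e
          have := h.x_inj _ (by omega) _ (by omega) e; omega
      · rw [i2 w fun j hj => hw j (by omega), a2 w fun t ht => hw _ (by omega)]

end Inc

/-! ### The carry as a parity -/

theorem xorN_succ' (v : ℕ → Bool) (n : ℕ) : xorN v (n + 1) = xor (v 0) (xorN (fun i => v (i + 1)) n) := by
  induction n with
  | zero => simp [xorN]
  | succ n ih => rw [xorN, ih, xorN, Bool.xor_assoc]

theorem xorN_and (a : Bool) (v : ℕ → Bool) (n : ℕ) :
    xorN (fun i => a && v i) n = (a && xorN v n) := by
  induction n with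
  | zero => simp [xorN]
  | succ n ih => rw [xorN, xorN, ih, Bool.and_xor_distrib_left]

theorem pre_succ' (v : ℕ → Bool) (n : ℕ) : pre v (n + 1) = (v 0 && pre (fun i => v (i + 1)) n) := by
  rw [add_comm, pre_add]
  simp [pre, add_comm]

/-- An enumeration of `{j < n | a j}`. -/
theorem exists_enum (a : ℕ → Bool) (n : ℕ) : ∃ (k : ℕ) (u : ℕ → ℕ), k ≤ n ∧ (∀ i < k, u i < n) ∧
    (∀ i < k, ∀ j < k, u i = u j → i = j) ∧
      ∀ v : ℕ → Bool, xorN (fun i => v (u i)) k = xorN (fun j => a j && v j) n := by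
  induction n with
  | zero => exact ⟨0, id, by simp [xorN]⟩
  | succ n ih =>
    obtain ⟨k, u, h1, h2, h3, h4⟩ := ih
    by_cases ha : a n = true
    · refine ⟨k + 1, Function.update u k n, by omega, fun i hi => ?_, fun i hi j hj e => ?_,
        fun v => ?_⟩
      · rcases Nat.lt_succ_iff_lt_or_eq.1 hi with hi' | rfl
        · rw [Function.update_of_ne (by omega)]; have := h2 i hi'; omega
        · simp
      · rcases Nat.lt_succ_iff_lt_or_eq.1 hi with hi' | rfl <;>
          rcases Nat.lt_succ_iff_lt_or_eq.1 hj with hj' | rfl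
        · rw [Function.update_of_ne (by omega), Function.update_of_ne (by omega)] at e
          exact h3 i hi' j hj' e
        · rw [Function.update_of_ne (by omega), Function.update_self] at e
          have := h2 i hi'; omega
        · rw [Function.update_self, Function.update_of_ne (by omega)] at e
          have := h2 j hj'; omega
        · rfl
      · rw [xorN, xorN, Function.update_self, ha, Bool.true_and, ← h4]
        congr 1
        exact xorN_congr fun i hi => by rw [Function.update_of_ne (by omega)]
    · refine ⟨k, u, by omega, fun i hi => by have := h2 i hi; omega, h3, fun v => ?_⟩
      rw [xorN, h4]
      simp [ha]

/-- The number of elements of `{j < n | a j}`. -/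
noncomputable def enumCard (a : ℕ → Bool) (n : ℕ) : ℕ := (exists_enum a n).choose

/-- The elements of `{j < n | a j}`. -/
noncomputable def enum (a : ℕ → Bool) (n : ℕ) : ℕ → ℕ := (exists_enum a n).choose_spec.choose

theorem enum_spec (a : ℕ → Bool) (n : ℕ) : enumCard a n ≤ n ∧ (∀ i < enumCard a n, enum a n i < n) ∧
    (∀ i < enumCard a n, ∀ j < enumCard a n, enum a n i = enum a n j → i = j) ∧
      ∀ v : ℕ → Bool, xorN (fun i => v (enum a n i)) (enumCard a n) = xorN (fun j => a j && v j) n :=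
  (exists_enum a n).choose_spec.choose_spec

/-- The carry into position `i` when the constant `c` is added to the bits of `σ` from
position `p` on. -/
def carry (c : ℕ → Bool) (p : ℕ) (σ : ℕ → Bool) : ℕ → Bool
  | 0 => false
  | i + 1 => Bool.atLeastTwo (σ (p + i)) (c (p + i)) (carry c p σ i)

theorem carry_congr {c σ τ : ℕ → Bool} {p i : ℕ} (h : ∀ j < i, σ (p + j) = τ (p + j)) :
    carry c p σ i = carry c p τ i := by
  induction i with
  | zero => rfl
  | succ i ih => rw [carry, carry, ih fun j hj => h j (by omega), h i (by omega)]

/-- Whether the `i`-th position from the top of a register of length `l` passes on a carry. -/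
def propagate (c : ℕ → Bool) (p : ℕ) (σ : ℕ → Bool) (l i : ℕ) : Bool :=
  xor (σ (p + (l - 1 - i))) (c (p + (l - 1 - i)))

theorem pre_propagate (c : ℕ → Bool) (p : ℕ) (σ : ℕ → Bool) (l j : ℕ) :
    pre (propagate c p σ (l + 1)) (j + 1) =
      (xor (σ (p + l)) (c (p + l)) && pre (propagate c p σ l) j) := by
  rw [pre_succ']
  congr 1
  refine pre_congr fun i _ => ?_
  rw [propagate, show l + 1 - 1 - (i + 1) = l - 1 - i by omega, ← propagate]

/-- The carry is the constant bit at the highest position that does not pass on a carry. -/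
theorem carry_eq_xorN (c σ : ℕ → Bool) (p l : ℕ) :
    carry c p σ l = xorN (fun j => c (p + (l - 1 - j)) &&
      xor (pre (propagate c p σ l) j) (pre (propagate c p σ l) (j + 1))) l := by
  induction l with
  | zero => rfl
  | succ l ih =>
    -- The induction adds a position at the top, which comes first in the reading order. Its own
    -- term is the carry generated there, and its propagate bit multiplies all other terms.
    have e : ∀ i, l + 1 - 1 - (i + 1) = l - 1 - i := fun i => by omega
    rw [xorN_succ', carry, ih]
    simp only [pre_propagate, e, ← Bool.and_xor_distrib_left, Bool.and_left_comm (c _), xorN_and]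
    simp only [pre, Bool.and_true, Nat.add_sub_cancel, Nat.sub_zero]
    generalize xorN _ l = k
    generalize σ (p + l) = a
    generalize c (p + l) = b
    revert k a b; decide

/-! ### Computing the carry with borrowed wires -/

/-- The wires of the register from position `p + l - 1` down to `p`, and then those from `p + l`. -/
def down (p l j : ℕ) : ℕ := if j < l then p + (l - 1 - j) else p + j

theorem down_inj {p l i j : ℕ} (h : down p l i = down p l j) : i = j := by
  unfold down at h; split_ifs at h <;> omega

/-- Flips the wires of the register where `c` is set. -/
def flipConst (c : ℕ → Bool) (p l : ℕ) : NCircuit :=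
  parN l fun i => if c (p + i) then [⟨[], p + i⟩] else []

section Carry

variable (c : ℕ → Bool) (p l : ℕ)

theorem flipConst_single_bd (i : ℕ) :
    Bd {p + i} (if c (p + i) then [⟨[], p + i⟩] else []) 1 1 := by
  split_ifs
  · exact Bd.gate (by simp) (by simp) (by simp) (by simp)
  · exact Bd.nil'

theorem flipConst_bd : Bd {w | p ≤ w ∧ w < p + l} (flipConst c p l) 1 l := by
  refine (Bd.parN (fun i hi => flipConst_single_bd c p i) ?_ ?_).weaken le_rfl (by simp)
  · intro i hi j hj hij w hw hw'
    simp only [Set.mem_singleton_iff] at hw hw'; omega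
  · rintro i hi w rfl; exact ⟨by omega, by omega⟩

theorem run_flipConst (σ : ℕ → Bool) {i : ℕ} (hi : i < l) :
    run (flipConst c p l) σ (p + i) = xor (σ (p + i)) (c (p + i)) := by
  rw [flipConst, run_parN (fun i hi => flipConst_single_bd c p i) _ σ hi (Set.mem_singleton _)]
  · split_ifs with h <;> simp [h, run_single]
  · intro i hi j hj hij w hw hw'
    simp only [Set.mem_singleton_iff] at hw hw'; omega

/-- The constant read from position `p + l - 1` down. -/
def downConst (j : ℕ) : Bool := c (p + (l - 1 - j))

/-- Adds the carry to `g`, with quadratic depth, on the flipped register. -/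
def slowCarry (g : ℕ) : ℕ → NCircuit
  | 0 => []
  | j + 1 => slowCarry g j ++ if downConst c p l j then
      bar ((List.range j).map (down p l)) (fun i => p + l + i) g ++
        bar ((List.range (j + 1)).map (down p l)) (fun i => p + l + i) g else []

/-- Adds to `g` the bits of the register where the constant is set, and those one below. -/
noncomputable def constParity (g : ℕ) : NCircuit :=
  parity g (enumCard (downConst c p l) l) (fun i => down p l (enum (downConst c p l) l i)) ++
    parity g (enumCard (downConst c p l) l) (fun i => down p l (enum (downConst c p l) l i + 1))

/-- Increments the register read from the top. -/
def incDown : NCircuit :=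
  (inc (p + l + 1) (down p l) (fun i => p + l + 2 + i) (l + 1) ++ [⟨[], p + l + 1⟩]) ++
    (inc (p + l + 1) (down p l) (fun i => p + l + 2 + i) (l + 1) ++ [⟨[], p + l + 1⟩])

/-- Adds the carry out of the register of length `l` at `p` to `g`; the wires from `p + l` on are
borrowed. -/
noncomputable def addCarry (g : ℕ) : NCircuit :=
  flipConst c p l ++
    (if l < 1100 then slowCarry c p l g l else
      constParity c p l g ++ (incDown p l ++ constParity c p l g ++ (incDown p l).reverse)) ++
    (flipConst c p l).reverse

variable {c p l} {n g : ℕ} (hn : 2 * l ≤ n) (hg : g < p ∨ p + n ≤ g)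

include hn hg

omit hn hg in
theorem down_twoReg {j : ℕ} (hj : j ≤ l) : TwoReg j (down p l) (fun i => p + l + i) where
  v_inj := fun i _ j _ h => down_inj h
  d_inj := fun i _ j _ h => by omega
  vd := fun i hi j hj => by unfold down; split_ifs <;> omega

omit hg in
theorem down_mem {j : ℕ} (hj : j < n) : p ≤ down p l j ∧ down p l j < p + n := by
  unfold down; split_ifs <;> omega

theorem down_chainReg {j : ℕ} (hj : j ≤ l) :
    ChainReg ((List.range j).map (down p l)) (fun i => p + l + i) g :=
  (down_twoReg hj).chainReg
    (fun i hi => by have := down_mem (p := p) hn (j := i) (by omega); omega) (fun i hi => by omega)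

theorem down_bar_bd {j : ℕ} (hj : j ≤ l) : Bd {w | w = g ∨ p ≤ w ∧ w < p + n}
    (bar ((List.range j).map (down p l)) (fun i => p + l + i) g) (4 * j + 1) (4 * j + 1) := by
  refine (bar_bd (down_chainReg hn hg hj)).mono ?_ (by simp) (by simp)
  rintro w (rfl | hw | ⟨i, hi, rfl⟩)
  · exact Or.inl rfl
  · simp only [List.mem_map, List.mem_range] at hw
    obtain ⟨i, hi, rfl⟩ := hw
    exact Or.inr (down_mem hn (by omega))
  · simp only [List.length_map, List.length_range] at hi
    refine Or.inr ⟨?_, ?_⟩ <;> simp only <;> omega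

theorem slowCarry_bd {j : ℕ} (hj : j ≤ l) : Bd {w | w = g ∨ p ≤ w ∧ w < p + n}
    (slowCarry c p l g j) (j * (8 * l + 6)) (j * (8 * l + 6)) := by
  induction j with
  | zero => exact Bd.nil'
  | succ j ih =>
    refine Bd.weaken (d := j * (8 * l + 6) + (8 * l + 6)) (k := j * (8 * l + 6) + (8 * l + 6))
      ((ih (by omega)).seq ?_) (Nat.succ_mul _ _).ge (Nat.succ_mul _ _).ge
    split_ifs
    · exact ((down_bar_bd hn hg (by omega)).seq (down_bar_bd hn hg hj)).weaken (by omega) (by omega)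
    · exact Bd.nil'

theorem run_slowCarry {j : ℕ} (hj : j ≤ l) (σ : ℕ → Bool) :
    run (slowCarry c p l g j) σ = Function.update σ g (xor (σ g) (xorN (fun j => downConst c p l j &&
      xor (pre (fun i => σ (down p l i)) j) (pre (fun i => σ (down p l i)) (j + 1))) j)) := by
  induction j with
  | zero => simp [slowCarry, xorN]
  | succ j ih =>
    rw [slowCarry, run_append, ih (by omega), xorN]
    have hd : ∀ i < n, down p l i ≠ g := fun i hi e => by
      have := down_mem (p := p) hn hi; omega
    split_ifs with ha
    · rw [run_append, run_bar (down_chainReg hn hg (j := j) (by omega)),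
        run_bar (down_chainReg hn hg hj)]
      simp only [pre_eq_all, Function.update_idem, Function.update_self, ha, Bool.true_and]
      have hpre : ∀ b, ∀ k ≤ l, pre (fun i => Function.update σ g b (down p l i)) k =
          pre (fun i => σ (down p l i)) k := fun b k hk =>
        pre_congr fun i hi => Function.update_of_ne (hd i (by omega)) _ _
      rw [hpre _ _ (by omega), hpre _ _ hj]
      simp only [Bool.xor_assoc]
    · simp [ha]

theorem constParity_bd : Bd {w | w = g ∨ p ≤ w ∧ w < p + n} (constParity c p l g)
    (4 * Nat.clog 2 n + 2) (4 * n) := by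
  obtain ⟨h1, h2, h3, -⟩ := enum_spec (downConst c p l) l
  have hc : Nat.clog 2 (enumCard (downConst c p l) l) ≤ Nat.clog 2 n :=
    Nat.clog_mono_right 2 (by omega)
  rcases Nat.eq_zero_or_pos l with rfl | hl
  · have : enumCard (downConst c p 0) 0 = 0 := by omega
    have e : constParity c p 0 g = [] := by rw [constParity, this, parity, if_pos rfl, parity, if_pos rfl]; rfl
    rw [e]; exact Bd.nil'
  refine ((parity_bd (Or.inl rfl) (fun i hi => Or.inr (down_mem hn ?_)) (fun i hi e => ?_)
    (fun i hi j hj e => h3 i hi j hj (down_inj e))).seq (parity_bd (Or.inl rfl)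
    (fun i hi => Or.inr (down_mem hn ?_)) (fun i hi e => ?_) (fun i hi j hj e => h3 i hi j hj
      (by have := down_inj e; omega)))).weaken (by omega) (by omega)
  · have := h2 i hi; omega
  · have := h2 i hi; have := down_mem (p := p) hn (j := enum (downConst c p l) l i) (by omega); omega
  · have := h2 i hi; omega
  · have := h2 i hi; have := down_mem (p := p) hn (j := enum (downConst c p l) l i + 1) (by omega); omega

/-- The two parities combine to sums of neighbouring bits. At `j = l - 1` the neighbour is the wire
`p + l` just above the register, which is why `incDown` has length `l + 1`. -/
theorem run_constParity (σ : ℕ → Bool) : run (constParity c p l g) σ =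
    Function.update σ g (xor (σ g) (xorN (fun j => downConst c p l j &&
      xor (σ (down p l j)) (σ (down p l (j + 1)))) l)) := by
  obtain ⟨h1, h2, h3, h4⟩ := enum_spec (downConst c p l) l
  have hd : ∀ i < n, g ≠ down p l i := fun i hi e => by
    have := down_mem (p := p) hn hi; omega
  rw [constParity, run_append, run_parity, run_parity]
  · rw [Function.update_idem, Function.update_self, Bool.xor_assoc]
    congr 2
    rw [h4 fun j => σ (down p l j)]
    have : xorN (fun i => Function.update σ g (xor (σ g) (xorN (fun j => downConst c p l j &&
        σ (down p l j)) l)) (down p l (enum (downConst c p l) l i + 1))) (enumCard (downConst c p l) l)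
        = xorN (fun j => downConst c p l j && σ (down p l (j + 1))) l := by
      rw [← h4 fun j => σ (down p l (j + 1))]
      refine xorN_congr fun i hi => Function.update_of_ne (hd _ ?_).symm _ _
      have := h2 i hi; omega
    rw [this, ← xorN_xor]
    exact xorN_congr fun j _ => (Bool.and_xor_distrib_left _ _ _).symm
  · intro i hi; have := h2 i hi; exact hd _ (by omega)
  · intro i hi j hj e; have := down_inj e; exact h3 i hi j hj (by omega)
  · intro i hi; have := h2 i hi; exact hd _ (by omega)
  · intro i hi j hj e; have := down_inj e; exact h3 i hi j hj (by omega)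

omit hn hg in
-- With `2 * l ≤ n` the borrowed wires are slightly fewer than the register has bits. This is why
-- `inc` also accepts the alternative `m / 2 + 513 ≤ Y` and why small `l` is treated separately.
theorem incDown_reg :
    CtrlReg (l + 1) (n - l - 2) (p + l + 1) (down p l) (fun i => p + l + 2 + i) where
  x_inj := fun i _ j _ h => down_inj h
  y_inj := fun i _ j _ h => by omega
  xy := fun i hi j hj => by unfold down; split_ifs <;> omega
  fx := fun i hi => by unfold down; split_ifs <;> omega
  fy := fun i hi => by omega

omit hg in
theorem incDown_bd (hl : ¬ l < 1100) : Bd {w | p ≤ w ∧ w < p + n} (incDown p l)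
    (40000 * Nat.clog 2 n + 8800002) (10000 * n) := by
  have hI := (inc_bd (incDown_reg (p := p) (l := l) (n := n)) (Or.inr (by omega))).mono (T := {w | p ≤ w ∧ w < p + n}) (by
    rintro w (rfl | ⟨i, hi, rfl⟩ | ⟨i, hi, rfl⟩)
    · exact ⟨by omega, by omega⟩
    · exact down_mem hn (by omega)
    · refine ⟨?_, ?_⟩ <;> simp only <;> omega) le_rfl le_rfl
  have hX : Bd {w | p ≤ w ∧ w < p + n} [⟨[], p + l + 1⟩] 1 1 :=
    Bd.gate (by simp) (by simp) ⟨by omega, by omega⟩ (by simp)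
  have hc : Nat.clog 2 (l + 1) ≤ Nat.clog 2 n := Nat.clog_mono_right 2 (by omega)
  refine ((hI.seq hX).seq (hI.seq hX)).weaken ?_ ?_
  · linarith
  · linarith

omit hg in
-- The control is a borrowed wire negated after each of the two controlled increments, so exactly
-- one of them takes effect, whichever value the wire had.
theorem run_incDown (hl : ¬ l < 1100) (σ : ℕ → Bool) :
    (∀ j < l + 1, run (incDown p l) σ (down p l j) =
      xor (σ (down p l j)) (pre (fun i => σ (down p l i)) j)) ∧
    ∀ w, (∀ j < l + 1, w ≠ down p l j) → run (incDown p l) σ w = σ w := by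
  have hr := incDown_reg (p := p) (l := l) (n := n)
  have hY : l + 1 ≤ n - l - 2 + 1 ∨ (l + 1) / 2 + 513 ≤ n - l - 2 := Or.inr (by omega)
  have hfd : ∀ j < l + 1, down p l j ≠ p + l + 1 := fun j hj => (hr.fx j hj).symm
  have incX : ∀ σ : ℕ → Bool, ∃ τ, run (inc (p + l + 1) (down p l) (fun i => p + l + 2 + i) (l + 1) ++
      [⟨[], p + l + 1⟩]) σ = τ ∧ τ (p + l + 1) = !σ (p + l + 1) ∧
      (∀ j < l + 1, τ (down p l j) = xor (σ (down p l j))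
        (σ (p + l + 1) && pre (fun i => σ (down p l i)) j)) ∧
      ∀ w, (∀ j < l + 1, w ≠ down p l j) → w ≠ p + l + 1 → τ w = σ w := by
    intro σ
    obtain ⟨a1, a2⟩ := run_inc hr hY σ
    refine ⟨_, rfl, ?_, fun j hj => ?_, fun w hw hw' => ?_⟩
    · rw [run_append, run_single, Function.update_self, a2 _ hr.fx]; simp
    · rw [run_append, run_single, Function.update_of_ne (hfd j hj), a1 j hj]
    · rw [run_append, run_single, Function.update_of_ne hw', a2 w hw]
  rw [incDown, run_append]
  obtain ⟨τ, e1, f1, r1, o1⟩ := incX σ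
  rw [e1]
  obtain ⟨ρ, e2, f2, r2, o2⟩ := incX τ
  rw [e2]
  refine ⟨fun j hj => ?_, fun w hw => ?_⟩
  · rw [r2 j hj, r1 j hj, f1]
    cases hf : σ (p + l + 1)
    · have : ∀ i < j, τ (down p l i) = σ (down p l i) := fun i hi => by
        rw [r1 i (by omega), hf, Bool.false_and, Bool.xor_false]
      rw [pre_congr this]; simp
    · simp
  · by_cases hw' : w = p + l + 1
    · rw [hw', f2, f1, Bool.not_not]
    · rw [o2 w hw hw', o1 w hw hw']

theorem addCarry_bd : Bd {w | w = g ∨ p ≤ w ∧ w < p + n} (addCarry c p l g)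
    (80008 * Nat.clog 2 n + 20000000) (40000 * n) := by
  have hX := (flipConst_bd c p l).mono (T := {w | w = g ∨ p ≤ w ∧ w < p + n})
    (fun w hw => Or.inr ⟨hw.1, by have := hw.2; omega⟩) le_rfl le_rfl
  rw [addCarry]
  split_ifs with hl
  · refine ((hX.seq (slowCarry_bd hn hg le_rfl)).seq hX.reverse).weaken ?_ ?_
    · have : l * (8 * l + 6) ≤ 1100 * (8 * 1100 + 6) := Nat.mul_le_mul (by omega) (by omega)
      linarith
    · have : l * (8 * l + 6) ≤ l * (8 * 1100 + 6) := Nat.mul_le_mul le_rfl (by omega)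
      linarith
  · have hP := constParity_bd (c := c) hn hg
    have hI := (incDown_bd (p := p) hn hl).mono (T := {w | w = g ∨ p ≤ w ∧ w < p + n})
      (fun w hw => Or.inr hw) le_rfl le_rfl
    refine ((hX.seq (hP.seq ((hI.seq hP).seq hI.reverse))).seq hX.reverse).weaken ?_ ?_
    · linarith
    · linarith

/-- The increment from the top flips position `j` by the prefix conjunction of length `j`. Adding
the selected neighbour sums before and after it leaves exactly the terms of `carry_eq_xorN`. All
else is conjugation and restores the register. -/
theorem run_addCarry (σ : ℕ → Bool) : run (addCarry c p l g) σ =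
    Function.update σ g (xor (σ g) (carry c p σ l)) := by
  have hgp : g ∉ {w | p ≤ w ∧ w < p + l} := by rintro ⟨h1, h2⟩; omega
  refine (flipConst_bd c p l).run_conj hgp ?_
  set τ := run (flipConst c p l) σ with hτ
  have τg : τ g = σ g := (flipConst_bd c p l).run_of_notMem hgp
  have τd : ∀ i < l, τ (down p l i) = xor (σ (p + (l - 1 - i))) (c (p + (l - 1 - i))) := by
    intro i hi
    rw [down, if_pos hi, hτ, run_flipConst c p l σ (by omega)]
  have key : xorN (fun j => downConst c p l j &&
      xor (pre (fun i => τ (down p l i)) j) (pre (fun i => τ (down p l i)) (j + 1))) l =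
      carry c p σ l := by
    rw [carry_eq_xorN]
    refine xorN_congr fun j hj => ?_
    rw [pre_congr fun i hi => τd i (by omega), pre_congr fun i hi => τd i (by omega), downConst]
    rfl
  split_ifs with hl
  · rw [run_slowCarry hn hg le_rfl, τg, key]
  · have hI := incDown_bd (p := p) hn hl
    have hgI : g ∉ {w | p ≤ w ∧ w < p + n} := by rintro ⟨h1, h2⟩; omega
    have hd : ∀ i < l + 1, down p l i ≠ g := fun i hi e => by
      have := down_mem (p := p) hn (j := i) (by omega); omega
    rw [run_append, run_constParity hn hg]
    set ρ := Function.update τ g (xor (τ g) (xorN (fun j => downConst c p l j &&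
      xor (τ (down p l j)) (τ (down p l (j + 1)))) l)) with hρ
    have ρu : ∀ b, Function.update ρ g b = Function.update τ g b := fun b => by
      rw [hρ, Function.update_idem]
    have ρg : ρ g = _ := Function.update_self _ _ _
    rw [hI.run_conj hgI (run_constParity hn hg _), hI.run_of_notMem hgI, ρu, ρg, τg, Bool.xor_assoc, ← xorN_xor, ← key]
    obtain ⟨a1, -⟩ := run_incDown (p := p) hn hl ρ
    congr 2
    refine xorN_congr fun j hj => ?_
    rw [a1 j (by omega), a1 (j + 1) (by omega)]
    have e : ∀ i < l + 1, ρ (down p l i) = τ (down p l i) := fun i hi =>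
      Function.update_of_ne (hd i hi) _ _
    rw [e j (by omega), e (j + 1) (by omega), pre_congr fun i hi => e i (by omega),
      pre_congr fun i hi => e i (by omega)]
    rw [← Bool.and_xor_distrib_left]
    congr 1
    generalize τ (down p l j) = a
    generalize τ (down p l (j + 1)) = b
    generalize pre _ j = u
    generalize pre _ (j + 1) = v
    revert a b u v; decide

end Carry

/-! ### Adding the carry of the lower half to the upper half -/

section Step

variable (c : ℕ → Bool) (p n g : ℕ)

/-- Negated increment, controlled by `g`, of the upper half of the register of length `n` at `p`. -/
def negIncUpper : NCircuit :=
  inc g (fun i => p + n / 2 + i) (fun i => p + i) (n - n / 2) ++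
    fan g (n - n / 2) (fun i => p + n / 2 + i)

/-- Adds to the upper half of the register the carry out of the lower half when `c` is added. -/
noncomputable def step : NCircuit :=
  negIncUpper p n g ++ (addCarry c p (n / 2) g ++ (negIncUpper p n g ++
    (fan g (n - n / 2) (fun i => p + n / 2 + i) ++ (addCarry c p (n / 2) g ++
      fan g (n - n / 2) (fun i => p + n / 2 + i)))))

variable {c p n g} (hg : g < p ∨ p + n ≤ g)

include hg

/-- The upper half exceeds the lower by at most one wire, which `inc` tolerates; conversely
`addCarry` on the lower half borrows from the upper one. -/
theorem upper_reg : CtrlReg (n - n / 2) (n / 2) g (fun i => p + n / 2 + i) (fun i => p + i) where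
  x_inj := fun i _ j _ h => by omega
  y_inj := fun i _ j _ h => by omega
  xy := fun i hi j hj => by omega
  fx := fun i hi => by omega
  fy := fun i hi => by omega

theorem upperFan_bd : Bd {w | w = g ∨ p ≤ w ∧ w < p + n}
    (fan g (n - n / 2) (fun i => p + n / 2 + i)) (2 * Nat.clog 2 n + 1) (2 * n) := by
  have hc : Nat.clog 2 (n - n / 2) ≤ Nat.clog 2 n := Nat.clog_mono_right 2 (by omega)
  refine (fan_bd (Or.inl rfl) (fun i hi => Or.inr ⟨?_, ?_⟩) (fun i hi => (upper_reg hg).fx i hi)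
    (upper_reg hg).x_inj).weaken (by omega) (by omega) <;> omega

theorem negIncUpper_bd : Bd {w | w = g ∨ p ≤ w ∧ w < p + n} (negIncUpper p n g)
    (20002 * Nat.clog 2 n + 4400001) (5002 * n) := by
  have hc : Nat.clog 2 (n - n / 2) ≤ Nat.clog 2 n := Nat.clog_mono_right 2 (by omega)
  have hI := (inc_bd (upper_reg hg) (Or.inl (by omega))).mono
    (T := {w | w = g ∨ p ≤ w ∧ w < p + n}) (by
      rintro w (rfl | ⟨i, hi, rfl⟩ | ⟨i, hi, rfl⟩)
      · exact Or.inl rfl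
      · refine Or.inr ⟨?_, ?_⟩ <;> simp only <;> omega
      · refine Or.inr ⟨?_, ?_⟩ <;> simp only <;> omega) le_rfl le_rfl
  refine (hI.seq (upperFan_bd hg)).weaken ?_ ?_
  · linarith
  · have : n - n / 2 ≤ n := Nat.sub_le _ _
    linarith

theorem run_negIncUpper (σ : ℕ → Bool) :
    NegInc (n - n / 2) (fun i => p + n / 2 + i) (σ g) σ (run (negIncUpper p n g) σ) := by
  have hr := upper_reg hg
  obtain ⟨a1, a2⟩ := run_inc hr (Or.inl (by omega)) σ
  rw [negIncUpper, run_append]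
  obtain ⟨b1, b2⟩ := run_fan hr.fx hr.x_inj
    (run (inc g (fun i => p + n / 2 + i) (fun i => p + i) (n - n / 2)) σ)
  refine ⟨fun j hj => ?_, fun w hw => ?_⟩
  · rw [b1 j hj, a1 j hj, a2 g hr.fx]
    generalize σ (p + n / 2 + j) = u
    generalize pre _ j = v
    generalize σ g = q
    revert u v q; decide
  · rw [b2 w hw, a2 w hw]

theorem step_bd : Bd {w | w = g ∨ p ≤ w ∧ w < p + n} (step c p n g)
    (200024 * Nat.clog 2 n + 48800004) (90008 * n) := by
  have hN := negIncUpper_bd hg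
  have hF := upperFan_bd hg
  have hA := addCarry_bd (c := c) (show 2 * (n / 2) ≤ n by omega) hg
  refine (hN.seq (hA.seq (hN.seq (hF.seq (hA.seq hF))))).weaken ?_ ?_
  · linarith
  · linarith

/-- With `k` the carry, the negated increments are controlled by `g` and by `g` plus `k`, which
amounts to one controlled by `k` as their prefix conjunctions agree. The fan-outs add `g` plus `k`
and then `g`, that is `k`, to every bit. -/
theorem run_step (σ : ℕ → Bool) :
    (∀ j < n - n / 2, run (step c p n g) σ (p + n / 2 + j) = xor (σ (p + n / 2 + j))
      (carry c p σ (n / 2) && pre (fun i => σ (p + n / 2 + i)) j)) ∧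
    ∀ w, (∀ j < n - n / 2, w ≠ p + n / 2 + j) → run (step c p n g) σ w = σ w := by
  have hr := upper_reg hg
  have hA := fun τ => run_addCarry (c := c) (show 2 * (n / 2) ≤ n by omega) hg τ
  have hxg : ∀ j < n - n / 2, p + n / 2 + j ≠ g := fun j hj => (hr.fx j hj).symm
  have hlow : ∀ i < n / 2, ∀ j < n - n / 2, p + i ≠ p + n / 2 + j := fun i hi j hj => by omega
  have hlg : ∀ i < n / 2, p + i ≠ g := fun i hi => by omega
  simp only [step, run_append, hA]
  have e1 := run_negIncUpper hg σ
  set σ1 := run (negIncUpper p n g) σ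
  have k1 : carry c p σ1 (n / 2) = carry c p σ (n / 2) :=
    carry_congr fun i hi => e1.out _ (hlow i hi)
  rw [k1, e1.out g hr.fx]
  set k := carry c p σ (n / 2) with hk
  set σ2 := Function.update σ1 g (xor (σ g) k) with hσ2
  have g2 : σ2 g = xor (σ g) k := Function.update_self _ _ _
  have o2 : ∀ w, w ≠ g → σ2 w = σ1 w := fun w hw => Function.update_of_ne hw _ _
  have e3 := run_negIncUpper hg σ2
  set σ3 := run (negIncUpper p n g) σ2
  obtain ⟨f1, f2⟩ := run_fan hr.fx hr.x_inj σ3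
  set σ4 := run (fan g (n - n / 2) (fun i => p + n / 2 + i)) σ3
  have g4 : σ4 g = xor (σ g) k := by rw [f2 g hr.fx, e3.out g hr.fx, g2]
  have k4 : carry c p σ4 (n / 2) = k := by
    rw [← k1]
    exact carry_congr fun i hi => by
      rw [f2 _ (hlow i hi), e3.out _ (hlow i hi), o2 _ (hlg i hi)]
  rw [k4, g4, Bool.xor_assoc, Bool.xor_self, Bool.xor_false]
  set σ5 := Function.update σ4 g (σ g) with hσ5
  have g5 : σ5 g = σ g := Function.update_self _ _ _
  have o5 : ∀ w, w ≠ g → σ5 w = σ4 w := fun w hw => Function.update_of_ne hw _ _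
  obtain ⟨h1, h2⟩ := run_fan hr.fx hr.x_inj σ5
  refine ⟨fun j hj => ?_, fun w hw => ?_⟩
  · have hp : pre (fun i => σ2 (p + n / 2 + i)) j = pre (fun i => σ (p + n / 2 + i)) j := by
      rw [← e1.pre_eq hj.le]
      exact pre_congr fun i hi => o2 _ (hxg i (by omega))
    rw [h1 j hj, o5 _ (hxg j hj), f1 j hj, e3.reg j hj, e3.out g hr.fx, g2, g5, hp,
      o2 _ (hxg j hj), e1.reg j hj]
    generalize σ (p + n / 2 + j) = u
    generalize pre _ j = v
    generalize σ g = q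
    revert u v q; generalize k = k'; revert k'; decide
  · rw [h2 w hw]
    by_cases hwg : w = g
    · rw [hwg, g5]
    · rw [o5 w hwg, f2 w hw, e3.out w hw, o2 w hwg, e1.out w hw]

end Step

/-! ### Recursive addition of the constant -/

/-- `σ'` arises from `σ` by adding `c` to the register of length `n` at `p`. -/
structure Adds (c : ℕ → Bool) (p n : ℕ) (σ σ' : ℕ → Bool) : Prop where
  reg : ∀ i < n, σ' (p + i) = xor (xor (σ (p + i)) (c (p + i))) (carry c p σ i)
  out : ∀ w, (∀ i < n, w ≠ p + i) → σ' w = σ w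

/-- Incrementing the upper half by the incoming carry and then adding `c` produces two carry
sequences. They are never set at the same position, and their sum is the true carry; this exclusion
makes the induction go through. -/
theorem carry_add {c σ τ : ℕ → Bool} {p l h : ℕ}
    (hτ : ∀ j < h, τ (p + l + j) = xor (σ (p + l + j))
      (carry c p σ l && pre (fun i => σ (p + l + i)) j)) :
    ∀ j ≤ h, carry c p σ (l + j) = xor (carry c p σ l && pre (fun i => σ (p + l + i)) j)
        (carry c (p + l) τ j) ∧
      ((carry c p σ l && pre (fun i => σ (p + l + i)) j) && carry c (p + l) τ j) = false := by
  intro j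
  induction j with
  | zero => simp [pre, carry]
  | succ j ih =>
    intro hj
    obtain ⟨i1, i2⟩ := ih (by omega)
    rw [← add_assoc, carry, i1, pre, carry, hτ j (by omega), ← add_assoc, ← Bool.and_assoc]
    clear ih i1
    revert i2
    generalize (carry c p σ l && pre (fun i => σ (p + l + i)) j) = u
    generalize carry c (p + l) τ j = v
    generalize σ (p + l + j) = w
    generalize c (p + l + j) = z
    revert u v w z; decide

/-- Adds `c` to the two halves of a register separately. -/
noncomputable def addHalves (c : ℕ → Bool) (p n : ℕ) : NCircuit :=
  if n = 0 then [] else if n = 1 then (if c p then [⟨[], p⟩] else []) else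
    step c p (n / 2) (p + n / 2) ++ (step c (p + n / 2) (n - n / 2) p ++
      (addHalves c p (n / 2) ++ addHalves c (p + n / 2) (n - n / 2)))
termination_by n

/-- Adds `c` to a register, by means of the borrowed wire `g`. -/
noncomputable def addConst (c : ℕ → Bool) (p n g : ℕ) : NCircuit := step c p n g ++ addHalves c p n

/-- Two successive steps of logarithmic depth are absorbed by the increment of the squared
logarithm. The recursive calls act on disjoint halves, so only the deeper one counts. -/
theorem addHalves_bd (c : ℕ → Bool) (p n : ℕ) : Bd {w | p ≤ w ∧ w < p + n} (addHalves c p n)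
    (50000000 * (Nat.clog 2 n + 1) ^ 2) (100000 * (n * (Nat.clog 2 n + 1))) := by
  induction n using Nat.strong_induction_on generalizing p with
  | _ n ih =>
    rw [addHalves]
    split_ifs with h0 h1 hc
    · exact Bd.nil'
    · subst h1
      exact (Bd.gate (by simp) (by simp) (by simp) (by simp)).weaken (by simp) (by simp)
    · exact Bd.nil'
    · have hk := clog_half (n := n) (by omega)
      have hk1 : Nat.clog 2 (n / 2) ≤ Nat.clog 2 ((n + 1) / 2) := Nat.clog_mono_right 2 (by omega)
      have hn : n - n / 2 = (n + 1) / 2 := by omega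
      have hA := (step_bd (c := c) (p := p) (n := n / 2) (g := p + n / 2) (by omega)).mono
        (T := {w | p ≤ w ∧ w < p + n}) (by
          rintro w (rfl | ⟨h1, h2⟩) <;> exact ⟨by omega, by omega⟩) le_rfl le_rfl
      have hB := (step_bd (c := c) (p := p + n / 2) (n := n - n / 2) (g := p) (by omega)).mono
        (T := {w | p ≤ w ∧ w < p + n}) (by
          rintro w (rfl | ⟨h1, h2⟩) <;> exact ⟨by omega, by omega⟩) le_rfl le_rfl
      have iA := ih (n / 2) (by omega) p
      have iB := ih (n - n / 2) (by omega) (p + n / 2)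
      rw [hn] at *
      generalize Nat.clog 2 ((n + 1) / 2) = k at *
      generalize Nat.clog 2 (n / 2) = k' at *
      rw [hk]
      have iA' := iA.weaken (e := 50000000 * (k + 1) ^ 2) (l := 100000 * (n / 2 * (k + 1)))
        (by gcongr) (by gcongr)
      have iP := (iA'.par iB (by
        rw [Set.disjoint_left]
        rintro w ⟨h1, h2⟩ ⟨h3, h4⟩
        omega)).mono (T := {w | p ≤ w ∧ w < p + n}) (by
          rintro w (⟨h1, h2⟩ | ⟨h1, h2⟩) <;> exact ⟨by omega, by omega⟩) le_rfl le_rfl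
      refine (hA.seq (hB.seq iP)).weaken ?_ ?_
      · nlinarith
      · have : n / 2 + (n + 1) / 2 = n := by omega
        have e : n / 2 * (k + 1) + (n + 1) / 2 * (k + 1) = n * (k + 1) := by
          rw [← Nat.add_mul, this]
        nlinarith

theorem addConst_bd (c : ℕ → Bool) {p n g : ℕ} (hg : g < p ∨ p + n ≤ g) :
    Bd {w | w = g ∨ p ≤ w ∧ w < p + n} (addConst c p n g)
      (100000000 * (Nat.clog 2 n + 1) ^ 2) (200000 * (n * (Nat.clog 2 n + 1))) := by
  refine ((step_bd hg).seq ((addHalves_bd c p n).mono (fun w hw => Or.inr hw) le_rfl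
    le_rfl)).weaken ?_ ?_
  · nlinarith
  · nlinarith

/-- `σ'` arises from `σ` by adding `c` to the two halves of the register separately. -/
structure AddsHalves (c : ℕ → Bool) (p n : ℕ) (σ σ' : ℕ → Bool) : Prop where
  lower : ∀ i < n / 2, σ' (p + i) = xor (xor (σ (p + i)) (c (p + i))) (carry c p σ i)
  upper : ∀ i < n - n / 2, σ' (p + n / 2 + i) =
    xor (xor (σ (p + n / 2 + i)) (c (p + n / 2 + i))) (carry c (p + n / 2) σ i)
  out : ∀ w, (∀ i < n, w ≠ p + i) → σ' w = σ w

/-- `step` leaves the lower half unchanged, so its addition is as before, and `carry_add`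
reassembles the upper half. -/
theorem AddsHalves.adds {c : ℕ → Bool} {p n g : ℕ} (hg : g < p ∨ p + n ≤ g) {σ σ' : ℕ → Bool}
    (h : AddsHalves c p n (run (step c p n g) σ) σ') : Adds c p n σ σ' := by
  obtain ⟨s1, s2⟩ := run_step (c := c) hg σ
  set τ := run (step c p n g) σ
  obtain ⟨r1, r2, r3⟩ := h
  have low : ∀ i < n / 2, τ (p + i) = σ (p + i) := fun i hi => s2 _ fun j hj => by omega
  refine ⟨fun i hi => ?_, fun w hw => ?_⟩
  · rcases Nat.lt_or_ge i (n / 2) with hi' | hi'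
    · rw [r1 i hi', low i hi', carry_congr fun j hj => low j (by omega)]
    · obtain ⟨j, rfl⟩ := Nat.exists_eq_add_of_le hi'
      have := (carry_add s1 j (by omega)).1
      rw [← add_assoc, r2 j (by omega), s1 j (by omega), this]
      generalize σ (p + n / 2 + j) = u
      generalize c (p + n / 2 + j) = v
      generalize (carry c p σ (n / 2) && _) = w
      generalize carry c (p + n / 2) τ j = z
      revert u v w z; decide
  · rw [r3 w hw, s2 w]
    intro j hj
    have := hw (n / 2 + j) (by omega)
    omega

theorem run_addHalves (c : ℕ → Bool) (p n : ℕ) (σ : ℕ → Bool) :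
    AddsHalves c p n σ (run (addHalves c p n) σ) := by
  induction n using Nat.strong_induction_on generalizing p σ with
  | _ n ih =>
    rw [addHalves]
    split_ifs with h0 h1 hc
    · subst h0; exact ⟨by simp, by simp, fun _ _ => rfl⟩
    · subst h1
      refine ⟨by simp, fun i hi => ?_, fun w hw => ?_⟩
      · obtain rfl : i = 0 := by omega
        simp [run_single, carry, hc]
      · rw [run_single, Function.update_of_ne (by simpa using hw 0)]
    · subst h1
      refine ⟨by simp, fun i hi => ?_, fun w hw => ?_⟩
      · obtain rfl : i = 0 := by omega
        simp [carry, hc]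
      · rfl
    · have full : ∀ q m g, m < n → (g < q ∨ q + m ≤ g) → ∀ σ,
          Adds c q m σ (run (addHalves c q m) (run (step c q m g) σ)) :=
        fun q m g hm hg σ => (ih m hm q _).adds hg
      rw [run_append, run_append, run_append]
      have hAb := addHalves_bd c p (n / 2)
      have hBb := addHalves_bd c (p + n / 2) (n - n / 2)
      have fA := full p (n / 2) (p + n / 2) (by omega) (by omega) σ
      obtain ⟨-, sA⟩ := run_step (c := c) (p := p) (n := n / 2) (g := p + n / 2) (by omega) σ
      set σ1 := run (step c p (n / 2) (p + n / 2)) σ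
      have fB := full (p + n / 2) (n - n / 2) p (by omega) (by omega) σ1
      obtain ⟨-, sB⟩ := run_step (c := c) (p := p + n / 2) (n := n - n / 2) (g := p) (by omega) σ1
      set σ2 := run (step c (p + n / 2) (n - n / 2) p) σ1
      have h21 : ∀ w, w < p + n / 2 → σ2 w = σ1 w := fun w hw => sB w fun j hj => by omega
      have h1 : ∀ w, p + n / 2 ≤ w → σ1 w = σ w := fun w hw => sA w fun j hj => by omega
      set σ3 := run (addHalves c p (n / 2)) σ2
      have h32 : ∀ w, p + n / 2 ≤ w → σ3 w = σ2 w := fun w hw =>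
        hAb.run_of_notMem (by rintro ⟨h3, h4⟩; omega)
      refine ⟨fun i hi => ?_, fun i hi => ?_, fun w hw => ?_⟩
      · rw [hBb.run_of_notMem (by rintro ⟨h3, h4⟩; omega), ← fA.reg i hi]
        exact hAb.run_congr (fun w hw => h21 w hw.2) _ ⟨by omega, by omega⟩
      · rw [hBb.run_congr (fun w hw => h32 w hw.1) _ ⟨by omega, by omega⟩, fB.reg i hi,
          h1 _ (by omega), carry_congr fun j hj => h1 _ (by omega)]
      · have hw' : ¬ (p ≤ w ∧ w < p + n) := fun h => hw (w - p) (by omega) (by omega)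
        have h3 : σ3 w = σ2 w := hAb.run_of_notMem (by rintro ⟨h3, h4⟩; omega)
        rw [hBb.run_of_notMem (by rintro ⟨h3, h4⟩; omega), h3, sB w (fun j hj => by omega),
          sA w fun j hj => by omega]

theorem run_addConst (c : ℕ → Bool) {p n g : ℕ} (hg : g < p ∨ p + n ≤ g) (σ : ℕ → Bool) :
    Adds c p n σ (run (addConst c p n g) σ) := by
  rw [addConst, run_append]
  exact (run_addHalves c p n _).adds hg

/-! ### Lower bounds on the number of gates -/

theorem layer_length (n : ℕ) (cs : ℕ → List ℕ) (t : ℕ → ℕ) : (layer n cs t).length = n := by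
  induction n with
  | zero => rfl
  | succ n ih => rw [layer_succ, List.length_append, ih]; rfl

theorem le_fan_length (c n : ℕ) (e : ℕ → ℕ) : n ≤ (fan c n e).length := by
  induction n using Nat.strong_induction_on generalizing e with
  | _ n ih =>
    rw [fan]
    split_ifs with h0 h1
    · omega
    · subst h1; simp
    · have := ih ((n + 1) / 2) (by omega) fun i => e (2 * i)
      simp only [List.length_append, layer_length]
      omega

theorem le_step_length (c : ℕ → Bool) (p n g : ℕ) : n - n / 2 ≤ (step c p n g).length := by
  have := le_fan_length g (n - n / 2) fun i => p + n / 2 + i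
  simp only [step, List.length_append]
  omega

/-- The two steps of a level have at least n/2 gates together, from the fan-outs alone, for each of
the log n levels below the top. The summand `n` is the missing top level, supplied in
`le_addConst_length`. -/
theorem le_addHalves_length (c : ℕ → Bool) (p n : ℕ) :
    n * Nat.log 2 n ≤ 2 * (addHalves c p n).length + n := by
  induction n using Nat.strong_induction_on generalizing p with
  | _ n ih =>
    rw [addHalves]
    split_ifs with h0 h1 hc
    · subst h0; simp
    · subst h1; simp
    · subst h1; simp
    · have hk : Nat.log 2 n = Nat.log 2 (n / 2) + 1 := Nat.log_of_one_lt_of_le one_lt_two (by omega)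
      have hk' : Nat.log 2 (n / 2) ≤ Nat.log 2 (n - n / 2) := Nat.log_mono_right (by omega)
      have iA := ih (n / 2) (by omega) p
      have iB := ih (n - n / 2) (by omega) (p + n / 2)
      have sA := le_step_length c p (n / 2) (p + n / 2)
      have sB := le_step_length c (p + n / 2) (n - n / 2) p
      have iB' := (Nat.mul_le_mul_left (n - n / 2) hk').trans iB
      have e : n * Nat.log 2 (n / 2) =
          n / 2 * Nat.log 2 (n / 2) + (n - n / 2) * Nat.log 2 (n / 2) := by
        rw [← Nat.add_mul]; congr 1; omega
      rw [hk, Nat.mul_succ, e]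
      simp only [List.length_append]
      omega

theorem le_addConst_length (c : ℕ → Bool) (p n g : ℕ) :
    n * Nat.log 2 n ≤ 2 * (addConst c p n g).length := by
  have h1 := le_addHalves_length c p n
  have h2 := le_step_length c p n g
  rw [addConst, List.length_append]
  omega

/-! ### Depth -/

/-- The wires of a gate. -/
def NGate.wires (g : NGate) : Finset ℕ := insert g.target g.controls.toFinset

/-- The last time steps in which the wires have been used, after one more gate. -/
def NGate.advance (t : ℕ → ℕ) (g : NGate) : ℕ → ℕ :=
  fun w => if w ∈ g.wires then g.wires.sup t + 1 else t w

/-- The last time steps in which the wires have been used, after a circuit. -/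
def times (C : NCircuit) (t : ℕ → ℕ) : ℕ → ℕ := C.foldl NGate.advance t

theorem times_append (C D : NCircuit) (t : ℕ → ℕ) : times (C ++ D) t = times D (times C t) := by
  simp [times]

theorem NGate.le_advance (g : NGate) (t : ℕ → ℕ) (w : ℕ) : t w ≤ g.advance t w := by
  unfold NGate.advance
  split_ifs with h
  · exact (Finset.le_sup h).trans (Nat.le_succ _)
  · exact le_rfl

theorem le_times (C : NCircuit) (t : ℕ → ℕ) (w : ℕ) : t w ≤ times C t w := by
  induction C generalizing t with
  | nil => exact le_rfl
  | cons g C ih => exact (g.le_advance t w).trans (ih _)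

theorem lt_times {C : NCircuit} {g : NGate} (hg : g ∈ C) {v w : ℕ} (hv : v ∈ g.wires)
    (hw : w ∈ g.wires) (t : ℕ → ℕ) : t v < times C t w := by
  obtain ⟨A, B, rfl⟩ := List.append_of_mem hg
  rw [times_append]
  refine lt_of_lt_of_le ?_ (le_times B _ w)
  simp only [NGate.advance, if_pos hw]
  exact Nat.lt_succ_of_le ((le_times A t v).trans (Finset.le_sup hv))

theorem mem_layer {n : ℕ} {cs : ℕ → List ℕ} {t : ℕ → ℕ} {i : ℕ} (hi : i < n) :
    (⟨cs i, t i⟩ : NGate) ∈ layer n cs t := by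
  simp only [layer, parN, List.mem_flatMap, List.mem_range, List.mem_singleton]
  exact ⟨i, hi, rfl⟩

/-- The wire `e 0` stays at the front throughout the recursion: it is the target of the innermost
gate controlled by `c` and takes part in the closing layer of every level. -/
theorem lt_times_fan (c : ℕ) {n : ℕ} (hn : 1 ≤ n) (e : ℕ → ℕ) (t : ℕ → ℕ) :
    t c + Nat.clog 2 n < times (fan c n e) t (e 0) := by
  induction n using Nat.strong_induction_on generalizing e t with
  | _ n ih =>
    rw [fan, if_neg (by omega)]
    split_ifs with h1
    · subst h1
      rw [Nat.clog_one_right, add_zero]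
      exact lt_times (List.mem_singleton_self _) (by simp [NGate.wires]) (by simp [NGate.wires]) t
    · rw [times_append, times_append, clog_half (by omega)]
      set L := layer (n / 2) (fun i => [e (2 * i)]) (fun i => e (2 * i + 1)) with hL
      have h2 := le_times L t c
      have h3 := ih ((n + 1) / 2) (by omega) (by omega) (fun i => e (2 * i)) (times L t)
      have h4 := lt_times (C := L) (v := e 0) (w := e 0) (mem_layer (i := 0) (by omega))
        (by simp [NGate.wires]) (by simp [NGate.wires])
        (times (fan c ((n + 1) / 2) (fun i => e (2 * i))) (times L t))
      simp only [mul_zero] at h3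
      omega

theorem le_times_step (c : ℕ → Bool) (p : ℕ) {n : ℕ} (hn : 1 ≤ n) (g : ℕ) (t : ℕ → ℕ) :
    t g + Nat.log 2 n ≤ times (step c p n g) t (p + n / 2) := by
  have hk : Nat.log 2 n ≤ Nat.clog 2 (n - n / 2) + 1 := by
    rcases Nat.lt_or_ge n 2 with h | h
    · have : n = 1 := by omega
      subst this; simp
    · refine (Nat.log_le_clog 2 n).trans ?_
      rw [clog_half h, show n - n / 2 = (n + 1) / 2 by omega]
  rw [step, ← List.append_assoc, ← List.append_assoc, ← List.append_assoc, ← List.append_assoc,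
    times_append]
  set C := negIncUpper p n g ++ addCarry c p (n / 2) g ++ negIncUpper p n g ++
    fan g (n - n / 2) (fun i => p + n / 2 + i) ++ addCarry c p (n / 2) g
  have h1 := le_times C t g
  have h2 := lt_times_fan g (n := n - n / 2) (by omega) (fun i => p + n / 2 + i) (times C t)
  simp only [add_zero] at h2
  omega

/-- The fan-out closing the step on the lower half ends on that half's middle wire, the wire
borrowed by the first step inside the recursive call. Thus a chain through `t (p + n / 2)` grows by
log(n/2) at each level, and these terms sum to a quadratic in log n. -/
theorem le_times_addHalves (c : ℕ → Bool) (p : ℕ) {n : ℕ} (hn : 1 ≤ n) (t : ℕ → ℕ) :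
    ∃ w, p ≤ w ∧ w < p + n ∧ 2 * t (p + n / 2) + (Nat.log 2 n - 1) * Nat.log 2 n ≤
      2 * times (addHalves c p n) t w := by
  induction n using Nat.strong_induction_on generalizing t with
  | _ n ih =>
    rcases Nat.lt_or_ge n 2 with h | h
    · have : n = 1 := by omega
      subst this
      refine ⟨p, by omega, by omega, ?_⟩
      have := le_times (addHalves c p 1) t p
      simpa using this
    · have hk : Nat.log 2 n = Nat.log 2 (n / 2) + 1 := Nat.log_of_one_lt_of_le one_lt_two (by omega)
      rw [addHalves, if_neg (by omega), if_neg (by omega)]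
      simp only [times_append]
      have h1 := le_times_step c p (n := n / 2) (by omega) (p + n / 2) t
      set t1 := times (step c p (n / 2) (p + n / 2)) t
      have h2 := le_times (step c (p + n / 2) (n - n / 2) p) t1 (p + n / 2 / 2)
      set t2 := times (step c (p + n / 2) (n - n / 2) p) t1
      obtain ⟨w, hw, hw', h3⟩ := ih (n / 2) (by omega) (by omega) t2
      have h4 := le_times (addHalves c (p + n / 2) (n - n / 2)) (times (addHalves c p (n / 2)) t2) w
      refine ⟨w, hw, by omega, ?_⟩
      have e : (Nat.log 2 n - 1) * Nat.log 2 n =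
          (Nat.log 2 (n / 2) - 1) * Nat.log 2 (n / 2) + 2 * Nat.log 2 (n / 2) := by
        rw [hk]
        cases Nat.log 2 (n / 2) with
        | zero => rfl
        | succ k => simp only [Nat.add_sub_cancel]; ring
      omega

theorem le_times_addConst (c : ℕ → Bool) (p : ℕ) {n : ℕ} (hn : 1 ≤ n) (g : ℕ) (t : ℕ → ℕ) :
    ∃ w, p ≤ w ∧ w < p + n ∧ Nat.log 2 n ^ 2 ≤ 2 * times (addConst c p n g) t w := by
  have h1 := le_times_step c p hn g t
  obtain ⟨w, hw, hw', h2⟩ := le_times_addHalves c p hn (times (step c p n g) t)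
  refine ⟨w, hw, hw', ?_⟩
  rw [addConst, times_append, sq]
  refine le_trans ?_ h2
  cases h : Nat.log 2 n with
  | zero => simp
  | succ k => rw [h] at h1; simp only [Nat.add_sub_cancel]; nlinarith

theorem Bd.times_of_notMem {S : Set ℕ} {C : NCircuit} {d k : ℕ} (h : Bd S C d k) :
    ∀ {t : ℕ → ℕ} {w : ℕ}, w ∉ S → times C t w = t w := by
  induction h with
  | nil => intros; rfl
  | @gate S cs a h hl ht hc =>
    intro t w hw
    refine if_neg ?_
    simp only [NGate.wires, Finset.mem_insert, List.mem_toFinset, not_or]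
    exact ⟨fun e => hw (e ▸ ht), fun hm => hw (hc w hm)⟩
  | seq _ _ ih ih' => intro t w hw; rw [times_append, ih' hw, ih hw]
  | par _ _ _ ih ih' =>
    intro t w hw
    rw [times_append, ih' fun h => hw (Or.inr h), ih fun h => hw (Or.inl h)]
  | mono _ hS _ _ ih => intro t w hw; exact ih fun h => hw (hS h)

/-- Executing gates as early as possible is no slower than the schedule recorded by `Bd`; parallel
parts do not delay each other because they share no wire. -/
theorem Bd.times_le {S : Set ℕ} {C : NCircuit} {d k : ℕ} (h : Bd S C d k) :
    ∀ {t : ℕ → ℕ} {T : ℕ}, (∀ w ∈ S, t w ≤ T) → ∀ w ∈ S, times C t w ≤ T + d := by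
  induction h with
  | nil => intro t T h w hw; exact absurd hw (Set.notMem_empty _)
  | @gate S cs a h hl ht hc =>
    intro t T hT w hw
    change NGate.advance t ⟨cs, a⟩ w ≤ _
    unfold NGate.advance
    split_ifs
    · refine Nat.succ_le_succ (Finset.sup_le fun v hv => hT v ?_)
      simp only [NGate.wires, Finset.mem_insert, List.mem_toFinset] at hv
      rcases hv with rfl | hv
      · exact ht
      · exact hc v hv
    · exact (hT w hw).trans (Nat.le_succ _)
  | seq _ _ ih ih' =>
    intro t T hT w hw
    rw [times_append, ← add_assoc]
    exact ih' (ih hT) w hw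
  | @par S S' C D d k l h h' hST ih ih' =>
    intro t T hT w hw
    rw [times_append]
    by_cases hS : w ∈ S
    · rw [h'.times_of_notMem (Set.disjoint_left.1 hST hS)]
      exact ih (fun w hw => hT w (Or.inl hw)) w hS
    · refine ih' (fun v hv => ?_) w (hw.resolve_left hS)
      rw [h.times_of_notMem (Set.disjoint_right.1 hST hv)]
      exact hT v (Or.inr hv)
  | @mono S S' C d e k l h hS hd hk ih =>
    intro t T hT w hw
    by_cases hwS : w ∈ S
    · exact (ih (fun w hw => hT w (hS hw)) w hwS).trans (by omega)
    · rw [h.times_of_notMem hwS]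
      exact (hT w hw).trans (by omega)

/-! ### Circuits on finitely many wires -/

/-- The gates that a circuit may use on `m` wires. -/
def NGate.Valid (m : ℕ) (g : NGate) : Prop :=
  g.target ∉ g.controls ∧ g.controls.length ≤ 2 ∧ g.target < m ∧ ∀ c ∈ g.controls, c < m

theorem Bd.valid {S : Set ℕ} {C : NCircuit} {d k m : ℕ} (h : Bd S C d k) :
    (∀ w ∈ S, w < m) → ∀ g ∈ C, g.Valid m := by
  induction h with
  | nil => simp
  | gate h hl ht hc =>
    intro hS g hg
    rw [List.mem_singleton.1 hg]
    exact ⟨h, hl, hS _ ht, fun c hcs => hS _ (hc c hcs)⟩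
  | seq _ _ ih ih' =>
    intro hS g hg
    exact (List.mem_append.1 hg).elim (ih hS g) (ih' hS g)
  | par _ _ _ ih ih' =>
    intro hS g hg
    exact (List.mem_append.1 hg).elim (ih (fun w hw => hS w (Or.inl hw)) g)
      (ih' (fun w hw => hS w (Or.inr hw)) g)
  | mono _ hST _ _ ih => intro hS; exact ih fun w hw => hS w (hST hw)

/-- A gate on `m` wires. -/
def NGate.toGate {m : ℕ} (g : NGate) (h : g.Valid m) : Gate m where
  controls := Finset.univ.filter fun i => i.val ∈ g.controls
  target := ⟨g.target, h.2.2.1⟩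
  target_notMem := by simpa using h.1
  card_le := by
    refine le_trans ?_ ((List.toFinset_card_le g.controls).trans h.2.1)
    exact Finset.card_le_card_of_injOn Fin.val (by intro i hi; simpa using hi)
      Fin.val_injective.injOn

/-- A circuit on `m` wires. -/
def toCircuit {m : ℕ} (C : NCircuit) (h : ∀ g ∈ C, g.Valid m) : Circuit m :=
  C.pmap (fun g hg => g.toGate hg) h

/-- Extends an assignment of bits to `m` wires by `false`. -/
def extend {m : ℕ} (x : Bits m) (w : ℕ) : Bool := if h : w < m then x ⟨w, h⟩ else false

theorem extend_val {m : ℕ} (x : Bits m) (i : Fin m) : extend x i = x i := by simp [extend]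

theorem extend_toGate {m : ℕ} (g : NGate) (h : g.Valid m) (x : Bits m) :
    extend ((g.toGate h).act x) = g.act (extend x) := by
  have hall : decide (∀ i ∈ (g.toGate h).controls, x i = true) = g.controls.all (extend x) := by
    rw [Bool.eq_iff_iff, decide_eq_true_iff, List.all_eq_true]
    constructor
    · intro hx c hc
      have := hx ⟨c, h.2.2.2 c hc⟩ (by simpa [NGate.toGate] using hc)
      simpa [extend, h.2.2.2 c hc] using this
    · intro hx i hi
      rw [← extend_val x i]
      exact hx _ (by simpa [NGate.toGate] using hi)
  ext w
  rw [NGate.act, Gate.act, hall]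
  by_cases hw : w = g.target
  · subst hw
    have : extend x g.target = x ⟨g.target, h.2.2.1⟩ := extend_val x ⟨g.target, h.2.2.1⟩
    rw [Function.update_self, this]
    simp [extend, h.2.2.1, NGate.toGate]
  · rw [Function.update_of_ne hw]
    by_cases hm : w < m
    · simp only [extend, hm, dif_pos]
      rw [Function.update_of_ne]
      simpa [NGate.toGate, Fin.ext_iff] using hw
    · simp [extend, hm]

/-- The map on bit strings performed by a circuit. -/
def Circuit.act {m : ℕ} (C : Circuit m) (x : Bits m) : Bits m := C.foldl (fun x g => g.act x) x

theorem extend_toCircuit {m : ℕ} (C : NCircuit) (h : ∀ g ∈ C, g.Valid m) (x : Bits m) :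
    extend ((toCircuit C h).act x) = run C (extend x) := by
  induction C generalizing x with
  | nil => rfl
  | cons g C ih =>
    rw [run_cons, ← extend_toGate g (h g (by simp)), ← ih fun g hg => h g (by simp [hg])]
    rfl

theorem wires_toGate {m : ℕ} (g : NGate) (h : g.Valid m) :
    (g.toGate h).wires.map Fin.valEmbedding = g.wires := by
  ext w
  simp only [Gate.wires, NGate.wires, NGate.toGate, Finset.mem_map, Finset.mem_insert,
    Finset.mem_filter, Finset.mem_univ, true_and, Fin.valEmbedding_apply, List.mem_toFinset]
  constructor
  · rintro ⟨i, rfl | hi, rfl⟩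
    · exact Or.inl rfl
    · exact Or.inr hi
  · rintro (rfl | hw)
    · exact ⟨_, Or.inl rfl, rfl⟩
    · exact ⟨⟨w, h.2.2.2 w hw⟩, Or.inr hw, rfl⟩

theorem advance_toGate {m : ℕ} (g : NGate) (h : g.Valid m) (t : ℕ → ℕ) :
    Gate.advance (fun i => t i.val) (g.toGate h) = fun i => g.advance t i.val := by
  ext i
  have h1 : i ∈ (g.toGate h).wires ↔ i.val ∈ g.wires := by
    rw [← wires_toGate g h, Finset.mem_map]
    exact ⟨fun hi => ⟨i, hi, rfl⟩, fun ⟨j, hj, e⟩ => Fin.val_injective e ▸ hj⟩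
  have h2 : (g.toGate h).wires.sup (fun i => t i.val) = g.wires.sup t := by
    rw [← wires_toGate g h, Finset.sup_map]; rfl
  simp only [Gate.advance, NGate.advance, h1, h2]

theorem advance_toCircuit {m : ℕ} (C : NCircuit) (h : ∀ g ∈ C, g.Valid m) (t : ℕ → ℕ) :
    (toCircuit C h).foldl Gate.advance (fun i => t i.val) = fun i => times C t i.val := by
  induction C generalizing t with
  | nil => rfl
  | cons g C ih =>
    have := ih (fun g hg => h g (by simp [hg])) (g.advance t)
    rw [← advance_toGate g (h g (by simp))] at this
    exact this

theorem depth_toCircuit_le {m : ℕ} {C : NCircuit} {S : Set ℕ} {d k : ℕ} (hb : Bd S C d k)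
    (h : ∀ g ∈ C, g.Valid m) : (toCircuit C h).depth ≤ d := by
  refine Finset.sup_le fun i _ => ?_
  have e := advance_toCircuit C h fun _ => 0
  rw [e]
  change times C (fun _ => 0) i.val ≤ d
  by_cases hi : i.val ∈ S
  · simpa using hb.times_le (t := fun _ => 0) (T := 0) (by simp) _ hi
  · rw [hb.times_of_notMem hi]; exact Nat.zero_le _

theorem le_depth_toCircuit {m : ℕ} {C : NCircuit} (h : ∀ g ∈ C, g.Valid m) {w : ℕ} (hw : w < m) :
    times C (fun _ => 0) w ≤ (toCircuit C h).depth := by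
  have e := advance_toCircuit C h fun _ => 0
  have := Finset.le_sup (f := (toCircuit C h).foldl Gate.advance fun _ => 0)
    (Finset.mem_univ (⟨w, hw⟩ : Fin m))
  rw [e] at this
  rw [Circuit.depth, e]
  exact this

theorem gateCount_toCircuit {m : ℕ} {C : NCircuit} (h : ∀ g ∈ C, g.Valid m) :
    (toCircuit C h).gateCount = C.length := List.length_pmap

/-! ### Operators -/

theorem basisOp_apply {m : ℕ} {f : Bits m → Bits m} (hf : Function.Injective f) (ψ : QState m)
    (x : Bits m) : basisOp f ψ (f x) = ψ x := by
  rw [basisOp, Module.Basis.constr_apply_fintype]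
  simp [ket, Pi.single_apply, hf.eq_iff]

theorem op_eq_basisOp {m : ℕ} (C : Circuit m) : C.op = basisOp C.act := by
  refine (EuclideanSpace.basisFun (Bits m) ℂ).toBasis.ext fun x => ?_
  have e : (EuclideanSpace.basisFun (Bits m) ℂ).toBasis x = ket x := by simp [ket]
  rw [e, basisOp_ket]
  clear e
  induction C generalizing x with
  | nil => rfl
  | cons g C ih =>
    rw [Circuit.op, LinearMap.comp_apply, basisOp_ket, ih]
    rfl

/-- A reversible circuit permutes the basis, so amplitudes can be compared at the images of basis
labels. Correctness for every ancilla bit then gives correctness for arbitrary product states by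
linearity. -/
theorem implementsWithDirtyAncilla_of_act {n : ℕ} {C : Circuit (n + 1)} {f : Bits n → Bits n}
    (hC : Function.Injective C.act) (hinit : ∀ y, Fin.init (C.act y) = f (Fin.init y))
    (hlast : ∀ y, C.act y (Fin.last n) = y (Fin.last n)) :
    C.ImplementsWithDirtyAncilla (basisOp f) := by
  intro ψ φ
  have hf : Function.Injective f := by
    intro x x' hx
    have : C.act (Fin.snoc x false) = C.act (Fin.snoc x' false) := by
      rw [← Fin.snoc_init_self (C.act (Fin.snoc x false)),
        ← Fin.snoc_init_self (C.act (Fin.snoc x' false)), hinit, hinit, hlast, hlast]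
      simp [hx]
    have := congrArg Fin.init (hC this)
    simpa using this
  ext z
  obtain ⟨y, rfl⟩ := Finite.surjective_of_injective hC z
  rw [op_eq_basisOp, basisOp_apply hC]
  simp only [tensorLast]
  rw [hinit, hlast, basisOp_apply hf]

/-! ### The adder -/

theorem carry_eq_bitVec_carry {n : ℕ} (c x : Bits n) (σ : ℕ → Bool) (hσ : ∀ i : Fin n, σ i = x i)
    {i : ℕ} (hi : i ≤ n) : carry (extend c) 0 σ i =
      BitVec.carry i (BitVec.ofNat n (Nat.ofBits x)) (BitVec.ofNat n (Nat.ofBits c)) false := by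
  induction i with
  | zero => simp [carry]
  | succ i ih =>
    have e : ∀ y : Bits n, (BitVec.ofNat n (Nat.ofBits y)).getLsbD i = y ⟨i, hi⟩ := fun y => by
      rw [BitVec.getLsbD_ofNat, Nat.testBit_ofBits_lt _ _ hi]
      simp; omega
    rw [carry, ih (by omega), BitVec.carry_succ, e, e, zero_add, hσ ⟨i, hi⟩]
    congr 1
    exact extend_val c ⟨i, hi⟩

theorem addBits_apply {n : ℕ} (c x : Bits n) (σ : ℕ → Bool) (hσ : ∀ i : Fin n, σ i = x i)
    (i : Fin n) : addBits c x i = xor (xor (x i) (c i)) (carry (extend c) 0 σ i) := by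
  have e : ∀ y : Bits n, (BitVec.ofNat n (Nat.ofBits y)).getLsbD i = y i := fun y => by
    rw [BitVec.getLsbD_ofNat, Nat.testBit_ofBits_lt _ _ i.2]
    simp
  have h := BitVec.getLsbD_add (w := n) (i := i) i.2 (BitVec.ofNat n (Nat.ofBits x))
    (BitVec.ofNat n (Nat.ofBits c))
  rw [e, e, ← carry_eq_bitVec_carry c x σ hσ i.2.le, ← BitVec.ofNat_add, BitVec.getLsbD_ofNat] at h
  rw [addBits, Nat.testBit_mod_two_pow, h, Bool.xor_assoc]

theorem adder_bd {n : ℕ} (c : Bits n) : Bd {w | w = n ∨ 0 ≤ w ∧ w < 0 + n}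
    (addConst (extend c) 0 n n) (100000000 * (Nat.clog 2 n + 1) ^ 2)
      (200000 * (n * (Nat.clog 2 n + 1))) := addConst_bd _ (Or.inr (by omega))

theorem adder_valid {n : ℕ} (c : Bits n) : ∀ g ∈ addConst (extend c) 0 n n, g.Valid (n + 1) :=
  (adder_bd c).valid (by rintro w (rfl | ⟨-, h⟩) <;> omega)

/-- The circuit for the adder. -/
noncomputable def adderCircuit (n : ℕ) (c : Bits n) : Circuit (n + 1) :=
  toCircuit (addConst (extend c) 0 n n) (adder_valid c)

theorem adderCircuit_implements (n : ℕ) (c : Bits n) :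
    (adderCircuit n c).ImplementsWithDirtyAncilla (adder c) := by
  have hb := adder_bd c
  have hrun : ∀ y, Adds (extend c) 0 n (extend y) (extend ((adderCircuit n c).act y)) := fun y => by
    rw [adderCircuit, extend_toCircuit]
    exact run_addConst _ (Or.inr (by omega)) _
  refine implementsWithDirtyAncilla_of_act ?_ ?_ ?_
  · intro y y' h
    have h1 : extend y = extend y' := by
      rw [← hb.run_reverse_run (extend y), ← hb.run_reverse_run (extend y'),
        ← extend_toCircuit _ (adder_valid c), ← extend_toCircuit _ (adder_valid c)]
      exact congrArg (fun z => run _ (extend z)) h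
    ext i
    rw [← extend_val y, h1, extend_val]
  · intro y
    ext i
    have h1 := (hrun y).reg i i.2
    rw [zero_add] at h1
    have e : ∀ (z : Bits (n + 1)) (i : Fin n), extend z i = Fin.init z i := fun z i =>
      extend_val z i.castSucc
    rw [addBits_apply c (Fin.init y) (extend y) (e y), ← e y, ← extend_val c, ← h1]
    exact (e _ i).symm
  · intro y
    rw [← extend_val (Circuit.act _ y), ← extend_val y]
    exact (hrun y).out _ fun i hi => by simp; omega

end QCircuit

/-! ### Passage from binary to natural logarithms -/

theorem mainTheorem4 :
    ∃ C : (n : ℕ) → QCircuit.Bits n → QCircuit.Circuit (n + 1),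
      (∀ (n : ℕ) (c : QCircuit.Bits n),
        (C n c).ImplementsWithDirtyAncilla (QCircuit.adder c)) ∧
      (∃ a A : ℝ, 0 < a ∧ 0 < A ∧ ∀ n : ℕ, 2 ≤ n → ∀ c : QCircuit.Bits n,
        a * (n * Real.log n) ≤ ((C n c).gateCount : ℝ) ∧
        ((C n c).gateCount : ℝ) ≤ A * (n * Real.log n)) ∧
      (∃ b B : ℝ, 0 < b ∧ 0 < B ∧ ∀ n : ℕ, 2 ≤ n → ∀ c : QCircuit.Bits n,
        b * Real.log n ^ 2 ≤ ((C n c).depth : ℝ) ∧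
        ((C n c).depth : ℝ) ≤ B * Real.log n ^ 2) := by
  have l2 : (1 : ℝ) / 2 ≤ Real.log 2 := by linarith [Real.log_two_gt_d9]
  have l2' : Real.log 2 ≤ 1 := by linarith [Real.log_two_lt_d9]
  -- With `k = Nat.clog 2 n - 1`, both `k ≤ 2 log n` and `2 ≤ 4 log n` follow from `1 / 2 ≤ log 2`,
  -- whence the 6.
  have upper : ∀ n : ℕ, 2 ≤ n → ((Nat.clog 2 n + 1 : ℕ) : ℝ) ≤ 6 * Real.log n := by
    intro n hn
    have h1 : Real.log 2 ≤ Real.log n := Real.log_le_log two_pos (by exact_mod_cast hn)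
    have h2 : ((Nat.clog 2 n - 1 : ℕ) : ℝ) * Real.log 2 ≤ Real.log n := by
      rw [← Real.log_pow]
      refine Real.log_le_log (by positivity) ?_
      exact_mod_cast (Nat.pow_pred_clog_lt_self one_lt_two (by omega)).le
    have h3 : 0 < Nat.clog 2 n := Nat.clog_pos one_lt_two hn
    have h4 : Nat.clog 2 n = Nat.clog 2 n - 1 + 1 := by omega
    rw [h4]
    generalize Nat.clog 2 n - 1 = k at *
    push_cast
    nlinarith [Nat.cast_nonneg (α := ℝ) k]
  have lower : ∀ n : ℕ, 2 ≤ n → Real.log n ≤ 2 * (Nat.log 2 n : ℝ) := by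
    intro n hn
    have h1 : Real.log n ≤ ((Nat.log 2 n + 1 : ℕ) : ℝ) * Real.log 2 := by
      rw [← Real.log_pow]
      refine Real.log_le_log (by positivity) ?_
      exact_mod_cast (Nat.lt_pow_succ_log_self one_lt_two n).le
    have h2 : (1 : ℝ) ≤ (Nat.log 2 n : ℝ) := by
      exact_mod_cast Nat.log_pos one_lt_two hn
    push_cast at h1
    nlinarith
  have nonneg : ∀ n : ℕ, 2 ≤ n → 0 ≤ Real.log n := fun n hn =>
    Real.log_nonneg (by exact_mod_cast (by omega : 1 ≤ n))
  -- The upper constants are 200000 · 6 and 100000000 · 6². The lower ones combine `log n ≤ 2 *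
  -- Nat.log 2 n`, squared in the case of depth, with the factor 2 in the combinatorial lower
  -- bounds.
  refine ⟨QCircuit.adderCircuit, QCircuit.adderCircuit_implements,
    ⟨1 / 4, 1200000, by norm_num, by norm_num, fun n hn c => ⟨?_, ?_⟩⟩,
    ⟨1 / 8, 3600000000, by norm_num, by norm_num, fun n hn c => ⟨?_, ?_⟩⟩⟩
  · rw [QCircuit.adderCircuit, QCircuit.gateCount_toCircuit]
    have h : ((n * Nat.log 2 n : ℕ) : ℝ) ≤ _ :=
      Nat.cast_le.2 (QCircuit.le_addConst_length (QCircuit.extend c) 0 n n)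
    push_cast at h
    have := mul_le_mul_of_nonneg_left (lower n hn) (Nat.cast_nonneg (α := ℝ) n)
    linarith
  · rw [QCircuit.adderCircuit, QCircuit.gateCount_toCircuit]
    have h : _ ≤ ((200000 * (n * (Nat.clog 2 n + 1)) : ℕ) : ℝ) :=
      Nat.cast_le.2 (QCircuit.adder_bd c).length_le
    rw [Nat.cast_mul, Nat.cast_mul] at h
    have := mul_le_mul_of_nonneg_left (upper n hn) (Nat.cast_nonneg (α := ℝ) n)
    push_cast at h this
    linarith
  · obtain ⟨w, -, hw, h⟩ := QCircuit.le_times_addConst (QCircuit.extend c) 0 (n := n) (by omega) n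
      fun _ => 0
    have h1 := QCircuit.le_depth_toCircuit (QCircuit.adder_valid c) (w := w) (by omega)
    have h2 : ((Nat.log 2 n ^ 2 : ℕ) : ℝ) ≤ ((2 * (QCircuit.adderCircuit n c).depth : ℕ) : ℝ) :=
      Nat.cast_le.2 (h.trans (Nat.mul_le_mul_left 2 h1))
    push_cast at h2
    have := pow_le_pow_left₀ (nonneg n hn) (lower n hn) 2
    linarith
  · have h : ((QCircuit.adderCircuit n c).depth : ℝ) ≤
        ((100000000 * (Nat.clog 2 n + 1) ^ 2 : ℕ) : ℝ) :=
      Nat.cast_le.2 (QCircuit.depth_toCircuit_le (QCircuit.adder_bd c) (QCircuit.adder_valid c))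
    rw [Nat.cast_mul, Nat.cast_pow] at h
    have := pow_le_pow_left₀ (Nat.cast_nonneg _) (upper n hn) 2
    push_cast at h this
    linarith
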